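/- Let $R$ be a commutative ring with identity, $G$ a discrete group with identity $\varepsilon$, and $X$ a totally disconnected, locally compact Hausdorff space. Let $\phi=(\phi_g,X_g,X)_{g\in G}$ be a partial action of $G$ on $X$ with every $X_g$ clopen: $\phi_g:X_{g^{-1}}\to X_g$ are homeomorphisms, $X_\varepsilon=X$, $\phi_\varepsilon=\mathrm{id}$, $\phi_g(X_{g^{-1}}\cap X_h)=X_g\cap X_{gh}$, and $\phi_g(\phi_h(x))=\phi_{gh}(x)$ for $x\in X_{h^{-1}}\cap X_{h^{-1}g^{-1}}$. Let $U\subseteq X$ be clopen and invariant, i.e. $\phi_g(U\cap X_{g^{-1}})\subseteq U$ for all $g\in G$, and put $U_g=X_g\cap U$. Notation. - $C_R(Y)$ is the $R$-algebra of locally constant functions $Y\to R$ with compact support, with pointwise operations. For $W\subseteq Y$ open, $C_R(W)$ is identified with the ideal of those $f\in C_R(Y)$ that vanish outside $W$. - $\mathcal G_X=\bigcup_{g\in G}\{g\}\times X_g$, with the topology inherited from $G\times X$, is the ample Hausdorff groupoid with unit space $X$, $d(g,x)=\phi_{g^{-1}}(x)$, $r(g,x)=x$, $(g,x)(h,y)=(gh,x)$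 when $\phi_{g^{-1}}(x)=y$, and $(g,x)^{-1}=(g^{-1},\phi_{g^{-1}}(x))$, graded by $(g,x)\mapsto g$. Further $\mathcal G_U=d^{-1}(U)=\bigcup_g\{g\}\times U_g$. - $A_R(\mathcal G)$ is the Steinberg algebra of $\mathcal G$: locally constant functions $\mathcal G\to R$ with compact support under the convolution $(f*f')(\gamma)=\sum_{\alpha\beta=\gamma}f(\alpha)f'(\beta)$; its $g$-component consists of the functions supported on arrows of degree $g$. - $\mathcal G_X^{(h)}$ is the inverse semigroup of compact open bisections $B$ of $\mathcal G_X$ contained in $\{g\}\times X_g$ for some $g$. It acts partially on $U$ by $U_B=r(B)\cap U$ and $\pi_B(d(b))=r(b)$ for $b\in B$ with $d(b)\in U$. - $S(G)$ is Exel's inverse semigroup, the semigroup generated by symbols $[g]$, $g\in G$, with relations $[g^{-1}][g][h]=[g^{-1}][gh]$, $[g][h][h^{-1}]=[gh][h^{-1}]$ and $[g][\varepsilon]=[g]$. It acts partially on $U$: with $\varepsilon_i=[i][i^{-1}]$, the element $s=\varepsilon_{i_1}\cdots\varepsilon_{i_n}[g]$, which has degree $g$, acts by $\phi'_s$, the restriction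 of $\phi_g$, with $U_s=U_g\cap U_{i_1}\cap\dots\cap U_{i_n}$ and $\phi'_s:U_{s^{-1}}\to U_s$. - A partial action $\pi$ of an inverse semigroup $S$ on a space $Y$ induces one on $C_R(Y)$, with ideals $C_R(Y_s)$ and isomorphisms $\pi_s(f)=f\circ\pi_s^{-1}$. The partial skew inverse semigroup ring $C_R(Y)\rtimes_\pi S$ is the algebra of finite formal sums $\sum_s a_s\delta_s$, $a_s\in C_R(Y_s)$, with $(a\delta_s)(b\delta_t)=\pi_s(\pi_s^{-1}(a)b)\delta_{st}$, modulo the two-sided ideal generated by all $a\delta_s-a\delta_t$ with $s\le t$ in the natural partial order and $a\in C_R(Y_s)$. For $S=G$ this ideal is $0$ and one obtains the partial skew group ring. The class of $a\delta_s$ is homogeneous of degree $g$ when $s$ has degree $g$ (for $s=B\in\mathcal G_X^{(h)}$: when $B\subseteq\{g\}\times X_g$). Then all the algebras below are associative $G$-graded $R$-algebras, and there are isomorphisms of $G$-graded $R$-algebras $$A_R(\mathcal G_U)\;\cong_{\rm gr}\;C_R(U)\rtimes_\pi\mathcal G_X^{(h)}\;\cong_{\rm gr}\;C_R(U)\rtimes_{\phi'}S(G)\;\cong_{\rm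 gr}\;C_R(U)\rtimes_\phi G .$$ In particular, there are isomorphisms of $G$-graded $R$-algebras $$A_R(\mathcal G_X)\;\cong_{\rm gr}\;C_R(X)\rtimes_\pi\mathcal G_X^{(h)}\;\cong_{\rm gr}\;C_R(X)\rtimes_{\phi'}S(G)\;\cong_{\rm gr}\;C_R(X)\rtimes_\phi G .$$ -/

import Mathlib

namespace PartialSkew

/-! ## Inverse semigroups -/

/-- An inverse semigroup: every `s` has a unique `s⁻¹` with `s s⁻¹ s = s` and `s⁻¹ s s⁻¹ = s⁻¹`. -/
class InverseSemigroup (S : Type*) extends Semigroup S, Inv S where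
  mul_inv_mul : ∀ s : S, s * s⁻¹ * s = s
  inv_mul_inv : ∀ s : S, s⁻¹ * s * s⁻¹ = s⁻¹
  inv_unique : ∀ s t : S, s * t * s = s → t * s * t = t → t = s⁻¹

theorem InverseSemigroup.inv_inv' {S : Type*} [InverseSemigroup S] (s : S) : s⁻¹⁻¹ = s :=
  (InverseSemigroup.inv_unique s⁻¹ s (InverseSemigroup.inv_mul_inv s)
    (InverseSemigroup.mul_inv_mul s)).symm

theorem InverseSemigroup.idem_comm {S : Type*} [InverseSemigroup S] {e f : S} (he : e * e = e)
    (hf : f * f = f) : e * f = f * e := by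
  have key : ∀ a b : S, a * a = a → b * b = b → (a * b) * (a * b) = a * b := by
    intro a b ha hb
    have m1 := InverseSemigroup.mul_inv_mul (a * b)
    have m2 := InverseSemigroup.inv_mul_inv (a * b)
    generalize hx : (a * b)⁻¹ = x at m1 m2
    have h1 : b * x * a = x := by
      rw [← hx]
      refine InverseSemigroup.inv_unique (a * b) _ ?_ ?_
      · calc a * b * (b * (a * b)⁻¹ * a) * (a * b)
            = a * (b * b) * (a * b)⁻¹ * (a * a) * b := by simp only [mul_assoc]
          _ = a * b := by rw [ha, hb, hx]; simpa only [mul_assoc] using m1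
      · calc b * (a * b)⁻¹ * a * (a * b) * (b * (a * b)⁻¹ * a)
            = b * ((a * b)⁻¹ * ((a * a) * (b * b)) * (a * b)⁻¹) * a := by simp only [mul_assoc]
          _ = b * (a * b)⁻¹ * a := by rw [ha, hb, hx, m2]
    have h2 : x * x = x := by
      calc x * x = (b * x * a) * (b * x * a) := by rw [h1]
        _ = b * (x * (a * b) * x) * a := by simp only [mul_assoc]
        _ = x := by rw [m2, h1]
    have h3 : a * b = x := by
      have e1 : x = x⁻¹ := InverseSemigroup.inv_unique x x (by rw [h2, h2]) (by rw [h2, h2])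
      have e2 : a * b = x⁻¹ := InverseSemigroup.inv_unique x _ m2 m1
      rw [e2, ← e1]
    rw [h3, h2]
  have k1 := key e f he hf
  have k2 := key f e hf he
  have e1 : e * f = (e * f)⁻¹ := InverseSemigroup.inv_unique _ _ (by rw [k1, k1]) (by rw [k1, k1])
  have e2 : f * e = (e * f)⁻¹ := by
    refine InverseSemigroup.inv_unique _ _ ?_ ?_
    · calc e * f * (f * e) * (e * f) = e * (f * f) * (e * e) * f := by simp only [mul_assoc]
        _ = e * f := by rw [he, hf]; simpa only [mul_assoc] using k1
    · calc f * e * (e * f) * (f * e) = f * (e * e) * (f * f) * e := by simp only [mul_assoc]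
        _ = f * e := by rw [he, hf]; simpa only [mul_assoc] using k2
  rw [e1, ← e2]

theorem InverseSemigroup.mul_inv_rev' {S : Type*} [InverseSemigroup S] (s t : S) :
    (s * t)⁻¹ = t⁻¹ * s⁻¹ := by
  have hs := InverseSemigroup.mul_inv_mul s
  have ht := InverseSemigroup.mul_inv_mul t
  have hs' := InverseSemigroup.inv_mul_inv s
  have ht' := InverseSemigroup.inv_mul_inv t
  have hc : (t * t⁻¹) * (s⁻¹ * s) = (s⁻¹ * s) * (t * t⁻¹) :=
    InverseSemigroup.idem_comm (by rw [← mul_assoc, ht]) (by rw [← mul_assoc, hs'])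
  refine (InverseSemigroup.inv_unique _ _ ?_ ?_).symm
  · calc s * t * (t⁻¹ * s⁻¹) * (s * t) = s * ((t * t⁻¹) * (s⁻¹ * s)) * t := by
          simp only [mul_assoc]
      _ = (s * s⁻¹ * s) * (t * t⁻¹ * t) := by rw [hc]; simp only [mul_assoc]
      _ = s * t := by rw [hs, ht]
  · calc t⁻¹ * s⁻¹ * (s * t) * (t⁻¹ * s⁻¹) = t⁻¹ * ((s⁻¹ * s) * (t * t⁻¹)) * s⁻¹ := by
          simp only [mul_assoc]
      _ = (t⁻¹ * t * t⁻¹) * (s⁻¹ * s * s⁻¹) := by rw [← hc]; simp only [mul_assoc]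
      _ = t⁻¹ * s⁻¹ := by rw [hs', ht']

/-- The natural partial order `s ≤ t ↔ s = t s⁻¹ s` of an inverse semigroup. -/
def NatLE {S : Type*} [InverseSemigroup S] (s t : S) : Prop := s = t * s⁻¹ * s

/-- Every group is an inverse semigroup. -/
instance groupInverseSemigroup (G : Type*) [Group G] : InverseSemigroup G where
  mul_inv_mul s := by simp
  inv_mul_inv s := by simp
  inv_unique s t h _ := by
    have h1 : s * (t * s) = s * 1 := by rw [← mul_assoc, h, mul_one]
    exact eq_inv_of_mul_eq_one_left (mul_left_cancel h1)

/-! ## Exel's inverse semigroup of a group -/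

/-- The defining relations of Exel's semigroup `S(G)`. -/
inductive ExelRel (G : Type*) [Group G] : FreeSemigroup G → FreeSemigroup G → Prop
  | rel₁ (g h : G) : ExelRel G
      (FreeSemigroup.of g⁻¹ * FreeSemigroup.of g * FreeSemigroup.of h)
      (FreeSemigroup.of g⁻¹ * FreeSemigroup.of (g * h))
  | rel₂ (g h : G) : ExelRel G
      (FreeSemigroup.of g * FreeSemigroup.of h * FreeSemigroup.of h⁻¹)
      (FreeSemigroup.of (g * h) * FreeSemigroup.of h⁻¹)
  | rel₃ (g : G) : ExelRel G
      (FreeSemigroup.of g * FreeSemigroup.of 1) (FreeSemigroup.of g)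

/-- Exel's semigroup `S(G)`: the semigroup generated by symbols `[g]`, `g ∈ G`, subject to
`[g⁻¹][g][h] = [g⁻¹][gh]`, `[g][h][h⁻¹] = [gh][h⁻¹]` and `[g][1] = [g]`. -/
def ExelSemigroup (G : Type*) [Group G] : Type _ := (conGen (ExelRel G)).Quotient

namespace ExelSemigroup

open scoped Pointwise

variable {G : Type*} [Group G]

instance : Semigroup (ExelSemigroup G) :=
  inferInstanceAs (Semigroup (conGen (ExelRel G)).Quotient)

/-- The generator `[g]` of `S(G)`. -/
def of (g : G) : ExelSemigroup G := ((FreeSemigroup.of g : FreeSemigroup G) : (conGen (ExelRel G)).Quotient)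

theorem rel₁ (g h : G) : of g⁻¹ * of g * of h = of g⁻¹ * of (g * h) :=
  (Con.eq _).2 (ConGen.Rel.of _ _ (ExelRel.rel₁ g h))

theorem rel₂ (g h : G) : of g * of h * of h⁻¹ = of (g * h) * of h⁻¹ :=
  (Con.eq _).2 (ConGen.Rel.of _ _ (ExelRel.rel₂ g h))

theorem rel₃ (g : G) : of g * of 1 = of g :=
  (Con.eq _).2 (ConGen.Rel.of _ _ (ExelRel.rel₃ g))

/-- The universal property of `S(G)`. -/
def lift {P : Type*} [Semigroup P] (f : G → P)
    (h₁ : ∀ g h, f g⁻¹ * f g * f h = f g⁻¹ * f (g * h))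
    (h₂ : ∀ g h, f g * f h * f h⁻¹ = f (g * h) * f h⁻¹)
    (h₃ : ∀ g, f g * f 1 = f g) : ExelSemigroup G →ₙ* P where
  toFun s := Con.liftOn s (FreeSemigroup.lift f) (by
    intro a b hab
    have hle : conGen (ExelRel G) ≤ Con.ker (FreeSemigroup.lift f) := by
      refine Con.conGen_le.2 ?_
      rintro _ _ (⟨g, h⟩ | ⟨g, h⟩ | ⟨g⟩)
      · simpa [Con.ker_rel] using h₁ g h
      · simpa [Con.ker_rel] using h₂ g h
      · simpa [Con.ker_rel] using h₃ g
    exact hle hab)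
  map_mul' s t := by
    induction s using Con.induction_on with | _ s =>
    induction t using Con.induction_on with | _ t =>
    exact map_mul (FreeSemigroup.lift f) s t

theorem lift_of {P : Type*} [Semigroup P] (f : G → P) (h₁ h₂ h₃) (g : G) :
    lift f h₁ h₂ h₃ (of g) = f g := rfl

theorem induction {p : ExelSemigroup G → Prop} (hof : ∀ g, p (of g))
    (hmul : ∀ g s, p s → p (of g * s)) (s : ExelSemigroup G) : p s := by
  induction s using Con.induction_on with | _ s =>
  induction s using FreeSemigroup.recOnMul with
  | ih1 g => exact hof g
  | ih2 g s _ hs => exact hmul g _ hs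

theorem of_mul_inv_mul (g : G) : of g * of g⁻¹ * of g = of g := by
  have := rel₂ g g⁻¹
  rw [inv_inv] at this
  have h := rel₁ g⁻¹ g
  rw [inv_inv] at h
  rw [h, inv_mul_cancel, rel₃]

theorem one_mul' (g : G) : of 1 * of g = of g := by
  have := rel₂ g g⁻¹
  rw [inv_inv] at this
  rw [mul_inv_cancel] at this
  rw [← this, of_mul_inv_mul]

/-- The idempotent `ε_g = [g][g⁻¹]`. -/
def eps (g : G) : ExelSemigroup G := of g * of g⁻¹

theorem of_mul_eps (h g : G) : of h * eps g = eps (h * g) * of h := by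
  have e1 : of h * eps g = of (h * g) * of g⁻¹ := by rw [eps, ← mul_assoc, rel₂]
  have e2 := rel₁ (h * g) g⁻¹
  rw [mul_inv_cancel_right] at e2
  rw [e1, ← of_mul_inv_mul (h * g), mul_assoc (of (h * g)), mul_assoc (of (h * g)), e2, eps, mul_assoc]

theorem eps_comm (g h : G) : eps g * eps h = eps h * eps g := by
  have : eps g * eps h = of g * (of g⁻¹ * eps h) := by rw [eps, mul_assoc]
  rw [this, of_mul_eps, ← mul_assoc, of_mul_eps, mul_assoc, mul_inv_cancel_left]; rfl

theorem of_mul_of (g h : G) : of g * of h = eps g * of (g * h) := by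
  have h' := rel₁ g h
  conv_lhs => rw [← of_mul_inv_mul g]
  rw [mul_assoc, mul_assoc, ← mul_assoc (of g⁻¹), h', eps, mul_assoc]

/-- The degree map `∂ : S(G) → G`, `[g] ↦ g`. -/
def deg : ExelSemigroup G →ₙ* G :=
  lift id (fun g h => by simp) (fun g h => by simp) (fun g => by simp)

@[simp] theorem deg_of (g : G) : deg (of g) = g := rfl

/-- The semigroup of pairs `(A, g)`, with product `(A, g)(B, h) = (A ∪ gB, gh)`. -/
structure SetPair (G : Type*) where
  carrier : Set G
  elt : G

instance : Semigroup (SetPair G) where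
  mul x y := ⟨x.carrier ∪ x.elt • y.carrier, x.elt * y.elt⟩
  mul_assoc x y z := by
    change SetPair.mk _ _ = SetPair.mk _ _
    congr 1
    · change (x.carrier ∪ x.elt • y.carrier) ∪ (x.elt * y.elt) • z.carrier =
        x.carrier ∪ x.elt • (y.carrier ∪ y.elt • z.carrier)
      rw [Set.smul_set_union, Set.union_assoc, smul_smul]
    · exact mul_assoc _ _ _

theorem SetPair.mul_def (x y : SetPair G) :
    x * y = ⟨x.carrier ∪ x.elt • y.carrier, x.elt * y.elt⟩ := rfl

theorem smul_set_pair (a b c : G) : a • ({b, c} : Set G) = {a * b, a * c} := by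
  rw [Set.smul_set_insert, Set.smul_set_singleton, smul_eq_mul, smul_eq_mul]

/-- The homomorphism `[g] ↦ ({1, g}, g)`. -/
def toPair : ExelSemigroup G →ₙ* SetPair G :=
  lift (fun g => ⟨{1, g}, g⟩)
    (fun g h => by
      simp only [SetPair.mul_def, SetPair.mk.injEq]
      refine ⟨?_, by simp⟩
      simp only [smul_set_pair, inv_mul_cancel, mul_one, one_smul, inv_mul_cancel_left]
      ext x; simp only [Set.mem_union, Set.mem_insert_iff, Set.mem_singleton_iff]; tauto)
    (fun g h => by
      simp only [SetPair.mul_def, SetPair.mk.injEq]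
      refine ⟨?_, by simp⟩
      simp only [smul_set_pair, mul_one, mul_inv_cancel_right]
      ext x; simp only [Set.mem_union, Set.mem_insert_iff, Set.mem_singleton_iff]; tauto)
    (fun g => by
      simp only [SetPair.mul_def, SetPair.mk.injEq]
      refine ⟨?_, by simp⟩
      simp only [smul_set_pair, mul_one]
      ext x; simp only [Set.mem_union, Set.mem_insert_iff, Set.mem_singleton_iff]; tauto)

/-- The set of group elements `{1, i₁, …, iₙ, g}` attached to `s = ε_{i₁} ⋯ ε_{iₙ} [g]`
(see `supp_standard`). -/
def supp (s : ExelSemigroup G) : Set G := (toPair s).carrier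

theorem toPair_elt (s : ExelSemigroup G) : (toPair s).elt = deg s := by
  induction s using induction with
  | hof g => rfl
  | hmul g s hs => rw [map_mul, map_mul, SetPair.mul_def, ← hs]; rfl

theorem supp_of (g : G) : supp (of g) = {1, g} := rfl

theorem supp_mul (s t : ExelSemigroup G) : supp (s * t) = supp s ∪ deg s • supp t := by
  rw [supp, map_mul, SetPair.mul_def, toPair_elt]; rfl

theorem supp_finite (s : ExelSemigroup G) : (supp s).Finite := by
  induction s using induction with
  | hof g => rw [supp_of]; exact Set.toFinite _
  | hmul g s hs => rw [supp_mul, supp_of]; exact (Set.toFinite _).union hs.smul_set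

theorem one_mem_supp (s : ExelSemigroup G) : (1 : G) ∈ supp s := by
  induction s using induction with
  | hof g => simp [supp_of]
  | hmul g s hs => rw [supp_mul, supp_of]; simp

theorem deg_mem_supp (s : ExelSemigroup G) : deg s ∈ supp s := by
  induction s using induction with
  | hof g => simp [supp_of]
  | hmul g s hs =>
    rw [supp_mul, map_mul, deg_of]
    exact Or.inr (Set.smul_mem_smul_set hs)

/-- On a standard form `s = ε_{i₁} ⋯ ε_{iₙ} [g]` one has `∂ s = g` and
`supp s = {1, g, i₁, …, iₙ}`. -/
theorem supp_standard (l : List G) (g : G) :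
    deg ((l.map eps).foldr (· * ·) (of g)) = g ∧
      supp ((l.map eps).foldr (· * ·) (of g)) = {1, g} ∪ {i | i ∈ l} := by
  induction l with
  | nil => simp [supp_of]
  | cons a l ih =>
    have hd : deg (eps a) = 1 := by simp [eps]
    have hs : supp (eps a) = {1, a} := by
      rw [eps, supp_mul, supp_of, supp_of, deg_of, smul_set_pair, mul_one, mul_inv_cancel]
      ext x; simp only [Set.mem_union, Set.mem_insert_iff, Set.mem_singleton_iff]; tauto
    simp only [List.map_cons, List.foldr_cons]
    refine ⟨by rw [map_mul, hd, ih.1, one_mul], ?_⟩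
    rw [supp_mul, hd, one_smul, ih.2, hs]
    ext x
    simp only [Set.mem_union, Set.mem_insert_iff, Set.mem_singleton_iff, Set.mem_ofPred_eq,
      List.mem_cons]
    tauto

/-- Every element of `S(G)` has a standard form. -/
theorem exists_standard (s : ExelSemigroup G) :
    ∃ (l : List G) (g : G), s = (l.map eps).foldr (· * ·) (of g) := by
  induction s using induction with
  | hof g => exact ⟨[], g, rfl⟩
  | hmul h s hs =>
    obtain ⟨l, g, rfl⟩ := hs
    refine ⟨l.map (h * ·) ++ [h], h * g, ?_⟩
    induction l with
    | nil => simpa using of_mul_of h g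
    | cons a l ih =>
      simp only [List.map_cons, List.foldr_cons, List.cons_append] at ih ⊢
      rw [← mul_assoc, of_mul_eps, mul_assoc, ih]

/-- The involution `[g] ↦ [g⁻¹]` of `S(G)`, as a homomorphism to the opposite semigroup. -/
def invHom : ExelSemigroup G →ₙ* (ExelSemigroup G)ᵐᵒᵖ :=
  lift (fun g => MulOpposite.op (of g⁻¹))
    (fun g h => by
      simp only [← MulOpposite.op_mul, inv_inv, mul_inv_rev]
      have := rel₂ h⁻¹ g⁻¹
      rw [inv_inv] at this
      rw [← mul_assoc, this])
    (fun g h => by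
      simp only [← MulOpposite.op_mul, inv_inv, mul_inv_rev]
      have := rel₁ h⁻¹ g⁻¹
      rw [inv_inv] at this
      rw [← mul_assoc, this])
    (fun g => by simp only [← MulOpposite.op_mul, inv_one, one_mul'])

instance : Inv (ExelSemigroup G) := ⟨fun s => (invHom s).unop⟩

theorem inv_of (g : G) : (of g)⁻¹ = of g⁻¹ := rfl

theorem mul_inv_rev' (s t : ExelSemigroup G) : (s * t)⁻¹ = t⁻¹ * s⁻¹ := by
  change (invHom (s * t)).unop = _
  rw [map_mul]; rfl

theorem inv_inv'' (s : ExelSemigroup G) : s⁻¹⁻¹ = s := by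
  induction s using induction with
  | hof g => simp [inv_of]
  | hmul g s hs => rw [mul_inv_rev', mul_inv_rev', hs, inv_of, inv_of, inv_inv]

theorem deg_inv (s : ExelSemigroup G) : deg s⁻¹ = (deg s)⁻¹ := by
  induction s using induction with
  | hof g => simp [inv_of]
  | hmul g s hs => rw [mul_inv_rev', map_mul, map_mul, hs, inv_of, deg_of, deg_of, mul_inv_rev]

theorem supp_inv (s : ExelSemigroup G) : supp s⁻¹ = (deg s)⁻¹ • supp s := by
  induction s using induction with
  | hof g =>
    rw [inv_of, supp_of, supp_of, deg_of, smul_set_pair, mul_one, inv_mul_cancel, Set.pair_comm]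
  | hmul g s hs =>
    have h1 : (deg s)⁻¹ ∈ (deg s)⁻¹ • supp s := by
      simpa using Set.smul_mem_smul_set (a := (deg s)⁻¹) (one_mem_supp s)
    have h2 : (1 : G) ∈ (deg s)⁻¹ • supp s := by
      simpa using Set.smul_mem_smul_set (a := (deg s)⁻¹) (deg_mem_supp s)
    rw [mul_inv_rev', supp_mul, supp_mul, hs, inv_of, supp_of, supp_of, deg_of, deg_inv, map_mul,
      deg_of, mul_inv_rev, Set.smul_set_union, smul_smul, inv_mul_cancel_right, smul_set_pair,
      smul_set_pair, mul_one, mul_one, inv_mul_cancel_right]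
    ext x
    simp only [Set.mem_union, Set.mem_insert_iff, Set.mem_singleton_iff]
    have h3 : x = (deg s)⁻¹ → x ∈ (deg s)⁻¹ • supp s := fun h => h ▸ h1
    tauto

/-- The subsemigroup of products of the `ε_g`. -/
def epsClosure (G : Type*) [Group G] : Subsemigroup (ExelSemigroup G) :=
  Subsemigroup.closure (Set.range eps)

theorem epsClosure_comm {e f : ExelSemigroup G} (he : e ∈ epsClosure G) (hf : f ∈ epsClosure G) :
    e * f = f * e := by
  have h1 : ∀ g, ∀ f ∈ epsClosure G, eps g * f = f * eps g := by
    intro g f hf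
    induction hf using Subsemigroup.closure_induction with
    | mem x hx => obtain ⟨h, rfl⟩ := hx; exact eps_comm g h
    | mul x y _ _ hx hy => rw [← mul_assoc, hx, mul_assoc, hy, mul_assoc]
  induction he using Subsemigroup.closure_induction with
  | mem x hx => obtain ⟨h, rfl⟩ := hx; exact h1 h f hf
  | mul x y _ _ hx hy => rw [mul_assoc, hy, ← mul_assoc, hx, mul_assoc]

theorem exists_epsClosure (s : ExelSemigroup G) : ∃ e ∈ epsClosure G, s = e * of (deg s) := by
  obtain ⟨l, g, rfl⟩ := exists_standard s
  rw [(supp_standard l g).1]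
  induction l with
  | nil => exact ⟨eps 1, Subsemigroup.subset_closure ⟨1, rfl⟩, by simp [eps, inv_one, rel₃, one_mul']⟩
  | cons a l ih =>
    obtain ⟨e, he, h⟩ := ih
    refine ⟨eps a * e, mul_mem (Subsemigroup.subset_closure ⟨a, rfl⟩) he, ?_⟩
    simp only [List.map_cons, List.foldr_cons]
    rw [h, mul_assoc]

theorem mem_epsClosure_of_idem {s : ExelSemigroup G} (hs : s * s = s) : s ∈ epsClosure G := by
  obtain ⟨e, he, h⟩ := exists_epsClosure s
  have hd : deg s = 1 := by
    have := congrArg deg hs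
    rw [map_mul] at this
    simpa using this
  have h1 : (of 1 : ExelSemigroup G) ∈ epsClosure G :=
    Subsemigroup.subset_closure ⟨1, by simp [eps, inv_one, rel₃]⟩
  rw [h, hd]
  exact mul_mem he h1

theorem mul_inv_mem (s : ExelSemigroup G) : s * s⁻¹ ∈ epsClosure G := by
  induction s using induction with
  | hof g => exact Subsemigroup.subset_closure ⟨g, rfl⟩
  | hmul g s hs =>
    have key : ∀ f ∈ epsClosure G, of g * f * of g⁻¹ ∈ epsClosure G := by
      intro f hf
      have : ∃ f' ∈ epsClosure G, of g * f = f' * of g := by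
        induction hf using Subsemigroup.closure_induction with
        | mem x hx =>
          obtain ⟨h, rfl⟩ := hx
          exact ⟨_, Subsemigroup.subset_closure ⟨g * h, rfl⟩, of_mul_eps g h⟩
        | mul x y _ _ hx hy =>
          obtain ⟨x', hx', ex⟩ := hx
          obtain ⟨y', hy', ey⟩ := hy
          exact ⟨x' * y', mul_mem hx' hy', by rw [← mul_assoc, ex, mul_assoc, ey, mul_assoc]⟩
      obtain ⟨f', hf', e⟩ := this
      rw [e, mul_assoc]
      exact mul_mem hf' (Subsemigroup.subset_closure ⟨g, rfl⟩)
    have := key _ hs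
    rw [mul_inv_rev', inv_of]
    simpa only [mul_assoc] using this

theorem mul_inv_mul' (s : ExelSemigroup G) : s * s⁻¹ * s = s := by
  induction s using induction with
  | hof g => exact of_mul_inv_mul g
  | hmul g s hs =>
    have hg : of g⁻¹ * of g ∈ epsClosure G :=
      Subsemigroup.subset_closure ⟨g⁻¹, by rw [eps, inv_inv]⟩
    have hc := epsClosure_comm (mul_inv_mem s) hg
    calc of g * s * (of g * s)⁻¹ * (of g * s)
        = of g * ((s * s⁻¹) * (of g⁻¹ * of g)) * s := by
          rw [mul_inv_rev', inv_of]; simp only [mul_assoc]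
      _ = (of g * of g⁻¹ * of g) * (s * s⁻¹ * s) := by rw [hc]; simp only [mul_assoc]
      _ = of g * s := by rw [hs, of_mul_inv_mul]

instance : InverseSemigroup (ExelSemigroup G) where
  mul_inv_mul := mul_inv_mul'
  inv_mul_inv s := by
    have := mul_inv_mul' s⁻¹
    rwa [inv_inv''] at this
  inv_unique s t h1 h2 := by
    have a1 : s * s⁻¹ * s = s := mul_inv_mul' s
    have a2 : s⁻¹ * s * s⁻¹ = s⁻¹ := by
      have := mul_inv_mul' s⁻¹
      rwa [inv_inv''] at this
    have idem : ∀ x y : ExelSemigroup G, x * y * x = x → x * y ∈ epsClosure G := fun x y h =>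
      mem_epsClosure_of_idem (by rw [← mul_assoc, h])
    have c1 := epsClosure_comm (idem t s h2) (idem s⁻¹ s a2)
    have c2 := epsClosure_comm (idem s t h1) (idem s s⁻¹ a1)
    have e1 : t = s⁻¹ * s * t := by
      calc t = t * s * t := h2.symm
        _ = t * (s * s⁻¹ * s) * t := by rw [a1]
        _ = (t * s) * (s⁻¹ * s) * t := by simp only [mul_assoc]
        _ = s⁻¹ * s * (t * s * t) := by rw [c1]; simp only [mul_assoc]
        _ = s⁻¹ * s * t := by rw [h2]
    have e2 : s⁻¹ = s⁻¹ * s * t := by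
      calc s⁻¹ = s⁻¹ * s * s⁻¹ := a2.symm
        _ = s⁻¹ * (s * t * s) * s⁻¹ := by rw [h1]
        _ = s⁻¹ * ((s * t) * (s * s⁻¹)) := by simp only [mul_assoc]
        _ = s⁻¹ * s * s⁻¹ * (s * t) := by rw [c2]; simp only [mul_assoc]
        _ = s⁻¹ * s * t := by rw [a2, mul_assoc]
    rw [e1, ← e2]

end ExelSemigroup

/-! ## Topological groupoids -/

/-- A topological groupoid with unit space `X` and space of arrows `Γ`. The composite `comp α β` is
defined when `d α = r β`. Continuity of `d`, `r` and `unit` identifies `X` with the subspace of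
units of `Γ`. -/
structure TopGroupoid (X Γ : Type*) [TopologicalSpace X] [TopologicalSpace Γ] where
  d : Γ → X
  r : Γ → X
  unit : X → Γ
  inv : Γ → Γ
  comp : ∀ α β : Γ, d α = r β → Γ
  d_unit : ∀ x, d (unit x) = x
  r_unit : ∀ x, r (unit x) = x
  d_inv : ∀ α, d (inv α) = r α
  r_inv : ∀ α, r (inv α) = d α
  d_comp : ∀ α β h, d (comp α β h) = d β
  r_comp : ∀ α β h, r (comp α β h) = r α
  comp_assoc : ∀ α β γ (h : d α = r β) (h' : d β = r γ),
    comp (comp α β h) γ ((d_comp α β h).trans h') =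
      comp α (comp β γ h') (h.trans (r_comp β γ h').symm)
  unit_comp : ∀ α, comp (unit (r α)) α (d_unit (r α)) = α
  comp_unit : ∀ α, comp α (unit (d α)) (r_unit (d α)).symm = α
  inv_comp : ∀ α, comp (inv α) α (d_inv α) = unit (d α)
  comp_inv : ∀ α, comp α (inv α) (r_inv α).symm = unit (r α)
  continuous_d : Continuous d
  continuous_r : Continuous r
  continuous_unit : Continuous unit
  continuous_inv : Continuous inv
  continuous_comp : Continuous fun p : {p : Γ × Γ // d p.1 = r p.2} => comp p.1.1 p.1.2 p.2

namespace TopGroupoid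

variable {X Γ : Type*} [TopologicalSpace X] [TopologicalSpace Γ] (𝒢 : TopGroupoid X Γ)

/-- An open bisection: an open set of arrows which `d` and `r` map homeomorphically onto open
subsets of the unit space. -/
def IsOpenBisection (B : Set Γ) : Prop :=
  IsOpen B ∧ Topology.IsOpenEmbedding (fun b : B => 𝒢.d b) ∧ Topology.IsOpenEmbedding (fun b : B => 𝒢.r b)

/-- An ample groupoid: étale, with a basis of compact open bisections. -/
def IsAmple : Prop :=
  IsLocalHomeomorph 𝒢.d ∧
    TopologicalSpace.IsTopologicalBasis {B : Set Γ | IsCompact B ∧ 𝒢.IsOpenBisection B}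

/-- A set of units is invariant if `d γ ∈ U` implies `r γ ∈ U`. -/
def IsInvariant (U : Set X) : Prop := ∀ γ, 𝒢.d γ ∈ U → 𝒢.r γ ∈ U

/-- The space of composable pairs. -/
def Composable : Type _ := {p : Γ × Γ // 𝒢.d p.1 = 𝒢.r p.2}

instance : TopologicalSpace 𝒢.Composable :=
  inferInstanceAs (TopologicalSpace {p : Γ × Γ // 𝒢.d p.1 = 𝒢.r p.2})

instance [T2Space Γ] : T2Space 𝒢.Composable :=
  inferInstanceAs (T2Space {p : Γ × Γ // 𝒢.d p.1 = 𝒢.r p.2})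

/-- The composition map on composable pairs. -/
def compMap (p : 𝒢.Composable) : Γ := 𝒢.comp p.1.1 p.1.2 p.2

theorem comp_congr {α α' β β' : Γ} (h : 𝒢.d α = 𝒢.r β) (hα : α = α') (hβ : β = β') :
    𝒢.comp α β h = 𝒢.comp α' β' (by rw [← hα, ← hβ, h]) := by
  subst hα hβ; rfl

theorem inv_comp_comp {α β : Γ} (h : 𝒢.d α = 𝒢.r β) :
    𝒢.comp (𝒢.inv α) (𝒢.comp α β h) ((𝒢.d_inv α).trans (𝒢.r_comp α β h).symm) = β := by
  rw [← 𝒢.comp_assoc (𝒢.inv α) α β (𝒢.d_inv α) h,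
    𝒢.comp_congr _ ((𝒢.inv_comp α).trans (congrArg 𝒢.unit h)) rfl, 𝒢.unit_comp]

theorem comp_inv_comp {α γ : Γ} (h : 𝒢.r α = 𝒢.r γ) :
    𝒢.comp α (𝒢.comp (𝒢.inv α) γ ((𝒢.d_inv α).trans h))
      ((𝒢.r_inv α).symm.trans (𝒢.r_comp _ _ _).symm) = γ := by
  rw [← 𝒢.comp_assoc α (𝒢.inv α) γ (𝒢.r_inv α).symm ((𝒢.d_inv α).trans h),
    𝒢.comp_congr _ ((𝒢.comp_inv α).trans (congrArg 𝒢.unit h)) rfl, 𝒢.unit_comp]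

theorem inv_inv (α : Γ) : 𝒢.inv (𝒢.inv α) = α := by
  have h := 𝒢.inv_comp_comp (𝒢.d_inv α)
  rw [𝒢.comp_congr _ rfl (𝒢.inv_comp α)] at h
  have h2 := 𝒢.comp_unit (𝒢.inv (𝒢.inv α))
  rw [← h2]
  refine Eq.trans (𝒢.comp_congr _ rfl ?_) h
  rw [𝒢.d_inv, 𝒢.r_inv]

theorem eq_inv_of_comp {α β : Γ} (h : 𝒢.d α = 𝒢.r β) (hd : 𝒢.comp α β h = 𝒢.unit (𝒢.r α)) :
    β = 𝒢.inv α := by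
  have h1 := 𝒢.inv_comp_comp h
  rw [𝒢.comp_congr _ rfl hd] at h1
  rw [← h1]
  refine Eq.trans (𝒢.comp_congr _ rfl ?_) (𝒢.comp_unit (𝒢.inv α))
  rw [𝒢.d_inv]

theorem inv_comp' {α β : Γ} (h : 𝒢.d α = 𝒢.r β) :
    𝒢.inv (𝒢.comp α β h) = 𝒢.comp (𝒢.inv β) (𝒢.inv α)
      ((𝒢.d_inv β).trans (h.symm.trans (𝒢.r_inv α).symm)) := by
  have h1 : 𝒢.d (𝒢.comp α β h) = 𝒢.r (𝒢.comp (𝒢.inv β) (𝒢.inv α)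
      ((𝒢.d_inv β).trans (h.symm.trans (𝒢.r_inv α).symm))) := by
    rw [𝒢.d_comp, 𝒢.r_comp, 𝒢.r_inv]
  refine (𝒢.eq_inv_of_comp h1 ?_).symm
  have h2 : 𝒢.r β = 𝒢.r (𝒢.inv α) := by rw [𝒢.r_inv, h]
  rw [𝒢.comp_assoc α β _ h (by rw [𝒢.r_comp, 𝒢.r_inv]),
    𝒢.comp_congr _ rfl (𝒢.comp_inv_comp h2), 𝒢.comp_inv, 𝒢.r_comp]

theorem isOpenMap_d (h : 𝒢.IsAmple) : IsOpenMap 𝒢.d := h.1.isOpenMap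

theorem isOpenMap_r (h : 𝒢.IsAmple) : IsOpenMap 𝒢.r := by
  intro O hO
  have : 𝒢.r '' O = 𝒢.d '' (𝒢.inv ⁻¹' O) := by
    ext x
    constructor
    · rintro ⟨γ, hγ, rfl⟩
      exact ⟨𝒢.inv γ, by rwa [Set.mem_preimage, 𝒢.inv_inv], 𝒢.d_inv γ⟩
    · rintro ⟨γ, hγ, rfl⟩
      exact ⟨𝒢.inv γ, hγ, 𝒢.r_inv γ⟩
  rw [this]
  exact 𝒢.isOpenMap_d h _ (hO.preimage 𝒢.continuous_inv)

variable {𝒢}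

theorem IsOpenBisection.injOn_d {B : Set Γ} (hB : 𝒢.IsOpenBisection B) : Set.InjOn 𝒢.d B :=
  fun x hx y hy h => congrArg Subtype.val (hB.2.1.injective (a₁ := ⟨x, hx⟩) (a₂ := ⟨y, hy⟩) h)

theorem IsOpenBisection.injOn_r {B : Set Γ} (hB : 𝒢.IsOpenBisection B) : Set.InjOn 𝒢.r B :=
  fun x hx y hy h => congrArg Subtype.val (hB.2.2.injective (a₁ := ⟨x, hx⟩) (a₂ := ⟨y, hy⟩) h)

/-- If `d` and `r` are open maps, an open set on which they are injective is an open bisection. -/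
theorem isOpenBisection_of_injOn (hd : IsOpenMap 𝒢.d) (hr : IsOpenMap 𝒢.r) {B : Set Γ}
    (hB : IsOpen B) (h1 : Set.InjOn 𝒢.d B) (h2 : Set.InjOn 𝒢.r B) : 𝒢.IsOpenBisection B := by
  refine ⟨hB, ?_, ?_⟩
  · exact .of_continuous_injective_isOpenMap (𝒢.continuous_d.comp continuous_subtype_val)
      (fun x y h => Subtype.ext (h1 x.2 y.2 h)) (hd.comp hB.isOpenMap_subtype_val)
  · exact .of_continuous_injective_isOpenMap (𝒢.continuous_r.comp continuous_subtype_val)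
      (fun x y h => Subtype.ext (h2 x.2 y.2 h)) (hr.comp hB.isOpenMap_subtype_val)

variable (𝒢)

/-- The product `BC` of sets of arrows. -/
def setMul (B C : Set Γ) : Set Γ :=
  {γ | ∃ (b c : Γ) (h : 𝒢.d b = 𝒢.r c), b ∈ B ∧ c ∈ C ∧ 𝒢.comp b c h = γ}

/-- The inverse `B⁻¹` of a set of arrows. -/
def setInv (B : Set Γ) : Set Γ := {γ | ∃ b ∈ B, 𝒢.inv b = γ}

theorem isOpen_setMul (hr : IsOpenMap 𝒢.r) {B C : Set Γ} (hB : IsOpen B) (hC : IsOpen C) :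
    IsOpen (𝒢.setMul B C) := by
  rw [isOpen_iff_mem_nhds]
  rintro _ ⟨b, c, h, hb, hc, rfl⟩
  let T := {p : Γ × Γ // 𝒢.r p.1 = 𝒢.r p.2}
  let f : T → Γ := fun p => 𝒢.comp (𝒢.inv p.1.1) p.1.2 ((𝒢.d_inv _).trans p.2)
  have hf : Continuous f :=
    𝒢.continuous_comp.comp
      (Continuous.subtype_mk (f := fun p : T => (𝒢.inv p.1.1, p.1.2))
        ((𝒢.continuous_inv.comp (continuous_fst.comp continuous_subtype_val)).prodMk
          (continuous_snd.comp continuous_subtype_val)) fun p => (𝒢.d_inv _).trans p.2)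
  obtain ⟨O, hO, hOeq⟩ := isOpen_induced_iff.1 (hC.preimage hf)
  have hmem : (b, 𝒢.comp b c h) ∈ O := by
    have : (⟨(b, 𝒢.comp b c h), (𝒢.r_comp b c h).symm⟩ : T) ∈ f ⁻¹' C := by
      change 𝒢.comp (𝒢.inv b) (𝒢.comp b c h) _ ∈ C
      rwa [𝒢.inv_comp_comp h]
    rw [← hOeq] at this
    exact this
  obtain ⟨B', W, hB', hW, hb', hw, hsub⟩ := isOpen_prod_iff.1 hO _ _ hmem
  have hopen : IsOpen (W ∩ 𝒢.r ⁻¹' (𝒢.r '' (B' ∩ B))) :=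
    hW.inter ((hr _ (hB'.inter hB)).preimage 𝒢.continuous_r)
  refine Filter.mem_of_superset
    (hopen.mem_nhds ⟨hw, ⟨b, ⟨hb', hb⟩, (𝒢.r_comp b c h).symm⟩⟩) ?_
  rintro γ ⟨hγ, b₁, ⟨hb₁, hb₁B⟩, e⟩
  have h1 : (⟨(b₁, γ), e⟩ : T) ∈ f ⁻¹' C := by
    rw [← hOeq]; exact hsub ⟨hb₁, hγ⟩
  exact ⟨b₁, 𝒢.comp (𝒢.inv b₁) γ ((𝒢.d_inv _).trans e),
    (𝒢.r_inv b₁).symm.trans (𝒢.r_comp _ _ _).symm, hb₁B, h1, 𝒢.comp_inv_comp e⟩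

theorem isCompact_setMul [T2Space X] {B C : Set Γ} (hB : IsCompact B) (hC : IsCompact C) :
    IsCompact (𝒢.setMul B C) := by
  have hcl : IsClosed {p : Γ × Γ | 𝒢.d p.1 = 𝒢.r p.2} :=
    isClosed_eq (𝒢.continuous_d.comp continuous_fst) (𝒢.continuous_r.comp continuous_snd)
  have hK : IsCompact ((Subtype.val : {p : Γ × Γ // 𝒢.d p.1 = 𝒢.r p.2} → Γ × Γ) ⁻¹' (B ×ˢ C)) :=
    hcl.isClosedEmbedding_subtypeVal.isCompact_preimage (hB.prod hC)
  have : 𝒢.setMul B C = (fun p : {p : Γ × Γ // 𝒢.d p.1 = 𝒢.r p.2} => 𝒢.comp p.1.1 p.1.2 p.2) ''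
      (Subtype.val ⁻¹' (B ×ˢ C)) := by
    ext γ
    constructor
    · rintro ⟨b, c, h, hb, hc, e⟩
      exact ⟨⟨(b, c), h⟩, ⟨hb, hc⟩, e⟩
    · rintro ⟨⟨⟨b, c⟩, h⟩, ⟨hb, hc⟩, e⟩
      exact ⟨b, c, h, hb, hc, e⟩
  rw [this]
  exact hK.image 𝒢.continuous_comp

variable {𝒢}

theorem IsOpenBisection.setMul (h : 𝒢.IsAmple) {B C : Set Γ} (hB : 𝒢.IsOpenBisection B)
    (hC : 𝒢.IsOpenBisection C) : 𝒢.IsOpenBisection (𝒢.setMul B C) := by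
  refine isOpenBisection_of_injOn (𝒢.isOpenMap_d h) (𝒢.isOpenMap_r h)
    (𝒢.isOpen_setMul (𝒢.isOpenMap_r h) hB.1 hC.1) ?_ ?_
  · rintro _ ⟨b, c, hbc, hb, hc, rfl⟩ _ ⟨b', c', hbc', hb', hc', rfl⟩ e
    rw [𝒢.d_comp, 𝒢.d_comp] at e
    obtain rfl := hC.injOn_d hc hc' e
    obtain rfl := hB.injOn_d hb hb' (hbc.trans hbc'.symm)
    rfl
  · rintro _ ⟨b, c, hbc, hb, hc, rfl⟩ _ ⟨b', c', hbc', hb', hc', rfl⟩ e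
    rw [𝒢.r_comp, 𝒢.r_comp] at e
    obtain rfl := hB.injOn_r hb hb' e
    obtain rfl := hC.injOn_r hc hc' (hbc.symm.trans hbc')
    rfl

theorem setInv_eq_preimage (𝒢 : TopGroupoid X Γ) (B : Set Γ) : 𝒢.setInv B = 𝒢.inv ⁻¹' B := by
  ext γ
  constructor
  · rintro ⟨b, hb, rfl⟩
    rwa [Set.mem_preimage, 𝒢.inv_inv]
  · exact fun h => ⟨_, h, 𝒢.inv_inv γ⟩

theorem IsOpenBisection.setInv (h : 𝒢.IsAmple) {B : Set Γ} (hB : 𝒢.IsOpenBisection B) :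
    𝒢.IsOpenBisection (𝒢.setInv B) := by
  refine isOpenBisection_of_injOn (𝒢.isOpenMap_d h) (𝒢.isOpenMap_r h) ?_ ?_ ?_
  · rw [setInv_eq_preimage]; exact hB.1.preimage 𝒢.continuous_inv
  · rintro _ ⟨b, hb, rfl⟩ _ ⟨c, hc, rfl⟩ e
    rw [𝒢.d_inv, 𝒢.d_inv] at e
    rw [hB.injOn_r hb hc e]
  · rintro _ ⟨b, hb, rfl⟩ _ ⟨c, hc, rfl⟩ e
    rw [𝒢.r_inv, 𝒢.r_inv] at e
    rw [hB.injOn_d hb hc e]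

theorem isCompact_setInv (𝒢 : TopGroupoid X Γ) {B : Set Γ} (hB : IsCompact B) :
    IsCompact (𝒢.setInv B) :=
  hB.image 𝒢.continuous_inv

/-- Composition is a local homeomorphism. -/
theorem isLocalHomeomorph_compMap (h : 𝒢.IsAmple) : IsLocalHomeomorph 𝒢.compMap := by
  have hc : Continuous 𝒢.compMap := 𝒢.continuous_comp
  have key : ∀ (p : 𝒢.Composable) (O : Set 𝒢.Composable), IsOpen O → p ∈ O →
      ∃ B C : Set Γ, 𝒢.IsOpenBisection B ∧ 𝒢.IsOpenBisection C ∧ p.1.1 ∈ B ∧ p.1.2 ∈ C ∧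
        ∀ q : 𝒢.Composable, q.1.1 ∈ B → q.1.2 ∈ C → q ∈ O := by
    intro p O hO hp
    obtain ⟨O', hO', rfl⟩ := isOpen_induced_iff.1 hO
    obtain ⟨V, W, hV, hW, hpV, hpW, hs⟩ := isOpen_prod_iff.1 hO' p.1.1 p.1.2 hp
    obtain ⟨B, ⟨-, hB⟩, hpB, hBV⟩ := h.2.exists_subset_of_mem_open hpV hV
    obtain ⟨C, ⟨-, hC⟩, hpC, hCW⟩ := h.2.exists_subset_of_mem_open hpW hW
    exact ⟨B, C, hB, hC, hpB, hpC, fun q h1 h2 => hs ⟨hBV h1, hCW h2⟩⟩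
  have hopen : IsOpenMap 𝒢.compMap := by
    intro O hO
    rw [isOpen_iff_mem_nhds]
    rintro _ ⟨p, hp, rfl⟩
    obtain ⟨B, C, hB, hC, h1, h2, hs⟩ := key p O hO hp
    refine Filter.mem_of_superset ((hB.setMul h hC).1.mem_nhds ⟨p.1.1, p.1.2, p.2, h1, h2, rfl⟩) ?_
    rintro _ ⟨b, c, hbc, hb, hc, rfl⟩
    exact ⟨⟨(b, c), hbc⟩, hs _ hb hc, rfl⟩
  rw [isLocalHomeomorph_iff_isOpenEmbedding_restrict]
  intro p
  obtain ⟨B, C, hB, hC, h1, h2, -⟩ := key p Set.univ isOpen_univ trivial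
  let W : Set 𝒢.Composable := {q | q.1.1 ∈ B ∧ q.1.2 ∈ C}
  have hW : IsOpen W :=
    isOpen_induced_iff.2 ⟨B ×ˢ C, hB.1.prod hC.1, rfl⟩
  refine ⟨W, hW.mem_nhds ⟨h1, h2⟩, ?_⟩
  refine .of_continuous_injective_isOpenMap (hc.comp continuous_subtype_val) ?_
    (hopen.comp hW.isOpenMap_subtype_val)
  rintro ⟨⟨⟨b, c⟩, hbc⟩, hb, hc⟩ ⟨⟨⟨b', c'⟩, hbc'⟩, hb', hc'⟩ e
  change 𝒢.comp b c hbc = 𝒢.comp b' c' hbc' at e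
  have e1 := congrArg 𝒢.d e
  have e2 := congrArg 𝒢.r e
  rw [𝒢.d_comp, 𝒢.d_comp] at e1
  rw [𝒢.r_comp, 𝒢.r_comp] at e2
  obtain rfl := hC.injOn_d hc hc' e1
  obtain rfl := hB.injOn_r hb hb' e2
  rfl

end TopGroupoid

/-! ## Locally constant functions with compact support -/

theorem isClosed_support {R Y : Type*} [Zero R] [TopologicalSpace Y] {f : Y → R}
    (hf : IsLocallyConstant f) : IsClosed (Function.support f) := by
  rw [← isOpen_compl_iff]
  have := hf {0}
  have e : (Function.support f)ᶜ = f ⁻¹' {0} := by ext; simp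
  rwa [e]

/-- `C_R(Y)`: the `R`-algebra, under pointwise operations, of locally constant functions `Y → R`
with compact support. -/
def CR (R Y : Type*) [CommRing R] [TopologicalSpace Y] :
    NonUnitalSubalgebra R (LocallyConstant Y R) where
  carrier := {f | IsCompact (Function.support f)}
  zero_mem' := by simp
  add_mem' {f g} hf hg :=
    (IsCompact.union hf hg).of_isClosed_subset (isClosed_support (f + g).isLocallyConstant)
      (Function.support_add f g)
  mul_mem' {f g} hf _ :=
    hf.of_isClosed_subset (isClosed_support (f * g).isLocallyConstant)
      fun x hx => by
        rw [Function.mem_support] at hx ⊢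
        intro h
        exact hx (by rw [LocallyConstant.coe_mul, Pi.mul_apply, h, zero_mul])
  smul_mem' c f hf :=
    hf.of_isClosed_subset (isClosed_support (c • f).isLocallyConstant)
      fun x hx => by
        rw [Function.mem_support] at hx ⊢
        intro h
        exact hx (by rw [LocallyConstant.coe_smul, Pi.smul_apply, h, smul_zero])

theorem CR.isCompact_support {R Y : Type*} [CommRing R] [TopologicalSpace Y] (f : CR R Y) :
    IsCompact (Function.support (f : LocallyConstant Y R)) := f.2

/-- Summation over the fibres of a local homeomorphism preserves local constancy of functions with
compact support. -/
theorem isLocallyConstant_fibreSum {R Y Z : Type*} [CommRing R] [TopologicalSpace Y]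
    [TopologicalSpace Z] [T2Space Y] [T2Space Z] {p : Y → Z} (hp : IsLocalHomeomorph p) {F : Y → R}
    (hF : IsLocallyConstant F) (hK : IsCompact (Function.support F)) :
    IsLocallyConstant fun z => ∑ᶠ (y : Y) (_ : y ∈ p ⁻¹' {z}), F y := by
  classical
  rw [IsLocallyConstant.iff_eventually_eq]
  intro z₀
  set K := Function.support F
  set S := K ∩ p ⁻¹' {z₀} with hS
  have hlocal : ∀ y : Y, ∃ W : Set Y, IsOpen W ∧ y ∈ W ∧ Set.InjOn p W ∧ ∀ y' ∈ W, F y' = F y := by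
    intro y
    obtain ⟨e, hy, he⟩ := hp y
    refine ⟨e.source ∩ F ⁻¹' {F y}, e.open_source.inter (hF _), ⟨hy, rfl⟩, ?_, fun y' h => h.2⟩
    rw [he]
    exact e.injOn.mono Set.inter_subset_left
  choose W hWo hWm hWi hWF using hlocal
  have hSc : IsCompact S :=
    hK.inter_right (isClosed_singleton.preimage hp.continuous)
  have hfin : S.Finite := by
    obtain ⟨t, ht⟩ := hSc.elim_nhds_subcover W (fun y _ => (hWo y).mem_nhds (hWm y))
    refine (t.finite_toSet).subset fun y hy => ?_
    obtain ⟨x, hx, hxy⟩ := Set.mem_iUnion₂.1 (ht.2 hy)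
    have hxS := ht.1 x hx
    have : p y = p x := (hy.2 : p y = z₀).trans (hxS.2 : p x = z₀).symm
    rw [hWi x hxy (hWm x) this]
    exact hx
  obtain ⟨V, hV, hVd⟩ := hfin.t2_separation
  let N : Y → Set Y := fun y => W y ∩ V y
  have hNo : ∀ y, IsOpen (N y) := fun y => (hWo y).inter (hV y).2
  have hNm : ∀ y, y ∈ N y := fun y => ⟨hWm y, (hV y).1⟩
  have h0 : IsOpen (p '' (K \ ⋃ y ∈ S, N y))ᶜ := by
    have : IsCompact (K \ ⋃ y ∈ S, N y) := hK.diff (isOpen_biUnion fun y _ => hNo y)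
    exact (this.image hp.continuous).isClosed.isOpen_compl
  have h1 : IsOpen (⋂ y ∈ S, p '' N y) :=
    hfin.isOpen_biInter fun y _ => hp.isOpenMap _ (hNo y)
  have hz0 : z₀ ∈ (p '' (K \ ⋃ y ∈ S, N y))ᶜ := by
    rintro ⟨y, ⟨hyK, hy⟩, e⟩
    exact hy (Set.mem_biUnion (show y ∈ S from ⟨hyK, e⟩) (hNm y))
  have hz1 : z₀ ∈ ⋂ y ∈ S, p '' N y :=
    Set.mem_iInter₂.2 fun y hy => ⟨y, hNm y, hy.2⟩
  filter_upwards [h0.mem_nhds hz0, h1.mem_nhds hz1] with z hz hz'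
  have hσ : ∀ y, ∃ y', y ∈ S → y' ∈ N y ∧ p y' = z := by
    intro y
    by_cases hy : y ∈ S
    · obtain ⟨y', h1, h2⟩ := Set.mem_iInter₂.1 hz' y hy
      exact ⟨y', fun _ => ⟨h1, h2⟩⟩
    · exact ⟨y, fun h => absurd h hy⟩
  choose σ hσ using hσ
  have hinj : Set.InjOn σ S := by
    intro y hy y' hy' e
    by_contra hne
    have := hVd hy hy' hne
    exact Set.disjoint_left.1 this (hσ y hy).1.2 (e ▸ (hσ y' hy').1.2)
  have e1 : ∑ᶠ (y : Y) (_ : y ∈ p ⁻¹' {z}), F y = ∑ᶠ (y : Y) (_ : y ∈ σ '' S), F y := by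
    refine finsum_mem_inter_support_eq' _ _ _ fun y hy => ⟨fun h => ?_, ?_⟩
    · by_contra hcon
      refine hz ⟨y, ⟨hy, fun hmem => ?_⟩, h⟩
      obtain ⟨x, hx, hxy⟩ := Set.mem_iUnion₂.1 hmem
      refine hcon ⟨x, hx, ?_⟩
      exact hWi x (hσ x hx).1.1 hxy.1 ((hσ x hx).2.trans (h : p y = z).symm)
    · rintro ⟨x, hx, rfl⟩
      exact (hσ x hx).2
  have e2 : ∑ᶠ (y : Y) (_ : y ∈ p ⁻¹' {z₀}), F y = ∑ᶠ (y : Y) (_ : y ∈ S), F y :=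
    finsum_mem_inter_support_eq' _ _ _ fun y hy => ⟨fun h => ⟨hy, h⟩, fun h => h.2⟩
  change ∑ᶠ (y : Y) (_ : y ∈ p ⁻¹' {z}), F y = ∑ᶠ (y : Y) (_ : y ∈ p ⁻¹' {z₀}), F y
  rw [e1, e2, finsum_mem_image hinj]
  exact finsum_mem_congr rfl fun y hy => hWF y _ (hσ y hy).1.1

/-! ## Steinberg algebras -/

namespace TopGroupoid

variable {X Γ : Type*} [TopologicalSpace X] [TopologicalSpace Γ]

/-- The convolution `(f * g)(γ) = ∑_{αβ = γ} f(α) g(β)`. -/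
noncomputable def conv {R : Type*} [CommRing R] (𝒢 : TopGroupoid X Γ) (f g : Γ → R) (γ : Γ) : R :=
  ∑ᶠ (p : 𝒢.Composable) (_ : p ∈ 𝒢.compMap ⁻¹' {γ}), f p.1.1 * g p.1.2

variable {R : Type*} [CommRing R] (𝒢 : TopGroupoid X Γ)

theorem support_conv_subset (f g : Γ → R) :
    Function.support (𝒢.conv f g) ⊆ 𝒢.setMul (Function.support f) (Function.support g) := by
  intro γ hγ
  by_contra hcon
  refine hγ ?_
  refine finsum_mem_eq_zero_of_forall_eq_zero fun p hp => ?_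
  by_contra hne
  exact hcon ⟨p.1.1, p.1.2, p.2, left_ne_zero_of_mul hne, right_ne_zero_of_mul hne, hp⟩

theorem isLocallyConstant_conv [T2Space X] [T2Space Γ] (h : 𝒢.IsAmple) {f g : Γ → R} (hf : IsLocallyConstant f)
    (hg : IsLocallyConstant g) (hf' : IsCompact (Function.support f))
    (hg' : IsCompact (Function.support g)) : IsLocallyConstant (𝒢.conv f g) := by
  have hF : IsLocallyConstant fun p : 𝒢.Composable => f p.1.1 * g p.1.2 :=
    (hf.comp_continuous (continuous_fst.comp continuous_subtype_val)).mul
      (hg.comp_continuous (continuous_snd.comp continuous_subtype_val))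
  have hcl : IsClosed {p : Γ × Γ | 𝒢.d p.1 = 𝒢.r p.2} :=
    isClosed_eq (𝒢.continuous_d.comp continuous_fst) (𝒢.continuous_r.comp continuous_snd)
  have hK : IsCompact ((Subtype.val : {p : Γ × Γ // 𝒢.d p.1 = 𝒢.r p.2} → Γ × Γ) ⁻¹'
      (Function.support f ×ˢ Function.support g)) :=
    hcl.isClosedEmbedding_subtypeVal.isCompact_preimage (hf'.prod hg')
  refine isLocallyConstant_fibreSum (isLocalHomeomorph_compMap h) hF ?_
  refine hK.of_isClosed_subset (isClosed_support hF) fun p hp => ?_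
  exact ⟨left_ne_zero_of_mul hp, right_ne_zero_of_mul hp⟩

end TopGroupoid

/-- An ample Hausdorff groupoid. -/
structure AmpleGroupoid (X Γ : Type*) [TopologicalSpace X] [TopologicalSpace Γ] [T2Space X]
    [T2Space Γ] extends TopGroupoid X Γ where
  isAmple : toTopGroupoid.IsAmple

/-- The Steinberg algebra `A_R(𝒢) = C_c(𝒢, R)`, the `R`-module of locally constant functions on
arrows with compact support, with convolution as multiplication. -/
def Steinberg {X Γ : Type*} [TopologicalSpace X] [TopologicalSpace Γ] [T2Space X] [T2Space Γ]
    (R : Type*) [CommRing R] (_𝒢 : AmpleGroupoid X Γ) : Type _ := (CR R Γ).toSubmodule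

namespace Steinberg

variable {X Γ : Type*} [TopologicalSpace X] [TopologicalSpace Γ] [T2Space X] [T2Space Γ]
  {R : Type*} [CommRing R] {𝒢 : AmpleGroupoid X Γ}

noncomputable instance : AddCommGroup (Steinberg R 𝒢) :=
  inferInstanceAs (AddCommGroup (CR R Γ).toSubmodule)

noncomputable instance : Module R (Steinberg R 𝒢) :=
  inferInstanceAs (Module R (CR R Γ).toSubmodule)

/-- The underlying function of an element of the Steinberg algebra. -/
def toFun (f : Steinberg R 𝒢) : Γ → R := (f : (CR R Γ).toSubmodule).1

noncomputable instance : Mul (Steinberg R 𝒢) where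
  mul f g :=
    ⟨⟨𝒢.conv f.toFun g.toFun, 𝒢.isLocallyConstant_conv 𝒢.isAmple f.1.2 g.1.2 f.2 g.2⟩,
      (𝒢.isCompact_setMul f.2 g.2).of_isClosed_subset
        (isClosed_support (𝒢.isLocallyConstant_conv 𝒢.isAmple f.1.2 g.1.2 f.2 g.2))
        (𝒢.support_conv_subset _ _)⟩

theorem toFun_mul (f g : Steinberg R 𝒢) : (f * g).toFun = 𝒢.conv f.toFun g.toFun := rfl

theorem toFun_add (f g : Steinberg R 𝒢) : (f + g).toFun = f.toFun + g.toFun := rfl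

theorem toFun_smul (c : R) (f : Steinberg R 𝒢) : (c • f).toFun = c • f.toFun := rfl

/-- The homogeneous component `A_R(𝒢)_g = {f | supp f ⊆ 𝒢_g}`, `𝒢_g = c⁻¹(g)`. -/
def component {G : Type*} (c : Γ → G) (g : G) : Submodule R (Steinberg R 𝒢) where
  carrier := {f | ∀ γ, f.toFun γ ≠ 0 → c γ = g}
  zero_mem' γ h := absurd rfl h
  add_mem' {f₁ f₂} h₁ h₂ γ h := by
    by_cases h0 : f₁.toFun γ = 0
    · refine h₂ γ fun h' => h ?_
      rw [toFun_add, Pi.add_apply, h0, h', add_zero]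
    · exact h₁ γ h0
  smul_mem' a f hf γ h := by
    refine hf γ fun h' => h ?_
    rw [toFun_smul, Pi.smul_apply, h', smul_zero]

end Steinberg

/-! ## Graded compact open bisections -/

/-- A `G`-grading of a topological groupoid: a continuous functor to the discrete group `G`. -/
structure Grading {X Γ : Type*} [TopologicalSpace X] [TopologicalSpace Γ] (𝒢 : TopGroupoid X Γ)
    (G : Type*) [Group G] [TopologicalSpace G] where
  deg : Γ → G
  continuous_deg : Continuous deg
  deg_comp : ∀ α β h, deg (𝒢.comp α β h) = deg α * deg β

theorem Grading.deg_inv {X Γ : Type*} [TopologicalSpace X] [TopologicalSpace Γ]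
    {𝒢 : TopGroupoid X Γ} {G : Type*} [Group G] [TopologicalSpace G] (c : Grading 𝒢 G) (γ : Γ) :
    c.deg (𝒢.inv γ) = (c.deg γ)⁻¹ := by
  have h1 := c.deg_comp γ (𝒢.inv γ) (𝒢.r_inv γ).symm
  have h2 := c.deg_comp (𝒢.unit (𝒢.r γ)) γ (𝒢.d_unit (𝒢.r γ))
  rw [𝒢.comp_inv] at h1
  rw [𝒢.unit_comp] at h2
  rw [right_eq_mul.1 h2] at h1
  exact (inv_eq_of_mul_eq_one_right h1.symm).symm

/-- `𝒢^(h)`: the graded compact open bisections of a graded ample Hausdorff groupoid. -/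
@[ext]
structure GradedBisection {X Γ : Type*} [TopologicalSpace X] [TopologicalSpace Γ] [T2Space X]
    [T2Space Γ] (𝒢 : AmpleGroupoid X Γ) {G : Type*} [Group G] [TopologicalSpace G]
    (c : Grading 𝒢.toTopGroupoid G) where
  carrier : Set Γ
  isCompact : IsCompact carrier
  isOpenBisection : 𝒢.IsOpenBisection carrier
  graded : ∃ g, ∀ γ ∈ carrier, c.deg γ = g

namespace GradedBisection

variable {X Γ : Type*} [TopologicalSpace X] [TopologicalSpace Γ] [T2Space X] [T2Space Γ]
  {𝒢 : AmpleGroupoid X Γ} {G : Type*} [Group G] [TopologicalSpace G]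
  {c : Grading 𝒢.toTopGroupoid G}

/-- The product `BC` of graded bisections. -/
instance : Mul (GradedBisection 𝒢 c) where
  mul B C :=
    { carrier := 𝒢.setMul B.carrier C.carrier
      isCompact := 𝒢.isCompact_setMul B.isCompact C.isCompact
      isOpenBisection := B.isOpenBisection.setMul 𝒢.isAmple C.isOpenBisection
      graded := by
        obtain ⟨g, hg⟩ := B.graded
        obtain ⟨h, hh⟩ := C.graded
        refine ⟨g * h, ?_⟩
        rintro _ ⟨b, c', hbc, hb, hc, rfl⟩
        rw [c.deg_comp, hg b hb, hh c' hc] }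

/-- The inverse `B⁻¹` of a graded bisection. -/
instance : Inv (GradedBisection 𝒢 c) where
  inv B :=
    { carrier := 𝒢.setInv B.carrier
      isCompact := 𝒢.isCompact_setInv B.isCompact
      isOpenBisection := B.isOpenBisection.setInv 𝒢.isAmple
      graded := by
        obtain ⟨g, hg⟩ := B.graded
        refine ⟨g⁻¹, ?_⟩
        rintro _ ⟨b, hb, rfl⟩
        rw [c.deg_inv, hg b hb] }

theorem carrier_mul (B C : GradedBisection 𝒢 c) :
    (B * C).carrier = 𝒢.setMul B.carrier C.carrier := rfl

theorem carrier_inv (B : GradedBisection 𝒢 c) : B⁻¹.carrier = 𝒢.setInv B.carrier := rfl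

theorem comp_inv_comp_self (b : Γ) :
    𝒢.comp (𝒢.comp b (𝒢.inv b) (𝒢.r_inv b).symm) b ((𝒢.d_comp _ _ _).trans (𝒢.d_inv b)) = b := by
  rw [𝒢.comp_congr _ (𝒢.comp_inv b) rfl, 𝒢.unit_comp]

instance : Semigroup (GradedBisection 𝒢 c) where
  mul_assoc A B C := by
    ext γ
    simp only [carrier_mul]
    constructor
    · rintro ⟨_, z, h, ⟨x, y, hxy, hx, hy, rfl⟩, hz, rfl⟩
      have h' : 𝒢.d y = 𝒢.r z := (𝒢.d_comp x y hxy).symm.trans h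
      exact ⟨x, 𝒢.comp y z h', hxy.trans (𝒢.r_comp _ _ _).symm, hx, ⟨y, z, h', hy, hz, rfl⟩,
        (𝒢.comp_assoc x y z hxy h').symm⟩
    · rintro ⟨x, _, h, hx, ⟨y, z, hyz, hy, hz, rfl⟩, rfl⟩
      have h' : 𝒢.d x = 𝒢.r y := h.trans (𝒢.r_comp y z hyz)
      exact ⟨𝒢.comp x y h', z, (𝒢.d_comp _ _ _).trans hyz, ⟨x, y, h', hx, hy, rfl⟩, hz,
        𝒢.comp_assoc x y z h' hyz⟩

/-- If `C B C = C` then `C ⊆ B⁻¹`. -/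
theorem subset_inv_of_regular {B C : GradedBisection 𝒢 c} (h1 : C * B * C = C) :
    C.carrier ⊆ 𝒢.setInv B.carrier := by
  intro γ hγ
  have : γ ∈ (C * B * C).carrier := by rwa [h1]
  obtain ⟨_, z, h, ⟨x, b, hxb, hx, hb, rfl⟩, hz, e⟩ := this
  have ex : γ = x := by
    refine C.isOpenBisection.injOn_r hγ hx ?_
    rw [← e, 𝒢.r_comp, 𝒢.r_comp]
  have ez : γ = z := by
    refine C.isOpenBisection.injOn_d hγ hz ?_
    rw [← e, 𝒢.d_comp]
  subst ex
  subst ez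
  have hbz : 𝒢.d b = 𝒢.r γ := (𝒢.d_comp _ _ _).symm.trans h
  rw [𝒢.comp_assoc γ b γ hxb hbz] at e
  have h2 := 𝒢.inv_comp_comp (hxb.trans (𝒢.r_comp b γ hbz).symm)
  rw [𝒢.comp_congr _ rfl e, 𝒢.inv_comp] at h2
  refine ⟨b, hb, (𝒢.eq_inv_of_comp hbz ?_).symm⟩
  rw [← h2, hxb]

instance : InverseSemigroup (GradedBisection 𝒢 c) where
  mul_inv_mul B := by
    ext γ
    constructor
    · rintro ⟨_, z, h, ⟨x, _, hxy, hx, ⟨y, hy, rfl⟩, rfl⟩, hz, rfl⟩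
      have e1 : x = y := B.isOpenBisection.injOn_d hx hy (hxy.trans (𝒢.r_inv y))
      subst e1
      have e2 : x = z := by
        refine B.isOpenBisection.injOn_r hx hz ?_
        rw [← h, 𝒢.d_comp, 𝒢.d_inv]
      subst e2
      rw [comp_inv_comp_self]
      exact hx
    · intro hγ
      exact ⟨_, γ, _, ⟨γ, 𝒢.inv γ, _, hγ, ⟨γ, hγ, rfl⟩, rfl⟩, hγ, comp_inv_comp_self γ⟩
  inv_mul_inv B := by
    ext γ
    constructor
    · rintro ⟨_, _, h, ⟨_, x, hxy, ⟨y, hy, rfl⟩, hx, rfl⟩, ⟨z, hz, rfl⟩, rfl⟩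
      have e1 : y = x := B.isOpenBisection.injOn_r hy hx ((𝒢.d_inv y).symm.trans hxy)
      subst e1
      have e2 : y = z := by
        refine B.isOpenBisection.injOn_d hy hz ?_
        rw [← 𝒢.r_inv z, ← h, 𝒢.d_comp]
      subst e2
      refine ⟨y, hy, ?_⟩
      rw [𝒢.comp_congr h (𝒢.inv_comp y) rfl]
      refine (𝒢.unit_comp (𝒢.inv y)).symm.trans (𝒢.comp_congr _ ?_ rfl)
      rw [𝒢.r_inv]
    · rintro ⟨b, hb, rfl⟩
      refine ⟨_, 𝒢.inv b, ?_, ⟨𝒢.inv b, b, 𝒢.d_inv b, ⟨b, hb, rfl⟩, hb, rfl⟩, ⟨b, hb, rfl⟩, ?_⟩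
      · rw [𝒢.d_comp, 𝒢.r_inv]
      · rw [𝒢.comp_congr _ (𝒢.inv_comp b) rfl]
        refine Eq.trans (𝒢.comp_congr _ ?_ rfl) (𝒢.unit_comp (𝒢.inv b))
        rw [𝒢.r_inv]
  inv_unique B C h1 h2 := by
    ext γ
    constructor
    · exact fun h => subset_inv_of_regular h2 h
    · rintro ⟨b, hb, rfl⟩
      obtain ⟨c', hc, rfl⟩ := subset_inv_of_regular h1 hb
      rwa [𝒢.inv_inv]

end GradedBisection

/-! ## Partial actions -/

/-- A partial action of an inverse semigroup `S` on a topological space `Y`: open sets `dom s ⊆ Y`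
and maps `map s : dom s⁻¹ → dom s`, continuous with inverse `map s⁻¹` (so that they are
homeomorphisms), compatible with the product and the natural order.
The values of `map s` outside `dom s⁻¹` play no role. -/
structure PartialAction (S Y : Type*) [InverseSemigroup S] [TopologicalSpace Y] where
  dom : S → Set Y
  map : S → Y → Y
  isOpen_dom : ∀ s, IsOpen (dom s)
  mapsTo : ∀ s, Set.MapsTo (map s) (dom s⁻¹) (dom s)
  continuousOn : ∀ s, ContinuousOn (map s) (dom s⁻¹)
  map_inv_map : ∀ s, ∀ x ∈ dom s⁻¹, map s⁻¹ (map s x) = x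
  map_mem_mul : ∀ s t, ∀ x ∈ dom s⁻¹ ∩ dom t, map s x ∈ dom (s * t)
  dom_mono : ∀ s t, NatLE s t → dom s ⊆ dom t
  map_map : ∀ s t, ∀ x ∈ dom t⁻¹ ∩ dom (t⁻¹ * s⁻¹), map s (map t x) = map (s * t) x

/-- A partial action of an inverse semigroup `S` on an `R`-algebra `A`: two-sided ideals `A_s` and
isomorphisms of algebras `π_s : A_{s⁻¹} → A_s`, compatible with the product and the natural
order. In the last condition `hst` and `ha'` are automatic. -/
structure AlgPartialAction (R S A : Type*) [CommRing R] [InverseSemigroup S] [NonUnitalRing A]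
    [Module R A] where
  ideal : S → Submodule R A
  mul_mem_left : ∀ s a b, b ∈ ideal s → a * b ∈ ideal s
  mul_mem_right : ∀ s a b, a ∈ ideal s → a * b ∈ ideal s
  equiv : ∀ s, ideal s⁻¹ ≃ₗ[R] ideal s
  equiv_mul : ∀ s (a b : ideal s⁻¹) (hab : (a : A) * b ∈ ideal s⁻¹),
    (equiv s ⟨(a : A) * b, hab⟩ : A) = equiv s a * equiv s b
  equiv_symm : ∀ s (a : ideal s) (ha : (a : A) ∈ ideal s⁻¹⁻¹),
    ((equiv s).symm a : A) = equiv s⁻¹ ⟨a, ha⟩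
  equiv_mem_mul : ∀ s t (a : ideal s⁻¹), (a : A) ∈ ideal t → (equiv s a : A) ∈ ideal (s * t)
  ideal_mono : ∀ s t, NatLE s t → ideal s ≤ ideal t
  equiv_equiv : ∀ s t (a : A) (ha : a ∈ ideal t⁻¹) (_ : a ∈ ideal (t⁻¹ * s⁻¹))
    (hst : a ∈ ideal (s * t)⁻¹) (ha' : (equiv t ⟨a, ha⟩ : A) ∈ ideal s⁻¹),
    (equiv s ⟨equiv t ⟨a, ha⟩, ha'⟩ : A) = equiv (s * t) ⟨a, hst⟩

/-! ## The partial skew inverse semigroup ring -/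

namespace AlgPartialAction

open scoped DirectSum Classical

variable {R S A : Type*} [CommRing R] [InverseSemigroup S] [NonUnitalRing A] [Module R A]
  [IsScalarTower R A A] [SMulCommClass R A A] (π : AlgPartialAction R S A)

/-- The algebra `𝓛` of formal finite sums `∑ a_s δ_s`, `a_s ∈ A_s`. -/
abbrev Formal {R S A : Type*} [CommRing R] [InverseSemigroup S] [NonUnitalRing A] [Module R A]
    (π : AlgPartialAction R S A) : Type _ := ⨁ s : S, π.ideal s

/-- The formal term `a δ_s`. -/
noncomputable def delta (s : S) : π.ideal s →ₗ[R] π.Formal :=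
  DirectSum.lof R S (fun s => π.ideal s) s

/-- The coefficient `π_s(π_{s⁻¹}(a) b)` of the product `(a δ_s)(b δ_t)`. -/
def coeff (s t : S) (a : π.ideal s) (b : π.ideal t) : π.ideal (s * t) :=
  ⟨π.equiv s ⟨((π.equiv s).symm a : A) * b, π.mul_mem_right _ _ _ ((π.equiv s).symm a).2⟩,
    π.equiv_mem_mul s t _ (π.mul_mem_left _ _ _ b.2)⟩

/-- The product on homogeneous terms, as a bilinear map. -/
noncomputable def termMul (s t : S) : π.ideal s →ₗ[R] π.ideal t →ₗ[R] π.Formal :=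
  LinearMap.mk₂ R (fun a b => π.delta (s * t) (π.coeff s t a b))
    (fun a a' b => by
      rw [← map_add]
      refine congrArg _ (Subtype.ext ?_)
      change (π.equiv s _ : A) = (π.equiv s _ : A) + π.equiv s _
      rw [← Submodule.coe_add, ← map_add]
      exact congrArg (fun z => (π.equiv s z : A)) (Subtype.ext (by simp [add_mul])))
    (fun c a b => by
      rw [← map_smul]
      refine congrArg _ (Subtype.ext ?_)
      change (π.equiv s _ : A) = c • (π.equiv s _ : A)
      rw [← Submodule.coe_smul, ← map_smul]
      exact congrArg (fun z => (π.equiv s z : A)) (Subtype.ext (by simp [smul_mul_assoc])))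
    (fun a b b' => by
      rw [← map_add]
      refine congrArg _ (Subtype.ext ?_)
      change (π.equiv s _ : A) = (π.equiv s _ : A) + π.equiv s _
      rw [← Submodule.coe_add, ← map_add]
      exact congrArg (fun z => (π.equiv s z : A)) (Subtype.ext (by simp [mul_add])))
    (fun c a b => by
      rw [← map_smul]
      refine congrArg _ (Subtype.ext ?_)
      change (π.equiv s _ : A) = c • (π.equiv s _ : A)
      rw [← Submodule.coe_smul, ← map_smul]
      exact congrArg (fun z => (π.equiv s z : A)) (Subtype.ext (by simp [mul_smul_comm])))

/-- The multiplication of `𝓛`: the bilinear extension of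
`(a δ_s)(b δ_t) = π_s(π_{s⁻¹}(a) b) δ_{st}`. -/
noncomputable def mulHom : π.Formal →ₗ[R] π.Formal →ₗ[R] π.Formal :=
  DirectSum.toModule R S _ fun s =>
    LinearMap.flip (DirectSum.toModule R S _ fun t => (π.termMul s t).flip)

noncomputable instance : Mul π.Formal := ⟨fun x y => π.mulHom x y⟩

theorem delta_mul_delta (s t : S) (a : π.ideal s) (b : π.ideal t) :
    π.delta s a * π.delta t b = π.delta (s * t) (π.coeff s t a b) := by
  change π.mulHom _ _ = _
  rw [mulHom, delta, DirectSum.toModule_lof, LinearMap.flip_apply, delta, DirectSum.toModule_lof]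
  rfl

/-- The two-sided ideal `𝓝` of `𝓛` generated by the elements `a δ_s - a δ_t` with `s ≤ t` and
`a ∈ A_s`. -/
noncomputable def nullIdeal : Submodule R π.Formal :=
  sInf {N | (∀ (s t : S) (h : NatLE s t) (a : π.ideal s),
      π.delta s a - π.delta t ⟨a, π.ideal_mono s t h a.2⟩ ∈ N) ∧
    ∀ x y : π.Formal, y ∈ N → x * y ∈ N ∧ y * x ∈ N}

theorem mul_mem_nullIdeal (x y : π.Formal) (hy : y ∈ π.nullIdeal) :
    x * y ∈ π.nullIdeal ∧ y * x ∈ π.nullIdeal := by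
  simp only [nullIdeal, Submodule.mem_sInf] at hy ⊢
  exact ⟨fun N hN => (hN.2 x y (hy N hN)).1, fun N hN => (hN.2 x y (hy N hN)).2⟩

/-- The partial skew inverse semigroup ring `A ⋊_π S = 𝓛 / 𝓝`. -/
abbrev SkewRing : Type _ := π.Formal ⧸ π.nullIdeal

/-- The quotient map `𝓛 → A ⋊_π S`. -/
noncomputable def toSkewRing : π.Formal →ₗ[R] π.SkewRing := π.nullIdeal.mkQ

/-- The multiplication of `A ⋊_π S` induced by that of `𝓛`. -/
noncomputable def skewMulHom : π.SkewRing →ₗ[R] π.SkewRing →ₗ[R] π.SkewRing :=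
  π.nullIdeal.liftQ
    (LinearMap.flip (π.nullIdeal.liftQ (LinearMap.flip (π.mulHom.compr₂ π.toSkewRing))
      (fun y hy => by
        rw [LinearMap.mem_ker]; ext x
        exact (Submodule.Quotient.mk_eq_zero _).2 (π.mul_mem_nullIdeal _ y hy).1)))
    (fun y hy => by
      rw [LinearMap.mem_ker]
      refine LinearMap.ext fun x => ?_
      obtain ⟨x, rfl⟩ := Submodule.mkQ_surjective _ x
      exact (Submodule.Quotient.mk_eq_zero _).2 (π.mul_mem_nullIdeal x y hy).2)

noncomputable instance : Mul π.SkewRing := ⟨fun x y => π.skewMulHom x y⟩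

theorem toSkewRing_mul (x y : π.Formal) :
    π.toSkewRing (x * y) = π.toSkewRing x * π.toSkewRing y := rfl

/-- The submodule of `𝓛` spanned by the terms `a δ_s` with `s ∈ P`. -/
noncomputable def formalComponent (P : Set S) : Submodule R π.Formal :=
  Submodule.span R {x | ∃ s ∈ P, ∃ a : π.ideal s, x = π.delta s a}

/-- The submodule of `A ⋊_π S` spanned by the classes of the terms `a δ_s` with `s ∈ P`. -/
noncomputable def component (P : Set S) : Submodule R π.SkewRing :=
  (π.formalComponent P).map π.toSkewRing

end AlgPartialAction

/-! ## The induced action on functions -/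

section Induced

variable (R : Type*) {Y : Type*} [CommRing R] [TopologicalSpace Y]

/-- `C_R(W)` as the ideal of functions in `C_R(Y)` vanishing outside the open set `W`. -/
def CRon (W : Set Y) : Submodule R (CR R Y) where
  carrier := {f | ∀ x, x ∉ W → (f : LocallyConstant Y R) x = 0}
  zero_mem' _ _ := rfl
  add_mem' {f g} hf hg x hx := by
    change (f : LocallyConstant Y R) x + (g : LocallyConstant Y R) x = 0
    rw [hf x hx, hg x hx, add_zero]
  smul_mem' c f hf x hx := by
    change c • (f : LocallyConstant Y R) x = 0
    rw [hf x hx, smul_zero]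

variable {R}

open scoped Classical in
/-- The function `f ∘ q` on `W'`, extended by zero. -/
noncomputable def pullFun (W' : Set Y) (q : Y → Y) (f : Y → R) (x : Y) : R :=
  if x ∈ W' then f (q x) else 0

theorem pullFun_of_mem {R Y : Type*} [CommRing R] {W' : Set Y} {q : Y → Y} {f : Y → R} {x : Y} (h : x ∈ W') :
    pullFun W' q f x = f (q x) := if_pos h

theorem pullFun_of_notMem {R Y : Type*} [CommRing R] {W' : Set Y} {q : Y → Y} {f : Y → R} {x : Y} (h : x ∉ W') :
    pullFun W' q f x = 0 := if_neg h

theorem support_pullFun_subset {R Y : Type*} [CommRing R] {W' : Set Y} {q p : Y → Y} (hpq : ∀ x ∈ W', p (q x) = x)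
    (f : Y → R) : Function.support (pullFun W' q f) ⊆ p '' Function.support f := by
  intro x hx
  by_cases h : x ∈ W'
  · refine ⟨q x, ?_, hpq x h⟩
    rwa [Function.mem_support, pullFun_of_mem h] at hx
  · exact absurd (pullFun_of_notMem h) hx

theorem isLocallyConstant_pullFun [T2Space Y] {W W' : Set Y} {q p : Y → Y} (hW' : IsOpen W')
    (hq : ContinuousOn q W') (hp : ContinuousOn p W) (hpm : Set.MapsTo p W W') (hpq : ∀ x ∈ W', p (q x) = x) {f : Y → R}
    (hf : IsLocallyConstant f) (hK : IsCompact (Function.support f))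
    (hfW : Function.support f ⊆ W) : IsLocallyConstant (pullFun W' q f) := by
  rw [IsLocallyConstant.iff_eventually_eq]
  intro x
  by_cases hx : x ∈ W'
  · have h1 : ∀ᶠ y in nhds x, q y ∈ f ⁻¹' {f (q x)} :=
      (hq.continuousAt (hW'.mem_nhds hx)).eventually ((hf {f (q x)}).mem_nhds rfl)
    filter_upwards [h1, hW'.mem_nhds hx] with y hy hyW
    rw [pullFun_of_mem hx, pullFun_of_mem hyW]
    exact hy
  · have hc : IsClosed (p '' Function.support f) := (hK.image_of_continuousOn (hp.mono hfW)).isClosed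
    by_cases hxK : x ∈ p '' Function.support f
    · obtain ⟨y, hy, rfl⟩ := hxK
      exact absurd (hpm (hfW hy)) hx
    · filter_upwards [hc.isOpen_compl.mem_nhds hxK] with y hy
      rw [pullFun_of_notMem hx]
      by_contra h
      exact hy (support_pullFun_subset hpq f h)

/-- The function `f ∘ q` on `W'`, extended by zero, as an element of `C_R(W')`. -/
noncomputable def pullAux [T2Space Y] {W W' : Set Y} (hW' : IsOpen W') {q p : Y → Y}
    (hq : ContinuousOn q W') (hp : ContinuousOn p W) (hpm : Set.MapsTo p W W')
    (hpq : ∀ x ∈ W', p (q x) = x) (f : CRon R W) : CRon R W' :=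
  have hfW : Function.support (f.1 : LocallyConstant Y R) ⊆ W := fun x hx => by
    by_contra h
    exact hx (f.2 x h)
  have hlc : IsLocallyConstant (pullFun W' q (f.1 : LocallyConstant Y R)) :=
    isLocallyConstant_pullFun hW' hq hp hpm hpq (f.1 : LocallyConstant Y R).2 f.1.2 hfW
  ⟨⟨⟨_, hlc⟩, (f.1.2.image_of_continuousOn (hp.mono hfW)).of_isClosed_subset (isClosed_support hlc)
    (support_pullFun_subset hpq _)⟩, fun _ hx => pullFun_of_notMem hx⟩

/-- The isomorphism `C_R(W) → C_R(W')`, `f ↦ f ∘ q`, for a homeomorphism `q : W' → W` with inverse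
`p`. -/
noncomputable def pullEquiv [T2Space Y] {W W' : Set Y} (hW : IsOpen W) (hW' : IsOpen W')
    {q p : Y → Y} (hq : ContinuousOn q W') (hp : ContinuousOn p W) (hqm : Set.MapsTo q W' W)
    (hpm : Set.MapsTo p W W') (hpq : ∀ x ∈ W', p (q x) = x) (hqp : ∀ x ∈ W, q (p x) = x) :
    CRon R W ≃ₗ[R] CRon R W' where
  toFun f := pullAux hW' hq hp hpm hpq f
  invFun f := pullAux hW hp hq hqm hqp f
  map_add' f g := by
    refine Subtype.ext (Subtype.ext (LocallyConstant.ext fun x => ?_))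
    change pullFun W' q ((f.1 : LocallyConstant Y R) + (g.1 : LocallyConstant Y R)) x =
      pullFun W' q (f.1 : LocallyConstant Y R) x + pullFun W' q (g.1 : LocallyConstant Y R) x
    by_cases hx : x ∈ W'
    · simp only [pullFun_of_mem hx, LocallyConstant.add_apply]
    · simp only [pullFun_of_notMem hx, add_zero]
  map_smul' c f := by
    refine Subtype.ext (Subtype.ext (LocallyConstant.ext fun x => ?_))
    change pullFun W' q (c • (f.1 : LocallyConstant Y R)) x =
      c • pullFun W' q (f.1 : LocallyConstant Y R) x
    by_cases hx : x ∈ W'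
    · simp only [pullFun_of_mem hx, LocallyConstant.smul_apply]
    · simp only [pullFun_of_notMem hx, smul_zero]
  left_inv f := by
    refine Subtype.ext (Subtype.ext (LocallyConstant.ext fun x => ?_))
    change pullFun W p (pullFun W' q _) x = _
    by_cases hx : x ∈ W
    · rw [pullFun_of_mem hx, pullFun_of_mem (hpm hx), hqp x hx]
    · rw [pullFun_of_notMem hx, f.2 x hx]
  right_inv f := by
    refine Subtype.ext (Subtype.ext (LocallyConstant.ext fun x => ?_))
    change pullFun W' q (pullFun W p _) x = _
    by_cases hx : x ∈ W'
    · rw [pullFun_of_mem hx, pullFun_of_mem (hqm hx), hpq x hx]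
    · rw [pullFun_of_notMem hx, f.2 x hx]

end Induced

namespace PartialAction

variable {S Y : Type*} [InverseSemigroup S] [TopologicalSpace Y]

theorem mapsTo_inv (π : PartialAction S Y) (s : S) :
    Set.MapsTo (π.map s⁻¹) (π.dom s) (π.dom s⁻¹) := by
  have := π.mapsTo s⁻¹
  rwa [InverseSemigroup.inv_inv'] at this

theorem continuousOn_inv (π : PartialAction S Y) (s : S) :
    ContinuousOn (π.map s⁻¹) (π.dom s) := by
  have := π.continuousOn s⁻¹
  rwa [InverseSemigroup.inv_inv'] at this

theorem map_map_inv (π : PartialAction S Y) (s : S) (x : Y) (hx : x ∈ π.dom s) :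
    π.map s (π.map s⁻¹ x) = x := by
  have := π.map_inv_map s⁻¹ x
  rw [InverseSemigroup.inv_inv'] at this
  exact this hx

/-- The induced partial action `(π_s, C_R(Y_s), C_R(Y))` with `π_s(f) = f ∘ π_{s⁻¹}`. -/
noncomputable def onCR [T2Space Y] (R : Type*) [CommRing R] (π : PartialAction S Y) :
    AlgPartialAction R S (CR R Y) where
  ideal s := CRon R (π.dom s)
  mul_mem_left s a b hb x hx := by
    change (a : LocallyConstant Y R) x * (b : LocallyConstant Y R) x = 0
    rw [hb x hx, mul_zero]
  mul_mem_right s a b ha x hx := by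
    change (a : LocallyConstant Y R) x * (b : LocallyConstant Y R) x = 0
    rw [ha x hx, zero_mul]
  equiv s := pullEquiv (q := π.map s⁻¹) (p := π.map s) (π.isOpen_dom s⁻¹) (π.isOpen_dom s)
    (π.continuousOn_inv s) (π.continuousOn s) (π.mapsTo_inv s) (π.mapsTo s)
    (π.map_map_inv s) (π.map_inv_map s)
  equiv_mul s a b hab := by
    refine Subtype.ext (LocallyConstant.ext fun x => ?_)
    change pullFun (π.dom s) (π.map s⁻¹)
        ((a.1 : LocallyConstant Y R) * (b.1 : LocallyConstant Y R)) x =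
      pullFun (π.dom s) (π.map s⁻¹) (a.1 : LocallyConstant Y R) x *
        pullFun (π.dom s) (π.map s⁻¹) (b.1 : LocallyConstant Y R) x
    by_cases hx : x ∈ π.dom s
    · simp only [pullFun_of_mem hx, LocallyConstant.mul_apply]
    · simp only [pullFun_of_notMem hx, mul_zero]
  equiv_symm s a ha := by
    refine Subtype.ext (LocallyConstant.ext fun x => ?_)
    change pullFun (π.dom s⁻¹) (π.map s) (a.1 : LocallyConstant Y R) x =
      pullFun (π.dom s⁻¹) (π.map s⁻¹⁻¹) (a.1 : LocallyConstant Y R) x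
    rw [InverseSemigroup.inv_inv']
  equiv_mem_mul s t a ha x hx := by
    change pullFun (π.dom s) (π.map s⁻¹) _ x = 0
    by_cases h : x ∈ π.dom s
    · rw [pullFun_of_mem h]
      refine ha _ fun h' => hx ?_
      have := π.map_mem_mul s t _ ⟨π.mapsTo_inv s h, h'⟩
      rwa [π.map_map_inv s x h] at this
    · exact pullFun_of_notMem h
  ideal_mono s t h f hf x hx := hf x fun h' => hx (π.dom_mono s t h h')
  equiv_equiv s t a ha ha2 hst ha' := by
    refine Subtype.ext (LocallyConstant.ext fun x => ?_)
    let A : Y → R := (a : LocallyConstant Y R)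
    change pullFun (π.dom s) (π.map s⁻¹) (pullFun (π.dom t) (π.map t⁻¹) A) x =
      pullFun (π.dom (s * t)) (π.map (s * t)⁻¹) A x
    have hA : ∀ z, A z ≠ 0 → z ∈ π.dom t⁻¹ ∧ z ∈ π.dom (t⁻¹ * s⁻¹) ∧ z ∈ π.dom (s * t)⁻¹ :=
      fun z hz => ⟨by_contra fun h => hz (ha z h), by_contra fun h => hz (ha2 z h),
        by_contra fun h => hz (hst z h)⟩
    by_cases h1 : pullFun (π.dom s) (π.map s⁻¹) (pullFun (π.dom t) (π.map t⁻¹) A) x = 0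
    · by_contra h2
      rw [h1] at h2
      have hx : x ∈ π.dom (s * t) := by_contra fun h => h2 (pullFun_of_notMem h).symm
      rw [pullFun_of_mem hx] at h2
      obtain ⟨w1, w2, w3⟩ := hA _ (Ne.symm h2)
      generalize hw : π.map (s * t)⁻¹ x = w at h2 w1 w2 w3
      have ex : π.map s (π.map t w) = x := by
        rw [π.map_map s t w ⟨w1, w2⟩, ← hw, π.map_map_inv _ x hx]
      have hy : π.map t w ∈ π.dom s⁻¹ := by
        by_contra h
        have : pullFun (π.dom t) (π.map t⁻¹) A (π.map t w) = 0 := ha' _ h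
        rw [pullFun_of_mem (π.mapsTo t w1), π.map_inv_map t w w1] at this
        exact h2 this.symm
      rw [← ex, pullFun_of_mem (π.mapsTo s hy), π.map_inv_map s _ hy,
        pullFun_of_mem (π.mapsTo t w1), π.map_inv_map t w w1] at h1
      exact h2 h1.symm
    · have hx : x ∈ π.dom s := by_contra fun h => h1 (pullFun_of_notMem h)
      rw [pullFun_of_mem hx] at h1 ⊢
      have hy : π.map s⁻¹ x ∈ π.dom t := by_contra fun h => h1 (pullFun_of_notMem h)
      rw [pullFun_of_mem hy] at h1 ⊢
      obtain ⟨w1, w2, w3⟩ := hA _ h1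
      have hxst : x ∈ π.dom (s * t) := by
        have := π.map_mem_mul s t _ ⟨π.mapsTo_inv s hx, hy⟩
        rwa [π.map_map_inv s x hx] at this
      have e := π.map_map s t _ ⟨w1, w2⟩
      rw [π.map_map_inv t _ hy, π.map_map_inv s x hx] at e
      rw [pullFun_of_mem hxst]
      refine congrArg A ?_
      conv_rhs => rw [e]
      rw [π.map_inv_map (s * t) _ w3]

open scoped Classical in
/-- The restriction `(π_s, Y_s ∩ U, U)` of a partial action to an open invariant set `U`. -/
noncomputable def restrict (π : PartialAction S Y) (U : Set Y)
    (hinv : ∀ s, ∀ x ∈ π.dom s⁻¹ ∩ U, π.map s x ∈ U) : PartialAction S U where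
  dom s := Subtype.val ⁻¹' π.dom s
  map s x := if h : π.map s x ∈ U then ⟨π.map s x, h⟩ else x
  isOpen_dom s := (π.isOpen_dom s).preimage continuous_subtype_val
  mapsTo s x hx := by
    simp only [dif_pos (hinv s x ⟨hx, x.2⟩)]
    exact π.mapsTo s hx
  continuousOn s := by
    rw [Topology.IsInducing.subtypeVal.continuousOn_iff]
    refine ((π.continuousOn s).comp continuous_subtype_val.continuousOn fun x hx => hx).congr ?_
    intro x hx
    simp only [Function.comp_apply]
    rw [dif_pos (hinv s x ⟨hx, x.2⟩)]
  map_inv_map s x hx := by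
    have h := hinv s x ⟨hx, x.2⟩
    have e := π.map_inv_map s x hx
    simp only [dif_pos h, e, x.2, dif_pos]
  map_mem_mul s t x hx := by
    rw [dif_pos (hinv s x ⟨hx.1, x.2⟩)]
    exact π.map_mem_mul s t x hx
  dom_mono s t h := Set.preimage_mono (π.dom_mono s t h)
  map_map s t x hx := by
    have h1 := hinv t x ⟨hx.1, x.2⟩
    have e := π.map_map s t x hx
    simp only [dif_pos h1, e]
    have h2 : π.map (s * t) x ∈ U := by
      refine hinv (s * t) x ⟨?_, x.2⟩
      rw [InverseSemigroup.mul_inv_rev']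
      exact hx.2
    simp only [dif_pos h2]

end PartialAction

/-! ## Partial actions of a group -/

/-- A partial action `φ = (φ_g, X_g, X)` of a group `G` on a topological space `X`: open sets
`X_g = dom g` and homeomorphisms `φ_g = map g : X_{g⁻¹} → X_g` (the inverse of `φ_g` is `φ_{g⁻¹}`
by the last three conditions). The values of `map g` outside `X_{g⁻¹}` play no role. -/
structure GroupPartialAction (G X : Type*) [Group G] [TopologicalSpace X] where
  dom : G → Set X
  map : G → X → X
  isOpen_dom : ∀ g, IsOpen (dom g)
  bijOn : ∀ g, Set.BijOn (map g) (dom g⁻¹) (dom g)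
  continuousOn : ∀ g, ContinuousOn (map g) (dom g⁻¹)
  dom_one : dom 1 = Set.univ
  map_one : ∀ x, map 1 x = x
  image_inter : ∀ g h, map g '' (dom g⁻¹ ∩ dom h) = dom g ∩ dom (g * h)
  map_map : ∀ g h, ∀ x ∈ dom h⁻¹ ∩ dom (h⁻¹ * g⁻¹), map g (map h x) = map (g * h) x

namespace GroupPartialAction

variable {G X : Type*} [Group G] [TopologicalSpace X] (φ : GroupPartialAction G X)

/-- A set `U ⊆ X` is invariant if `φ_g(U ∩ X_{g⁻¹}) ⊆ U` for all `g`. -/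
def IsInvariant (U : Set X) : Prop := ∀ g, ∀ x ∈ φ.dom g⁻¹ ∩ U, φ.map g x ∈ U

theorem map_mem (g : G) {x : X} (hx : x ∈ φ.dom g⁻¹) : φ.map g x ∈ φ.dom g := (φ.bijOn g).mapsTo hx

theorem map_inv_mem (g : G) {x : X} (hx : x ∈ φ.dom g) : φ.map g⁻¹ x ∈ φ.dom g⁻¹ := by
  have := φ.map_mem g⁻¹ (x := x)
  rw [inv_inv] at this
  exact this hx

theorem map_inv_map (g : G) {x : X} (hx : x ∈ φ.dom g⁻¹) : φ.map g⁻¹ (φ.map g x) = x := by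
  rw [φ.map_map g⁻¹ g x ⟨hx, by rw [inv_inv, inv_mul_cancel, φ.dom_one]; trivial⟩, inv_mul_cancel,
    φ.map_one]

theorem map_map_inv (g : G) {x : X} (hx : x ∈ φ.dom g) : φ.map g (φ.map g⁻¹ x) = x := by
  have := φ.map_inv_map g⁻¹ (x := x)
  rw [inv_inv] at this
  exact this hx

theorem map_mem_mul (g h : G) {x : X} (hx : x ∈ φ.dom g⁻¹) (hh : x ∈ φ.dom h) :
    φ.map g x ∈ φ.dom (g * h) := by
  have : φ.map g x ∈ φ.dom g ∩ φ.dom (g * h) := by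
    rw [← φ.image_inter]
    exact ⟨x, ⟨hx, hh⟩, rfl⟩
  exact this.2

/-- A partial action of a group, regarded as a partial action of an inverse semigroup. -/
def toPartialAction : PartialAction G X where
  dom := φ.dom
  map := φ.map
  isOpen_dom := φ.isOpen_dom
  mapsTo g := (φ.bijOn g).mapsTo
  continuousOn := φ.continuousOn
  map_inv_map g _ hx := φ.map_inv_map g hx
  map_mem_mul g h _ hx := φ.map_mem_mul g h hx.1 hx.2
  dom_mono s t h := by
    have h' : s = t * s⁻¹ * s := h
    rw [inv_mul_cancel_right] at h'
    rw [h']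
  map_map := φ.map_map

open scoped Pointwise in
/-- The partial action `φ'` of `S(G)`: for `s = ε_{i₁} ⋯ ε_{iₙ} [g]` the set `X_s` is
`X_g ∩ X_{i₁} ∩ ⋯ ∩ X_{iₙ}` and `φ'_s` is the restriction of `φ_g` to `X_{s⁻¹}`. -/
def exelAction : PartialAction (ExelSemigroup G) X where
  dom s := ⋂ a ∈ s.supp, φ.dom a
  map s := φ.map (ExelSemigroup.deg s)
  isOpen_dom s := s.supp_finite.isOpen_biInter fun a _ => φ.isOpen_dom a
  mapsTo s x hx := by
    refine Set.mem_iInter₂.2 fun a ha => ?_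
    rw [Set.mem_iInter₂, ExelSemigroup.supp_inv] at hx
    have h0 := Set.smul_mem_smul_set (a := (ExelSemigroup.deg s)⁻¹) s.one_mem_supp
    rw [smul_eq_mul, mul_one] at h0
    have h1 := hx _ h0
    have h2 := hx _ (Set.smul_mem_smul_set ha)
    have := φ.map_mem_mul _ _ h1 h2
    rwa [smul_eq_mul, mul_inv_cancel_left] at this
  continuousOn s := by
    refine (φ.continuousOn _).mono fun x hx => ?_
    have := Set.mem_iInter₂.1 hx _ (ExelSemigroup.deg_mem_supp s⁻¹)
    rwa [ExelSemigroup.deg_inv] at this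
  map_inv_map s x hx := by
    have h := Set.mem_iInter₂.1 hx _ (ExelSemigroup.deg_mem_supp s⁻¹)
    rw [ExelSemigroup.deg_inv] at h ⊢
    exact φ.map_inv_map _ h
  map_mem_mul s t x hx := by
    have h := Set.mem_iInter₂.1 hx.1 _ (ExelSemigroup.deg_mem_supp s⁻¹)
    rw [ExelSemigroup.deg_inv] at h
    refine Set.mem_iInter₂.2 fun a ha => ?_
    rw [ExelSemigroup.supp_mul] at ha
    rcases ha with ha | ⟨b, hb, rfl⟩
    · have h2 : x ∈ φ.dom ((ExelSemigroup.deg s)⁻¹ * a) := by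
        refine Set.mem_iInter₂.1 hx.1 _ ?_
        rw [ExelSemigroup.supp_inv]
        exact Set.smul_mem_smul_set ha
      have := φ.map_mem_mul _ _ h h2
      rwa [mul_inv_cancel_left] at this
    · exact φ.map_mem_mul _ _ h (Set.mem_iInter₂.1 hx.2 _ hb)
  dom_mono s t h := by
    refine Set.biInter_subset_biInter_left ?_
    have h' : s = t * (s⁻¹ * s) := by rw [← mul_assoc]; exact h
    rw [h', ExelSemigroup.supp_mul]
    exact Set.subset_union_left
  map_map s t x hx := by
    rw [map_mul]
    refine φ.map_map _ _ x ⟨?_, ?_⟩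
    · have h := Set.mem_iInter₂.1 hx.1 _ (ExelSemigroup.deg_mem_supp t⁻¹)
      rwa [ExelSemigroup.deg_inv] at h
    · have h := Set.mem_iInter₂.1 hx.2 _ (ExelSemigroup.deg_mem_supp (t⁻¹ * s⁻¹))
      rwa [map_mul, ExelSemigroup.deg_inv, ExelSemigroup.deg_inv] at h

theorem exelAction_invariant {U : Set X} (hU : φ.IsInvariant U) (s : ExelSemigroup G) (x : X)
    (hx : x ∈ φ.exelAction.dom s⁻¹ ∩ U) : φ.exelAction.map s x ∈ U := by
  refine hU _ x ⟨?_, hx.2⟩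
  have h := Set.mem_iInter₂.1 hx.1 _ (ExelSemigroup.deg_mem_supp s⁻¹)
  rwa [ExelSemigroup.deg_inv] at h

/-! ## The transformation groupoid -/

variable [TopologicalSpace G]

/-- The set `𝒢_X = ⋃_g {g} × X_g`, with the topology inherited from `G × X`. -/
def Arrow : Type _ := {p : G × X // p.2 ∈ φ.dom p.1}

instance : TopologicalSpace φ.Arrow :=
  inferInstanceAs (TopologicalSpace {p : G × X // p.2 ∈ φ.dom p.1})

instance [T2Space G] [T2Space X] : T2Space φ.Arrow :=
  inferInstanceAs (T2Space {p : G × X // p.2 ∈ φ.dom p.1})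

/-- The group coordinate `(g, x) ↦ g`. -/
def arrowDeg (p : φ.Arrow) : G := p.1.1

theorem continuous_arrowDeg : Continuous φ.arrowDeg := continuous_fst.comp continuous_subtype_val

theorem continuous_arrowSnd : Continuous fun p : φ.Arrow => p.1.2 :=
  continuous_snd.comp continuous_subtype_val

theorem isOpen_arrowDeg_fibre [DiscreteTopology G] (g : G) : IsOpen {p : φ.Arrow | φ.arrowDeg p = g} :=
  (isOpen_discrete {g}).preimage φ.continuous_arrowDeg

theorem continuous_arrow_d [DiscreteTopology G] :
    Continuous fun p : φ.Arrow => φ.map p.1.1⁻¹ p.1.2 := by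
  rw [continuous_iff_continuousAt]
  intro p
  have h1 : ContinuousAt (φ.map p.1.1⁻¹) p.1.2 := by
    refine (φ.continuousOn p.1.1⁻¹).continuousAt ((φ.isOpen_dom _).mem_nhds ?_)
    rw [inv_inv]
    exact p.2
  have h2 : ContinuousAt (fun q : φ.Arrow => φ.map p.1.1⁻¹ q.1.2) p :=
    ContinuousAt.comp (f := fun q : φ.Arrow => q.1.2) h1 φ.continuous_arrowSnd.continuousAt
  refine h2.congr ?_
  filter_upwards [(φ.isOpen_arrowDeg_fibre p.1.1).mem_nhds rfl] with q hq
  rw [show q.1.1 = p.1.1 from hq]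

theorem arrow_comp_mem (p q : φ.Arrow) (h : φ.map p.1.1⁻¹ p.1.2 = q.1.2) :
    p.1.2 ∈ φ.dom (p.1.1 * q.1.1) := by
  have h1 : φ.map p.1.1⁻¹ p.1.2 ∈ φ.dom q.1.1 := by rw [h]; exact q.2
  have := φ.map_mem_mul _ _ (φ.map_inv_mem _ p.2) h1
  rwa [φ.map_map_inv _ p.2] at this

/-- The groupoid `𝒢_X`: `d(g, x) = φ_{g⁻¹}(x)`, `r(g, x) = x`, `(g, x)(h, y) = (gh, x)` and
`(g, x)⁻¹ = (g⁻¹, φ_{g⁻¹}(x))`. -/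
def topGroupoid [DiscreteTopology G] : TopGroupoid X φ.Arrow where
  d p := φ.map p.1.1⁻¹ p.1.2
  r p := p.1.2
  unit x := ⟨(1, x), by rw [φ.dom_one]; trivial⟩
  inv p := ⟨(p.1.1⁻¹, φ.map p.1.1⁻¹ p.1.2), φ.map_inv_mem _ p.2⟩
  comp p q h := ⟨(p.1.1 * q.1.1, p.1.2), φ.arrow_comp_mem p q h⟩
  d_unit x := by simp only [inv_one, φ.map_one]
  r_unit x := rfl
  d_inv p := by simp only [inv_inv, φ.map_map_inv _ p.2]
  r_inv p := rfl
  d_comp p q h := by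
    have hp : p.1.2 ∈ φ.dom p.1.1 := p.2
    have h2 := φ.arrow_comp_mem p q h
    rw [mul_inv_rev, ← φ.map_map _ _ p.1.2 ⟨by rwa [inv_inv], by rwa [inv_inv, inv_inv]⟩, h]
  r_comp p q h := rfl
  comp_assoc p q s h h' := Subtype.ext (Prod.ext (mul_assoc _ _ _) rfl)
  unit_comp p := Subtype.ext (Prod.ext (one_mul _) rfl)
  comp_unit p := Subtype.ext (Prod.ext (mul_one _) rfl)
  inv_comp p := Subtype.ext (Prod.ext (inv_mul_cancel _) rfl)
  comp_inv p := Subtype.ext (Prod.ext (mul_inv_cancel _) rfl)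
  continuous_d := φ.continuous_arrow_d
  continuous_r := φ.continuous_arrowSnd
  continuous_unit := (continuous_const.prodMk continuous_id).subtype_mk fun x => by
    rw [φ.dom_one]; trivial
  continuous_inv :=
    ((continuous_of_discreteTopology.comp φ.continuous_arrowDeg).prodMk
      φ.continuous_arrow_d).subtype_mk fun p => φ.map_inv_mem _ p.2
  continuous_comp := by
    refine Continuous.subtype_mk (Continuous.prodMk ?_ ?_) fun p => φ.arrow_comp_mem _ _ p.2
    · exact (continuous_of_discreteTopology (f := fun q : G × G => q.1 * q.2)).comp
        ((φ.continuous_arrowDeg.comp (continuous_fst.comp continuous_subtype_val)).prodMk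
          (φ.continuous_arrowDeg.comp (continuous_snd.comp continuous_subtype_val)))
    · exact φ.continuous_arrowSnd.comp (continuous_fst.comp continuous_subtype_val)

theorem isOpenMap_arrow_d [DiscreteTopology G] : IsOpenMap φ.topGroupoid.d := by
  intro O hO
  rw [isOpen_iff_mem_nhds]
  rintro _ ⟨⟨⟨g, x⟩, hx⟩, hp, rfl⟩
  change _ ∈ nhds (φ.map g⁻¹ x)
  have hy : φ.map g⁻¹ x ∈ φ.dom g⁻¹ := φ.map_inv_mem g hx
  obtain ⟨O', hO', rfl⟩ := isOpen_induced_iff.1 hO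
  have hc : ContinuousAt (fun y => (g, φ.map g y)) (φ.map g⁻¹ x) :=
    continuousAt_const.prodMk ((φ.continuousOn g).continuousAt ((φ.isOpen_dom _).mem_nhds hy))
  have hmem : (g, φ.map g (φ.map g⁻¹ x)) ∈ O' := by
    rw [φ.map_map_inv g hx]; exact hp
  filter_upwards [hc.eventually (hO'.mem_nhds hmem), (φ.isOpen_dom _).mem_nhds hy] with y h1 h2
  exact ⟨⟨(g, φ.map g y), φ.map_mem g h2⟩, h1, φ.map_inv_map g h2⟩

theorem isOpenMap_arrow_r [DiscreteTopology G] : IsOpenMap φ.topGroupoid.r := by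
  intro O hO
  rw [isOpen_iff_mem_nhds]
  rintro _ ⟨⟨⟨g, x⟩, hx⟩, hp, rfl⟩
  change _ ∈ nhds x
  obtain ⟨O', hO', rfl⟩ := isOpen_induced_iff.1 hO
  have hc : ContinuousAt (fun y : X => (g, y)) x := continuousAt_const.prodMk continuousAt_id
  filter_upwards [hc.eventually (hO'.mem_nhds hp), (φ.isOpen_dom _).mem_nhds hx] with y h1 h2
  exact ⟨⟨(g, y), h2⟩, h1, rfl⟩

theorem injOn_arrow_d [DiscreteTopology G] (g : G) :
    Set.InjOn φ.topGroupoid.d {p | φ.arrowDeg p = g} := by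
  rintro ⟨⟨a, x⟩, hx⟩ (rfl : a = g) ⟨⟨b, y⟩, hy⟩ (rfl : b = a) e
  change φ.map b⁻¹ x = φ.map b⁻¹ y at e
  change x ∈ φ.dom b at hx
  change y ∈ φ.dom b at hy
  have : x = y := by rw [← φ.map_map_inv b hx, e, φ.map_map_inv b hy]
  subst this
  rfl

theorem injOn_arrow_r [DiscreteTopology G] (g : G) :
    Set.InjOn φ.topGroupoid.r {p | φ.arrowDeg p = g} := by
  rintro ⟨⟨a, x⟩, hx⟩ (rfl : a = g) ⟨⟨b, y⟩, hy⟩ (rfl : b = a) (rfl : x = y)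
  rfl

theorem isAmple [DiscreteTopology G] [T2Space X] [LocallyCompactSpace X]
    [TotallyDisconnectedSpace X] : φ.topGroupoid.IsAmple := by
  constructor
  · rw [isLocalHomeomorph_iff_isOpenEmbedding_restrict]
    intro p
    refine ⟨_, (φ.isOpen_arrowDeg_fibre (φ.arrowDeg p)).mem_nhds rfl, ?_⟩
    exact .of_continuous_injective_isOpenMap
      (φ.topGroupoid.continuous_d.comp continuous_subtype_val)
      (Set.injOn_iff_injective.1 (φ.injOn_arrow_d _))
      (φ.isOpenMap_arrow_d.comp (φ.isOpen_arrowDeg_fibre _).isOpenMap_subtype_val)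
  · refine TopologicalSpace.isTopologicalBasis_of_isOpen_of_nhds (fun B hB => hB.2.1) ?_
    rintro ⟨⟨g, x⟩, hx⟩ O hp hO
    obtain ⟨O', hO', rfl⟩ := isOpen_induced_iff.1 hO
    obtain ⟨V, hV, hxV, hsub⟩ : ∃ V : Set X, IsOpen V ∧ x ∈ V ∧ ∀ y ∈ V, y ∈ φ.dom g ∧ (g, y) ∈ O' :=
      ⟨φ.dom g ∩ (fun y => (g, y)) ⁻¹' O',
        (φ.isOpen_dom g).inter (hO'.preimage (continuous_const.prodMk continuous_id)), ⟨hx, hp⟩,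
        fun y hy => hy⟩
    obtain ⟨K, hK, hxK, hKV⟩ := exists_compact_subset hV hxV
    obtain ⟨C, hC, hxC, hCK⟩ :=
      (loc_compact_Haus_tot_disc_of_zero_dim (H := X)).exists_subset_of_mem_open hxK isOpen_interior
    have hCc : IsCompact C := hK.of_isClosed_subset hC.isClosed (hCK.trans interior_subset)
    have hCV : C ⊆ V := (hCK.trans interior_subset).trans hKV
    let B : Set φ.Arrow := {p | φ.arrowDeg p = g ∧ p.1.2 ∈ C}
    have hBo : IsOpen B :=
      (φ.isOpen_arrowDeg_fibre g).inter (hC.isOpen.preimage φ.continuous_arrowSnd)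
    have hBc : IsCompact B := by
      have e : B = Set.range fun y : C => (⟨(g, y.1), (hsub _ (hCV y.2)).1⟩ : φ.Arrow) := by
        ext ⟨⟨a, y⟩, hy⟩
        constructor
        · rintro ⟨rfl : a = g, h⟩
          exact ⟨⟨y, h⟩, rfl⟩
        · rintro ⟨z, hz⟩
          rw [← hz]
          exact ⟨rfl, z.2⟩
      rw [e]
      have := isCompact_iff_compactSpace.1 hCc
      exact isCompact_range ((continuous_const.prodMk continuous_subtype_val).subtype_mk _)
    refine ⟨B, ⟨hBc, ?_⟩, ⟨rfl, hxC⟩, ?_⟩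
    · exact TopGroupoid.isOpenBisection_of_injOn φ.isOpenMap_arrow_d φ.isOpenMap_arrow_r hBo
        ((φ.injOn_arrow_d g).mono fun _ h => h.1) ((φ.injOn_arrow_r g).mono fun _ h => h.1)
    · rintro ⟨⟨a, y⟩, hy⟩ ⟨rfl : a = g, h⟩
      exact (hsub y (hCV h)).2

/-- The ample Hausdorff groupoid `𝒢_X`. -/
def groupoid [DiscreteTopology G] [T2Space X] [LocallyCompactSpace X]
    [TotallyDisconnectedSpace X] : AmpleGroupoid X φ.Arrow where
  toTopGroupoid := φ.topGroupoid
  isAmple := φ.isAmple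

/-- The canonical cocycle `𝒢_X → G`, `(g, x) ↦ g`. -/
def grading [DiscreteTopology G] [T2Space X] [LocallyCompactSpace X]
    [TotallyDisconnectedSpace X] : Grading φ.groupoid.toTopGroupoid G where
  deg := φ.arrowDeg
  continuous_deg := φ.continuous_arrowDeg
  deg_comp _ _ _ := rfl

variable {φ}

theorem IsInvariant.groupoid [DiscreteTopology G] [T2Space X] [LocallyCompactSpace X]
    [TotallyDisconnectedSpace X] {U : Set X} (hU : φ.IsInvariant U) :
    φ.groupoid.IsInvariant U := by
  rintro ⟨⟨g, x⟩, hx⟩ h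
  change φ.map g⁻¹ x ∈ U at h
  change x ∈ U
  have := hU g _ ⟨φ.map_inv_mem g hx, h⟩
  rwa [φ.map_map_inv g hx] at this

end GroupPartialAction

/-! ## The canonical action of bisections, and reductions -/

section Ample

variable {X Γ : Type*} [TopologicalSpace X] [TopologicalSpace Γ] [T2Space X] [T2Space Γ]

open scoped Classical in
/-- The canonical partial action of `𝒢^(h)` on the unit space: `X_B = r(B)` and `π_B(d(b)) = r(b)`
for `b ∈ B`. -/
noncomputable def bisectionAction (𝒢 : AmpleGroupoid X Γ) {G : Type*} [Group G]
    [TopologicalSpace G] (c : Grading 𝒢.toTopGroupoid G) :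
    PartialAction (GradedBisection 𝒢 c) X :=
  let act : GradedBisection 𝒢 c → X → X := fun B x =>
    if h : ∃ b ∈ B.carrier, 𝒢.d b = x then 𝒢.r h.choose else x
  have act_d : ∀ (B : GradedBisection 𝒢 c) (b : Γ), b ∈ B.carrier → act B (𝒢.d b) = 𝒢.r b := by
    intro B b hb
    have h : ∃ b' ∈ B.carrier, 𝒢.d b' = 𝒢.d b := ⟨b, hb, rfl⟩
    simp only [act, dif_pos h]
    rw [B.isOpenBisection.injOn_d h.choose_spec.1 hb h.choose_spec.2]
  have dom_inv : ∀ (B : GradedBisection 𝒢 c) (x : X), x ∈ 𝒢.r '' (B⁻¹).carrier →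
      ∃ b ∈ B.carrier, 𝒢.d b = x := by
    rintro B _ ⟨_, ⟨b, hb, rfl⟩, rfl⟩
    exact ⟨b, hb, (𝒢.r_inv b).symm⟩
  { dom := fun B => 𝒢.r '' B.carrier
    map := act
    isOpen_dom := fun B => 𝒢.isOpenMap_r 𝒢.isAmple _ B.isOpenBisection.1
    mapsTo := by
      intro B x hx
      obtain ⟨b, hb, rfl⟩ := dom_inv B x hx
      rw [act_d B b hb]
      exact ⟨b, hb, rfl⟩
    continuousOn := by
      intro B x hx
      obtain ⟨b, hb, rfl⟩ := dom_inv B x hx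
      refine ContinuousAt.continuousWithinAt ?_
      rw [ContinuousAt, act_d B b hb, Filter.tendsto_def]
      intro O hO
      obtain ⟨O', hO'O, hO', hbO'⟩ := mem_nhds_iff.1 hO
      have hopen : IsOpen (𝒢.d '' (B.carrier ∩ 𝒢.r ⁻¹' O')) :=
        𝒢.isOpenMap_d 𝒢.isAmple _ (B.isOpenBisection.1.inter (hO'.preimage 𝒢.continuous_r))
      refine Filter.mem_of_superset (hopen.mem_nhds ⟨b, ⟨hb, hbO'⟩, rfl⟩) ?_
      rintro _ ⟨b', ⟨hb', hr⟩, rfl⟩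
      rw [Set.mem_preimage, act_d B b' hb']
      exact hO'O hr
    map_inv_map := by
      intro B x hx
      obtain ⟨b, hb, rfl⟩ := dom_inv B x hx
      rw [act_d B b hb, ← 𝒢.d_inv b, act_d B⁻¹ (𝒢.inv b) ⟨b, hb, rfl⟩, 𝒢.r_inv]
    map_mem_mul := by
      rintro B C x ⟨hx, ⟨c', hc, e⟩⟩
      obtain ⟨b, hb, rfl⟩ := dom_inv B x hx
      rw [act_d B b hb]
      exact ⟨𝒢.comp b c' e.symm, ⟨b, c', e.symm, hb, hc, rfl⟩, 𝒢.r_comp _ _ _⟩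
    dom_mono := by
      rintro B C h _ ⟨b, hb, rfl⟩
      have hb' : b ∈ (C * B⁻¹ * B).carrier := by
        have h' : B = C * B⁻¹ * B := h
        rwa [← h']
      obtain ⟨_, z, _, ⟨x, y, hxy, hx, hy, rfl⟩, hz, rfl⟩ := hb'
      exact ⟨x, hx, by rw [𝒢.r_comp, 𝒢.r_comp]⟩
    map_map := by
      rintro B C x ⟨hx, hx2⟩
      have hx3 : x ∈ 𝒢.r '' ((B * C)⁻¹).carrier := by
        rw [InverseSemigroup.mul_inv_rev']; exact hx2
      obtain ⟨_, ⟨b, c', hbc, hb, hc, rfl⟩, rfl⟩ := dom_inv (B * C) x hx3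
      rw [act_d (B * C) _ ⟨b, c', hbc, hb, hc, rfl⟩, 𝒢.r_comp, 𝒢.d_comp, act_d C c' hc, ← hbc,
        act_d B b hb] }

theorem bisectionAction_invariant (𝒢 : AmpleGroupoid X Γ) {G : Type*} [Group G]
    [TopologicalSpace G] (c : Grading 𝒢.toTopGroupoid G) {U : Set X} (hU : 𝒢.IsInvariant U)
    (B : GradedBisection 𝒢 c) (x : X) (hx : x ∈ (bisectionAction 𝒢 c).dom B⁻¹ ∩ U) :
    (bisectionAction 𝒢 c).map B x ∈ U := by
  obtain ⟨⟨_, ⟨b, hb, rfl⟩, hbx⟩, hxU⟩ := hx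
  rw [𝒢.r_inv] at hbx
  have h : ∃ b ∈ B.carrier, 𝒢.d b = x := ⟨b, hb, hbx⟩
  have e : (bisectionAction 𝒢 c).map B x = 𝒢.r h.choose := by
    simp only [bisectionAction]
    exact dif_pos h
  rw [e]
  exact hU _ (by rw [h.choose_spec.2]; exact hxU)

/-- The reduction `𝒢_U = d⁻¹(U)` of a groupoid to an invariant set of units. -/
def TopGroupoid.reduction (𝒢 : TopGroupoid X Γ) (U : Set X) (hU : 𝒢.IsInvariant U) :
    TopGroupoid U {γ : Γ // 𝒢.d γ ∈ U} where
  d γ := ⟨𝒢.d γ, γ.2⟩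
  r γ := ⟨𝒢.r γ, hU _ γ.2⟩
  unit x := ⟨𝒢.unit x, by rw [𝒢.d_unit]; exact x.2⟩
  inv γ := ⟨𝒢.inv γ, by rw [𝒢.d_inv]; exact hU _ γ.2⟩
  comp α β h := ⟨𝒢.comp α β (congrArg Subtype.val h), by rw [𝒢.d_comp]; exact β.2⟩
  d_unit x := Subtype.ext (𝒢.d_unit x)
  r_unit x := Subtype.ext (𝒢.r_unit x)
  d_inv γ := Subtype.ext (𝒢.d_inv γ)
  r_inv γ := Subtype.ext (𝒢.r_inv γ)
  d_comp α β h := Subtype.ext (𝒢.d_comp _ _ _)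
  r_comp α β h := Subtype.ext (𝒢.r_comp _ _ _)
  comp_assoc α β γ h h' := Subtype.ext (𝒢.comp_assoc _ _ _ _ _)
  unit_comp α := Subtype.ext (𝒢.unit_comp _)
  comp_unit α := Subtype.ext (𝒢.comp_unit _)
  inv_comp α := Subtype.ext (𝒢.inv_comp _)
  comp_inv α := Subtype.ext (𝒢.comp_inv _)
  continuous_d := (𝒢.continuous_d.comp continuous_subtype_val).subtype_mk fun γ => γ.2
  continuous_r := (𝒢.continuous_r.comp continuous_subtype_val).subtype_mk fun γ => hU _ γ.2
  continuous_unit := (𝒢.continuous_unit.comp continuous_subtype_val).subtype_mk fun x => by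
    rw [Function.comp_apply, 𝒢.d_unit]; exact x.2
  continuous_inv := (𝒢.continuous_inv.comp continuous_subtype_val).subtype_mk fun γ => by
    rw [Function.comp_apply, 𝒢.d_inv]; exact hU _ γ.2
  continuous_comp := by
    refine Continuous.subtype_mk ?_ fun p => by rw [𝒢.d_comp]; exact p.1.2.2
    exact 𝒢.continuous_comp.comp
      (Continuous.subtype_mk
        (f := fun p : {p : {γ : Γ // 𝒢.d γ ∈ U} × {γ : Γ // 𝒢.d γ ∈ U} //
          (⟨𝒢.d p.1, p.1.2⟩ : U) = ⟨𝒢.r p.2, hU _ p.2.2⟩} => ((p.1.1 : Γ), (p.1.2 : Γ)))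
        ((continuous_subtype_val.comp (continuous_fst.comp continuous_subtype_val)).prodMk
          (continuous_subtype_val.comp (continuous_snd.comp continuous_subtype_val)))
        fun p => congrArg Subtype.val p.2)

/-- The reduction of an ample Hausdorff groupoid to an open invariant set of units. -/
def AmpleGroupoid.reduction (𝒢 : AmpleGroupoid X Γ) (U : Set X) (hUo : IsOpen U)
    (hU : 𝒢.IsInvariant U) : AmpleGroupoid U {γ : Γ // 𝒢.d γ ∈ U} where
  toTopGroupoid := 𝒢.toTopGroupoid.reduction U hU
  isAmple := by
    have hΓ : IsOpen {γ : Γ | 𝒢.d γ ∈ U} := hUo.preimage 𝒢.continuous_d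
    have hopen : ∀ f : Γ → X, IsOpenMap f → ∀ (f' : {γ : Γ // 𝒢.d γ ∈ U} → U),
        (∀ γ, (f' γ : X) = f γ) → IsOpenMap f' := by
      intro f hf f' hf' O hO
      rw [hUo.isOpenEmbedding_subtypeVal.isOpen_iff_image_isOpen, Set.image_image]
      have : (fun γ : {γ : Γ // 𝒢.d γ ∈ U} => (f' γ : X)) '' O = f '' (Subtype.val '' O) := by
        rw [Set.image_image]; exact Set.image_congr fun γ _ => hf' γ
      rw [this]
      exact hf _ (hΓ.isOpenMap_subtype_val _ hO)
    have hd : IsOpenMap (𝒢.toTopGroupoid.reduction U hU).d :=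
      hopen 𝒢.d (𝒢.isOpenMap_d 𝒢.isAmple) _ fun _ => rfl
    have hr : IsOpenMap (𝒢.toTopGroupoid.reduction U hU).r :=
      hopen 𝒢.r (𝒢.isOpenMap_r 𝒢.isAmple) _ fun _ => rfl
    have basis : TopologicalSpace.IsTopologicalBasis {B : Set {γ : Γ // 𝒢.d γ ∈ U} |
        IsCompact B ∧ (𝒢.toTopGroupoid.reduction U hU).IsOpenBisection B} := by
      refine TopologicalSpace.isTopologicalBasis_of_isOpen_of_nhds (fun B hB => hB.2.1) ?_
      intro γ O hγ hO
      obtain ⟨B, ⟨hBc, hB⟩, hγB, hBO⟩ := 𝒢.isAmple.2.exists_subset_of_mem_open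
        (Set.mem_image_of_mem Subtype.val hγ) (hΓ.isOpenMap_subtype_val _ hO)
      have hBs : Subtype.val ⁻¹' B ⊆ O := by
        intro γ' hγ'
        obtain ⟨γ'', h1, h2⟩ := hBO hγ'
        rwa [← Subtype.ext h2]
      refine ⟨Subtype.val ⁻¹' B, ⟨?_, ?_⟩, hγB, hBs⟩
      · refine (Topology.IsInducing.isCompact_preimage_iff Topology.IsInducing.subtypeVal ?_).2 hBc
        intro γ' hγ'
        obtain ⟨γ'', -, rfl⟩ := hBO hγ'
        exact ⟨γ'', rfl⟩
      · refine TopGroupoid.isOpenBisection_of_injOn hd hr (hB.1.preimage continuous_subtype_val)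
          ?_ ?_
        · exact fun x hx y hy e => Subtype.ext (hB.injOn_d hx hy (congrArg Subtype.val e))
        · exact fun x hx y hy e => Subtype.ext (hB.injOn_r hx hy (congrArg Subtype.val e))
    refine ⟨?_, basis⟩
    rw [isLocalHomeomorph_iff_isOpenEmbedding_restrict]
    intro γ
    obtain ⟨B, ⟨-, hB⟩, hγB, -⟩ := basis.exists_subset_of_mem_open (Set.mem_univ γ) isOpen_univ
    exact ⟨B, hB.1.mem_nhds hγB, hB.2.1⟩

end Ample

/-! ## Graded algebras and graded isomorphisms -/

open scoped Classical in
/-- The multiplication of `A` and the submodules `𝒜 g` make `A` an associative (not necessarily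
unital) `G`-graded `R`-algebra: `A = ⨁ 𝒜 g` and `𝒜 g * 𝒜 h ⊆ 𝒜 (g h)`. -/
structure IsGradedAlgebra {R G A : Type*} [CommRing R] [Group G] [AddCommGroup A] [Module R A]
    [Mul A] (𝒜 : G → Submodule R A) : Prop where
  add_mul : ∀ x y z : A, (x + y) * z = x * z + y * z
  mul_add : ∀ x y z : A, x * (y + z) = x * y + x * z
  smul_mul : ∀ (c : R) (x y : A), (c • x) * y = c • (x * y)
  mul_smul : ∀ (c : R) (x y : A), x * (c • y) = c • (x * y)
  mul_assoc : ∀ x y z : A, x * y * z = x * (y * z)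
  mul_mem : ∀ g h, ∀ x ∈ 𝒜 g, ∀ y ∈ 𝒜 h, x * y ∈ 𝒜 (g * h)
  isInternal : DirectSum.IsInternal 𝒜

/-- There is an isomorphism of `R`-algebras `A ≅ B` mapping `𝒜 g` onto `ℬ g` for every `g`. -/
def GradedIso {R G A B : Type*} [CommRing R] [AddCommGroup A] [Module R A] [Mul A]
    [AddCommGroup B] [Module R B] [Mul B] (𝒜 : G → Submodule R A) (ℬ : G → Submodule R B) : Prop :=
  ∃ e : A ≃ₗ[R] B, (∀ x y, e (x * y) = e x * e y) ∧ ∀ g, (𝒜 g).map (e : A →ₗ[R] B) = ℬ g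

/-! ## The gradings of the algebras in question -/

/-- The grading of `A ⋊_π 𝒢^(h)` for a partial action `π` of `𝒢^(h)`: `a δ_B` has degree `g` if
`B ⊆ 𝒢_g`. -/
noncomputable def bisectionGrading {R A X Γ G : Type*} [CommRing R] [NonUnitalRing A] [Module R A]
    [IsScalarTower R A A] [SMulCommClass R A A] [TopologicalSpace X] [TopologicalSpace Γ]
    [T2Space X] [T2Space Γ] [Group G] [TopologicalSpace G] {𝒢 : AmpleGroupoid X Γ}
    {c : Grading 𝒢.toTopGroupoid G} (π : AlgPartialAction R (GradedBisection 𝒢 c) A) (g : G) :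
    Submodule R π.SkewRing :=
  π.component {B | ∀ γ ∈ B.carrier, c.deg γ = g}

/-- The grading of `A ⋊_π S(G)`: `a δ_s` has degree `∂ s`. -/
noncomputable def exelGrading {R A G : Type*} [CommRing R] [NonUnitalRing A] [Module R A]
    [IsScalarTower R A A] [SMulCommClass R A A] [Group G]
    (π : AlgPartialAction R (ExelSemigroup G) A) (g : G) : Submodule R π.SkewRing :=
  π.component {s | ExelSemigroup.deg s = g}

/-- The partial skew group ring `A ⋊_π G` of formal sums `∑ a_g δ_g`, `a_g ∈ A_g`. -/
abbrev SkewGroupRing {R A G : Type*} [CommRing R] [NonUnitalRing A] [Module R A] [Group G]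
    (π : AlgPartialAction R G A) : Type _ := π.Formal

/-- The grading of `A ⋊_π G`: the component of degree `g` is `A_g δ_g`. -/
noncomputable def groupGrading {R A G : Type*} [CommRing R] [NonUnitalRing A] [Module R A] [Group G]
    (π : AlgPartialAction R G A) (g : G) : Submodule R (SkewGroupRing π) :=
  LinearMap.range (π.delta g)

namespace GroupPartialAction

variable {G X : Type*} [Group G] [TopologicalSpace G] [DiscreteTopology G] [TopologicalSpace X]
  [T2Space X] [LocallyCompactSpace X] [TotallyDisconnectedSpace X]
  (R : Type*) [CommRing R] (φ : GroupPartialAction G X)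

/-- The partial action `π = (π_B, C_R(X_B), C_R(X))` of `𝒢_X^(h)`, `X_B = r(B)`. -/
noncomputable def bisectionCR : AlgPartialAction R (GradedBisection φ.groupoid φ.grading) (CR R X) :=
  (bisectionAction φ.groupoid φ.grading).onCR R

/-- The partial action `φ' = (φ'_s, E_s, C_R(X))` of `S(G)`. -/
noncomputable def exelCR : AlgPartialAction R (ExelSemigroup G) (CR R X) :=
  φ.exelAction.onCR R

/-- The partial action `φ = (φ_g, C_R(X_g), C_R(X))` of `G`. -/
noncomputable def groupCR : AlgPartialAction R G (CR R X) :=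
  φ.toPartialAction.onCR R

variable {φ} {U : Set X} (hU : φ.IsInvariant U)

/-- The partial action `π = (π_B, C_R(U_B), C_R(U))` of `𝒢_X^(h)`, `U_B = r(B) ∩ U`. -/
noncomputable def bisectionCROn :
    AlgPartialAction R (GradedBisection φ.groupoid φ.grading) (CR R U) :=
  ((bisectionAction φ.groupoid φ.grading).restrict U
    (bisectionAction_invariant φ.groupoid φ.grading hU.groupoid)).onCR R

/-- The partial action `φ' = (φ'_s, E_s, C_R(U))` of `S(G)`. -/
noncomputable def exelCROn : AlgPartialAction R (ExelSemigroup G) (CR R U) :=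
  (φ.exelAction.restrict U (φ.exelAction_invariant hU)).onCR R

/-- The partial action `φ = (φ_g, C_R(U_g), C_R(U))` of `G`, `U_g = X_g ∩ U`. -/
noncomputable def groupCROn : AlgPartialAction R G (CR R U) :=
  (φ.toPartialAction.restrict U hU).onCR R

variable (φ)

/-- The grading of `A_R(𝒢_X)`. -/
noncomputable def steinbergGrading : G → Submodule R (Steinberg R φ.groupoid) :=
  Steinberg.component φ.grading.deg

variable {φ}

/-- The grading of `A_R(𝒢_U)`, `𝒢_U = d⁻¹(U) ⊆ 𝒢_X`. -/
noncomputable def steinbergGradingOn (hUo : IsOpen U) :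
    G → Submodule R (Steinberg R (φ.groupoid.reduction U hUo hU.groupoid)) :=
  Steinberg.component fun γ => φ.grading.deg γ.1

end GroupPartialAction

end PartialSkew

/-!
Each of the algebras is compared with a partial skew group ring `C_R(Y) ⋊_ρ G`, where `ρ` is the
partial action of `G` on `Y = U` or `Y = X`.

In `C_R(Y) ⋊_ρ G` the product of `a δ_g` and `b δ_h` is `c δ_{gh}` with `c(x) = a(x) b(g⁻¹x)`
(`PartialAction.onCR_coeff_apply`). Both bracketings of a triple product therefore have the
coefficient `x ↦ a(x) b(g⁻¹x) c((gh)⁻¹x)`, so this ring is an associative graded algebra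
(`PartialAction.isGradedAlgebra_groupGrading`). The axioms are carried to the other algebras by the
graded isomorphisms (`IsGradedAlgebra.of_gradedIso`).

For the skew inverse semigroup rings let `S` be `S(G)` or the semigroup of graded bisections. Every
`π_s` is a restriction of `ρ_g`, `g` the degree of `s`; two elements of the same degree have a common
upper bound (the generator `[g]` of `S(G)`, the union of two bisections); and every function in
`C_R(Y_g)`, having compact open support, lies in some `C_R(Y_s)` with `s` of degree `g`. Modulo the
ideal generated by the `a δ_s - a δ_t`, `s ≤ t`, the class of `a δ_s` hence depends only on `a` and
`g`, and `[a δ_s] ↦ a δ_g` is an isomorphism. These properties are collected in `IsGradedOver`, which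
passes to restrictions to `U` (`IsGradedOver.restrict`), and the isomorphism is
`IsGradedOver.gradedIso`.

For the Steinberg algebra, `r` maps the arrows of degree `g` homeomorphically onto `Y_g`
(`IsTransformationGroupoid`), so that a function on arrows is a family of functions `a_g` on the
`Y_g`, only finitely many of them nonzero when the support is compact. An arrow `γ` has at most one
factorization `γ = αβ` with `α` of degree `g`, namely the one with `r α = r γ`, and the convolution
becomes the product formula above (`IsTransformationGroupoid.gradedIso_steinberg`).
-/

namespace PartialSkew

open AlgPartialAction

/-! ### Graded isomorphisms -/

section GradedIso

variable {R G A B C : Type*} [CommRing R] [AddCommGroup A] [Module R A] [Mul A]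
  [AddCommGroup B] [Module R B] [Mul B] [AddCommGroup C] [Module R C] [Mul C]
  {𝒜 : G → Submodule R A} {ℬ : G → Submodule R B} {𝒞 : G → Submodule R C}

theorem GradedIso.symm (h : GradedIso 𝒜 ℬ) : GradedIso ℬ 𝒜 := by
  obtain ⟨e, hm, hg⟩ := h
  refine ⟨e.symm, fun x y => e.injective ?_, fun g => ?_⟩
  · rw [hm, e.apply_symm_apply, e.apply_symm_apply, e.apply_symm_apply]
  · rw [← hg g]
    ext x
    simp

theorem GradedIso.trans (h : GradedIso 𝒜 ℬ) (h' : GradedIso ℬ 𝒞) : GradedIso 𝒜 𝒞 := by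
  obtain ⟨e, hm, hg⟩ := h
  obtain ⟨e', hm', hg'⟩ := h'
  refine ⟨e.trans e', fun x y => ?_, fun g => ?_⟩
  · rw [e.trans_apply, hm, hm', e.trans_apply, e.trans_apply]
  · rw [← hg' g, ← hg g]
    ext x
    simp

/-- The axioms of a graded algebra are invariant under graded isomorphism. -/
theorem IsGradedAlgebra.of_gradedIso [Group G] (hB : IsGradedAlgebra ℬ) (h : GradedIso 𝒜 ℬ) :
    IsGradedAlgebra 𝒜 := by
  classical
  obtain ⟨e, hm, hg⟩ := h
  have hmem : ∀ g x, x ∈ 𝒜 g ↔ e x ∈ ℬ g := fun g x => by rw [← hg g]; simp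
  refine ⟨fun x y z => ?_, fun x y z => ?_, fun c x y => ?_, fun c x y => ?_, fun x y z => ?_,
    fun g k x hx y hy => ?_, ?_⟩
  · apply e.injective
    rw [hm, map_add, map_add, hB.add_mul, hm, hm]
  · apply e.injective
    rw [hm, map_add, map_add, hB.mul_add, hm, hm]
  · apply e.injective
    rw [hm, map_smul, map_smul, hB.smul_mul, hm]
  · apply e.injective
    rw [hm, map_smul, map_smul, hB.mul_smul, hm]
  · apply e.injective
    rw [hm, hm, hm, hm, hB.mul_assoc]
  · rw [hmem] at hx hy ⊢
    rw [hm]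
    exact hB.mul_mem g k _ hx _ hy
  · have hi := hB.isInternal
    have hA : 𝒜 = Submodule.orderIsoMapComap e.symm ∘ ℬ := by
      funext g
      rw [Function.comp_apply, ← hg g]
      ext x
      simp
    rw [DirectSum.isInternal_submodule_iff_iSupIndep_and_iSup_eq_top] at hi ⊢
    rw [hA]
    refine ⟨hi.1.map_orderIso _, ?_⟩
    change ⨆ g, Submodule.orderIsoMapComap e.symm (ℬ g) = ⊤
    rw [← OrderIso.map_iSup, hi.2, OrderIso.map_top]

end GradedIso

/-! ### The partial skew group ring -/

namespace AlgPartialAction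

section Formal

variable {R S A : Type*} [CommRing R] [InverseSemigroup S] [NonUnitalRing A] [Module R A]
  (π : AlgPartialAction R S A)

open scoped Classical in
theorem Formal.induction {p : π.Formal → Prop} (x : π.Formal) (zero : p 0)
    (delta : ∀ s a, p (π.delta s a)) (add : ∀ x y, p x → p y → p (x + y)) : p x := by
  induction x using DirectSum.induction_on with
  | zero => exact zero
  | of s a => exact delta s a
  | add x y hx hy => exact add x y hx hy

theorem delta_apply_self (s : S) (a : π.ideal s) : π.delta s a s = a := by
  classical exact DirectSum.of_eq_same _ _

theorem delta_apply_of_ne {s t : S} (h : s ≠ t) (a : π.ideal s) : π.delta s a t = 0 := by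
  classical exact DirectSum.of_eq_of_ne _ _ _ h.symm

theorem delta_congr {s t : S} (h : s = t) (a : π.ideal s) (b : π.ideal t) (hab : (a : A) = b) :
    π.delta s a = π.delta t b := by
  subst h
  rw [Subtype.ext hab]

theorem Formal.hom_ext {M : Type*} [AddCommMonoid M] [Module R M] {f f' : π.Formal →ₗ[R] M}
    (h : ∀ s a, f (π.delta s a) = f' (π.delta s a)) : f = f' := by
  refine LinearMap.ext fun x => ?_
  induction x using Formal.induction with
  | zero => rw [map_zero, map_zero]
  | delta s a => exact h s a
  | add x y hx hy => rw [map_add, map_add, hx, hy]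

open scoped Classical in
/-- The linear map on formal sums with prescribed values on the terms `a δ_s`. -/
noncomputable def formalLift {M : Type*} [AddCommMonoid M] [Module R M]
    (f : ∀ s, π.ideal s →ₗ[R] M) : π.Formal →ₗ[R] M :=
  DirectSum.toModule R S M f

theorem formalLift_delta {M : Type*} [AddCommMonoid M] [Module R M]
    (f : ∀ s, π.ideal s →ₗ[R] M) (s : S) (a : π.ideal s) : π.formalLift f (π.delta s a) = f s a := by
  classical exact DirectSum.toModule_lof _ _ _

end Formal

section FormalMul

variable {R S A : Type*} [CommRing R] [InverseSemigroup S] [NonUnitalRing A] [Module R A]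
  [IsScalarTower R A A] [SMulCommClass R A A] (π : AlgPartialAction R S A)

theorem formal_add_mul (x y z : π.Formal) : (x + y) * z = x * z + y * z :=
  π.mulHom.map_add₂ x y z

theorem formal_mul_add (x y z : π.Formal) : x * (y + z) = x * y + x * z :=
  map_add (π.mulHom x) y z

theorem formal_smul_mul (c : R) (x y : π.Formal) : (c • x) * y = c • (x * y) :=
  π.mulHom.map_smul₂ c x y

theorem formal_mul_smul (c : R) (x y : π.Formal) : x * (c • y) = c • (x * y) :=
  map_smul (π.mulHom x) c y

theorem formal_zero_mul (x : π.Formal) : (0 : π.Formal) * x = 0 :=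
  π.mulHom.map_zero₂ x

theorem formal_mul_zero (x : π.Formal) : x * (0 : π.Formal) = 0 :=
  map_zero (π.mulHom x)

/-- A linear map out of the formal sums is multiplicative if it is so on the terms `a δ_s`. -/
theorem map_mul_of_delta {B : Type*} [AddCommGroup B] [Module R B] [Mul B]
    (add_mul : ∀ x y z : B, (x + y) * z = x * z + y * z)
    (mul_add : ∀ x y z : B, x * (y + z) = x * y + x * z) (f : π.Formal →ₗ[R] B)
    (h : ∀ s t a b, f (π.delta s a * π.delta t b) = f (π.delta s a) * f (π.delta t b))
    (x y : π.Formal) : f (x * y) = f x * f y := by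
  have zero_mul : ∀ z : B, 0 * z = 0 := fun z => by simpa using add_mul 0 0 z
  have mul_zero : ∀ z : B, z * 0 = 0 := fun z => by simpa using mul_add z 0 0
  induction x using Formal.induction with
  | zero => rw [formal_zero_mul, map_zero, zero_mul]
  | add x x' hx hx' => rw [formal_add_mul, map_add, map_add, add_mul, hx, hx']
  | delta s a =>
    induction y using Formal.induction with
    | zero => rw [formal_mul_zero, map_zero, mul_zero]
    | add y y' hy hy' => rw [formal_mul_add, map_add, map_add, mul_add, hy, hy']
    | delta t b => exact h s t a b

theorem formal_mul_assoc
    (h : ∀ s t u a b c, π.delta s a * π.delta t b * π.delta u c =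
      π.delta s a * (π.delta t b * π.delta u c)) (x y z : π.Formal) : x * y * z = x * (y * z) := by
  induction x using Formal.induction with
  | zero => simp only [formal_zero_mul]
  | add x x' hx hx' => simp only [formal_add_mul, hx, hx']
  | delta s a =>
    induction y using Formal.induction with
    | zero => simp only [formal_zero_mul, formal_mul_zero]
    | add y y' hy hy' => simp only [formal_add_mul, formal_mul_add, hy, hy']
    | delta t b =>
      induction z using Formal.induction with
      | zero => simp only [formal_mul_zero]
      | add z z' hz hz' => simp only [formal_mul_add, hz, hz']
      | delta u c => exact h s t u a b c

end FormalMul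

section Group

variable {R G A : Type*} [CommRing R] [Group G] [NonUnitalRing A] [Module R A]
  (π : AlgPartialAction R G A)

open scoped Classical in
theorem isInternal_groupGrading : DirectSum.IsInternal (groupGrading π) := by
  have hcoe : ∀ g (x : groupGrading π g),
      DirectSum.coeLinearMap (groupGrading π) (DirectSum.lof R G _ g x) = x := fun g x =>
    DirectSum.coeLinearMap_lof _ _ _
  refine (DirectSum.Decomposition.ofLinearMap (groupGrading π)
    (π.formalLift fun g => DirectSum.lof R G (fun g => groupGrading π g) g ∘ₗ
      (π.delta g).rangeRestrict) ?_ ?_).isInternal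
  · refine Formal.hom_ext π fun g a => ?_
    rw [LinearMap.comp_apply, formalLift_delta]
    exact hcoe g ⟨π.delta g a, a, rfl⟩
  · refine DirectSum.linearMap_ext _ fun g => LinearMap.ext fun x => ?_
    obtain ⟨_, a, rfl⟩ := x
    simp only [LinearMap.comp_apply, hcoe, formalLift_delta]
    rfl

theorem mem_groupGrading {g : G} {x : SkewGroupRing π} :
    x ∈ groupGrading π g ↔ ∀ h, h ≠ g → x h = 0 := by
  classical
  constructor
  · rintro ⟨a, rfl⟩ h hh
    exact π.delta_apply_of_ne hh.symm a
  · intro hx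
    refine ⟨x g, DFinsupp.ext fun h => ?_⟩
    by_cases hh : h = g
    · subst hh
      exact π.delta_apply_self h _
    · rw [hx h hh]
      exact π.delta_apply_of_ne (Ne.symm hh) _

end Group

end AlgPartialAction

namespace PartialAction

variable {R S Y : Type*} [CommRing R] [InverseSemigroup S] [TopologicalSpace Y] [T2Space Y]

/-- The coefficient of `(a δ_s)(b δ_t)` is `x ↦ a(x) b(π_{s⁻¹}(x))`. Off `Y_s` the value of
`π_{s⁻¹}` is arbitrary, but `a` vanishes there. -/
theorem onCR_coeff_apply (π : PartialAction S Y) (s t : S) (a : (π.onCR R).ideal s)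
    (b : (π.onCR R).ideal t) (x : Y) :
    (((π.onCR R).coeff s t a b).1 : LocallyConstant Y R) x =
      (a.1 : LocallyConstant Y R) x * (b.1 : LocallyConstant Y R) (π.map s⁻¹ x) := by
  let A : Y → R := (a.1 : LocallyConstant Y R)
  let B : Y → R := (b.1 : LocallyConstant Y R)
  change pullFun (π.dom s) (π.map s⁻¹) (fun z => pullFun (π.dom s⁻¹) (π.map s) A z * B z) x =
    A x * B (π.map s⁻¹ x)
  by_cases hx : x ∈ π.dom s
  · rw [pullFun_of_mem hx, pullFun_of_mem (π.mapsTo_inv s hx), π.map_map_inv s x hx]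
  · rw [pullFun_of_notMem hx, show A x = 0 from a.2 x hx, zero_mul]

/-- For a partial action on a space, the algebra of formal sums is associative: both products
have the coefficient `x ↦ a(x) b(s⁻¹x) c((st)⁻¹x)`. -/
theorem onCR_formal_mul_assoc (π : PartialAction S Y) (x y z : (π.onCR R).Formal) :
    x * y * z = x * (y * z) := by
  refine formal_mul_assoc _ (fun s t u a b c => ?_) x y z
  simp only [delta_mul_delta]
  refine delta_congr _ (mul_assoc s t u) _ _ (Subtype.ext (LocallyConstant.ext fun x => ?_))
  simp only [onCR_coeff_apply]
  rw [mul_assoc]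
  by_cases ha : (a.1 : LocallyConstant Y R) x = 0
  · rw [ha, zero_mul, zero_mul]
  by_cases hb : (b.1 : LocallyConstant Y R) (π.map s⁻¹ x) = 0
  · rw [hb, zero_mul, zero_mul]
  have hx : x ∈ π.dom s := by_contra fun h => ha (a.2 x h)
  have hy : π.map s⁻¹ x ∈ π.dom t := by_contra fun h => hb (b.2 _ h)
  have hxt : x ∈ π.dom (s * t) := by
    have := π.map_mem_mul s t _ ⟨π.mapsTo_inv s hx, hy⟩
    rwa [π.map_map_inv s x hx] at this
  have e := π.map_map t⁻¹ s⁻¹ x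
    ⟨by rwa [InverseSemigroup.inv_inv'],
      by rwa [InverseSemigroup.inv_inv', InverseSemigroup.inv_inv']⟩
  rw [InverseSemigroup.mul_inv_rev', e]

theorem isGradedAlgebra_groupGrading {G : Type*} [Group G] (ρ : PartialAction G Y) :
    IsGradedAlgebra (groupGrading (ρ.onCR R)) where
  add_mul := formal_add_mul _
  mul_add := formal_mul_add _
  smul_mul := formal_smul_mul _
  mul_smul := formal_mul_smul _
  mul_assoc := ρ.onCR_formal_mul_assoc
  mul_mem g h x hx y hy := by
    obtain ⟨a, rfl⟩ := hx
    obtain ⟨b, rfl⟩ := hy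
    exact ⟨_, (delta_mul_delta _ g h a b).symm⟩
  isInternal := isInternal_groupGrading _

end PartialAction

/-! ### Partial actions graded over a partial action of a group -/

namespace AlgPartialAction

variable {R S A : Type*} [CommRing R] [InverseSemigroup S] [NonUnitalRing A] [Module R A]
  [IsScalarTower R A A] [SMulCommClass R A A] (π : AlgPartialAction R S A)

theorem toSkewRing_delta_of_natLE {s t : S} (h : NatLE s t) (a : π.ideal s) :
    π.toSkewRing (π.delta s a) = π.toSkewRing (π.delta t ⟨a, π.ideal_mono s t h a.2⟩) := by
  refine (Submodule.Quotient.eq _).2 ?_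
  rw [nullIdeal, Submodule.mem_sInf]
  exact fun N hN => hN.1 s t h a

/-- A multiplicative linear map out of the formal sums kills `𝓝` if it does not distinguish
`a δ_s` from `a δ_t` for `s ≤ t`. -/
theorem nullIdeal_le_ker {B : Type*} [AddCommGroup B] [Module R B] [Mul B]
    (zero_mul : ∀ z : B, 0 * z = 0) (mul_zero : ∀ z : B, z * 0 = 0) (f : π.Formal →ₗ[R] B)
    (hf : ∀ x y, f (x * y) = f x * f y)
    (h : ∀ (s t : S) (h : NatLE s t) (a : π.ideal s),
      f (π.delta s a) = f (π.delta t ⟨a, π.ideal_mono s t h a.2⟩)) :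
    π.nullIdeal ≤ LinearMap.ker f := by
  refine sInf_le ⟨fun s t hst a => ?_, fun x y hy => ?_⟩
  · rw [LinearMap.mem_ker, map_sub, h s t hst a, sub_self]
  · rw [LinearMap.mem_ker] at hy
    rw [LinearMap.mem_ker, LinearMap.mem_ker, hf, hf, hy, zero_mul, mul_zero]
    exact ⟨rfl, rfl⟩

end AlgPartialAction

/-- A partial action `π` of an inverse semigroup `S` is graded over a partial action `ρ` of a group
`G` on the same space if every `π_s` is a restriction of `ρ_g` for each degree `g` of `s`, if
elements of the same degree have a common upper bound, and if every compact open subset of the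
domain of `ρ_g` lies in that of some `π_s` with `s` of degree `g`. The degree is a relation `D`
rather than a function, because an empty bisection has every degree. -/
structure IsGradedOver {S G Y : Type*} [InverseSemigroup S] [Group G] [TopologicalSpace Y]
    (π : PartialAction S Y) (ρ : PartialAction G Y) (D : S → G → Prop) : Prop where
  exists_deg : ∀ s, ∃ g, D s g
  deg_mul : ∀ {s t g h}, D s g → D t h → D (s * t) (g * h)
  deg_inv : ∀ {s g}, D s g → D s⁻¹ g⁻¹
  dom_subset : ∀ {s g}, D s g → π.dom s ⊆ ρ.dom g
  map_eq : ∀ {s g}, D s g → ∀ x ∈ π.dom s⁻¹, π.map s x = ρ.map g x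
  dom_eq_empty : ∀ {s g h}, D s g → D s h → g ≠ h → π.dom s = ∅
  exists_upper : ∀ {s t g}, D s g → D t g → ∃ u, D u g ∧ NatLE s u ∧ NatLE t u
  exists_dom : ∀ {g} {K : Set Y}, IsCompact K → IsOpen K → K ⊆ ρ.dom g →
    ∃ s, D s g ∧ K ⊆ π.dom s

namespace IsGradedOver

/-- Gradedness passes to the restriction to an open invariant set. -/
theorem restrict {S G Y : Type*} [InverseSemigroup S] [Group G] [TopologicalSpace Y]
    {π : PartialAction S Y} {ρ : PartialAction G Y} {D : S → G → Prop} (h : IsGradedOver π ρ D)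
    {U : Set Y} (hUo : IsOpen U) (hπ : ∀ s, ∀ x ∈ π.dom s⁻¹ ∩ U, π.map s x ∈ U)
    (hρ : ∀ g, ∀ x ∈ ρ.dom g⁻¹ ∩ U, ρ.map g x ∈ U) :
    IsGradedOver (π.restrict U hπ) (ρ.restrict U hρ) D where
  exists_deg := h.exists_deg
  deg_mul := h.deg_mul
  deg_inv := h.deg_inv
  dom_subset hs := Set.preimage_mono (h.dom_subset hs)
  map_eq {s g} hs x hx := by
    have hxρ : (x : Y) ∈ ρ.dom g⁻¹ := h.dom_subset (h.deg_inv hs) hx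
    refine Subtype.ext ?_
    simp only [PartialAction.restrict, dif_pos (hπ s x ⟨hx, x.2⟩), dif_pos (hρ g x ⟨hxρ, x.2⟩)]
    exact h.map_eq hs x hx
  dom_eq_empty hs hs' hne := by
    simp only [PartialAction.restrict, h.dom_eq_empty hs hs' hne, Set.preimage_empty]
  exists_upper := h.exists_upper
  exists_dom {g K} hK hKo hKg := by
    obtain ⟨s, hs, hKs⟩ := h.exists_dom (hK.image continuous_subtype_val)
      (hUo.isOpenMap_subtype_val K hKo) (Set.image_subset_iff.2 hKg)
    exact ⟨s, hs, Set.image_subset_iff.1 hKs⟩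

variable {S G Y : Type*} [InverseSemigroup S] [Group G] [TopologicalSpace Y]
  {π : PartialAction S Y} {ρ : PartialAction G Y} {D : S → G → Prop}

theorem deg_of_natLE (h : IsGradedOver π ρ D) {s t : S} {g : G} (hst : NatLE s t) (ht : D t g) :
    D s g := by
  obtain ⟨k, hk⟩ := h.exists_deg s
  have := h.deg_mul (h.deg_mul ht (h.deg_inv hk)) hk
  rwa [inv_mul_cancel_right, ← hst] at this

variable {R : Type*} [CommRing R] [T2Space Y]

theorem ideal_le (h : IsGradedOver π ρ D) {s : S} {g : G} (hs : D s g) :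
    (π.onCR R).ideal s ≤ (ρ.onCR R).ideal g :=
  fun _ ha x hx => ha x fun hx' => hx (h.dom_subset hs hx')

/-- In the partial skew inverse semigroup ring the class of `a δ_s` depends only on `a` and on a
degree of `s`. -/
theorem toSkewRing_delta_eq (h : IsGradedOver π ρ D) {s t : S} {g : G} (hs : D s g) (ht : D t g)
    (a : (π.onCR R).ideal s) (b : (π.onCR R).ideal t) (hab : (a : CR R Y) = b) :
    (π.onCR R).toSkewRing ((π.onCR R).delta s a) = (π.onCR R).toSkewRing ((π.onCR R).delta t b) := by
  obtain ⟨u, -, hsu, htu⟩ := h.exists_upper hs ht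
  rw [toSkewRing_delta_of_natLE _ hsu, toSkewRing_delta_of_natLE _ htu]
  exact congrArg _ (delta_congr _ rfl _ _ hab)

theorem exists_mem_ideal (h : IsGradedOver π ρ D) {g : G} (a : (ρ.onCR R).ideal g) :
    ∃ s, D s g ∧ (a : CR R Y) ∈ (π.onCR R).ideal s := by
  obtain ⟨s, hs, hK⟩ := h.exists_dom (g := g) (CR.isCompact_support a.1)
    ((a.1 : LocallyConstant Y R).isLocallyConstant {0}ᶜ)
    fun x hx => by_contra fun h => hx (a.2 x h)
  exact ⟨s, hs, fun x hx => by_contra fun h => hx (hK h)⟩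

/-- The map `a δ_g ↦ [a δ_s]`, for any `s` of degree `g` with `a ∈ C_R(Y_s)`. -/
noncomputable def ofGroupTerm (h : IsGradedOver π ρ D) (g : G) :
    (ρ.onCR R).ideal g →ₗ[R] (π.onCR R).SkewRing where
  toFun a := (π.onCR R).toSkewRing ((π.onCR R).delta (h.exists_mem_ideal a).choose
    ⟨a, (h.exists_mem_ideal a).choose_spec.2⟩)
  map_add' a b := by
    obtain ⟨hs, ha⟩ := (h.exists_mem_ideal a).choose_spec
    obtain ⟨ht, hb⟩ := (h.exists_mem_ideal b).choose_spec
    obtain ⟨hc, hab⟩ := (h.exists_mem_ideal (a + b)).choose_spec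
    obtain ⟨u, hu, hsu, htu⟩ := h.exists_upper hs ht
    have ha' := (π.onCR R).ideal_mono _ _ hsu ha
    have hb' := (π.onCR R).ideal_mono _ _ htu hb
    rw [h.toSkewRing_delta_eq (R := R) hs hu ⟨a, ha⟩ ⟨a, ha'⟩ rfl,
      h.toSkewRing_delta_eq (R := R) ht hu ⟨b, hb⟩ ⟨b, hb'⟩ rfl, ← map_add, ← map_add]
    exact h.toSkewRing_delta_eq hc hu _ _ rfl
  map_smul' c a := by
    obtain ⟨hs, ha⟩ := (h.exists_mem_ideal a).choose_spec
    obtain ⟨hc, hca⟩ := (h.exists_mem_ideal (c • a)).choose_spec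
    rw [RingHom.id_apply, ← map_smul, ← map_smul]
    exact h.toSkewRing_delta_eq hc hs _ _ rfl

theorem ofGroupTerm_apply (h : IsGradedOver π ρ D) {s : S} {g : G} (hs : D s g)
    (a : (ρ.onCR R).ideal g) (ha : (a : CR R Y) ∈ (π.onCR R).ideal s) :
    h.ofGroupTerm g a = (π.onCR R).toSkewRing ((π.onCR R).delta s ⟨a, ha⟩) :=
  h.toSkewRing_delta_eq (h.exists_mem_ideal a).choose_spec.1 hs _ _ rfl

/-- The linear map `∑ a_s δ_s ↦ ∑ a_s δ_{deg s}` to the partial skew group ring. -/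
noncomputable def formalToGroup (R : Type*) [CommRing R] (h : IsGradedOver π ρ D) :
    (π.onCR R).Formal →ₗ[R] SkewGroupRing (ρ.onCR R) :=
  (π.onCR R).formalLift fun s => (ρ.onCR R).delta (h.exists_deg s).choose ∘ₗ
    Submodule.inclusion (h.ideal_le (h.exists_deg s).choose_spec)

theorem formalToGroup_delta (h : IsGradedOver π ρ D) {s : S} {g : G} (hs : D s g)
    (a : (π.onCR R).ideal s) :
    h.formalToGroup R ((π.onCR R).delta s a) = (ρ.onCR R).delta g ⟨a, h.ideal_le hs a.2⟩ := by
  rw [formalToGroup, formalLift_delta, LinearMap.comp_apply]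
  by_cases hg : (h.exists_deg s).choose = g
  · exact delta_congr _ hg _ _ rfl
  · -- An element with two degrees has empty domain, so that `a = 0`.
    have h0 : a = 0 := Subtype.ext (Subtype.ext (LocallyConstant.ext fun x => a.2 x (by
      rw [h.dom_eq_empty (h.exists_deg s).choose_spec hs hg]
      exact Set.notMem_empty x)))
    subst h0
    rw [map_zero, map_zero]
    exact (map_zero ((ρ.onCR R).delta g)).symm

theorem formalToGroup_mul (h : IsGradedOver π ρ D) (x y : (π.onCR R).Formal) :
    h.formalToGroup R (x * y) = h.formalToGroup R x * h.formalToGroup R y := by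
  refine map_mul_of_delta _ (formal_add_mul _) (formal_mul_add _) _ (fun s t a b => ?_) x y
  obtain ⟨g, hs⟩ := h.exists_deg s
  obtain ⟨k, ht⟩ := h.exists_deg t
  rw [delta_mul_delta, h.formalToGroup_delta (h.deg_mul hs ht), h.formalToGroup_delta hs,
    h.formalToGroup_delta ht, delta_mul_delta]
  refine delta_congr _ rfl _ _ (Subtype.ext (LocallyConstant.ext fun x => ?_))
  simp only [PartialAction.onCR_coeff_apply]
  by_cases hx : x ∈ π.dom s
  · rw [h.map_eq (h.deg_inv hs) x (by rwa [InverseSemigroup.inv_inv'])]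
  · rw [show (a.1 : LocallyConstant Y R) x = 0 from a.2 x hx, zero_mul, zero_mul]

/-- The homomorphism from the partial skew inverse semigroup ring to the partial skew group ring
which sends the class of `a δ_s` to `a δ_{deg s}`. -/
noncomputable def skewToGroup (R : Type*) [CommRing R] (h : IsGradedOver π ρ D) :
    (π.onCR R).SkewRing →ₗ[R] SkewGroupRing (ρ.onCR R) :=
  (π.onCR R).nullIdeal.liftQ (h.formalToGroup R) (by
    refine nullIdeal_le_ker _ (formal_zero_mul _) (formal_mul_zero _) _ h.formalToGroup_mul ?_
    intro s t hst a
    obtain ⟨g, ht⟩ := h.exists_deg t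
    rw [h.formalToGroup_delta ht, h.formalToGroup_delta (h.deg_of_natLE hst ht)])

theorem skewToGroup_toSkewRing (h : IsGradedOver π ρ D) (x : (π.onCR R).Formal) :
    h.skewToGroup R ((π.onCR R).toSkewRing x) = h.formalToGroup R x := rfl

/-- The inverse `a δ_g ↦ [a δ_s]` of `skewToGroup`. -/
noncomputable def groupToSkew (R : Type*) [CommRing R] (h : IsGradedOver π ρ D) :
    SkewGroupRing (ρ.onCR R) →ₗ[R] (π.onCR R).SkewRing :=
  (ρ.onCR R).formalLift h.ofGroupTerm

theorem groupToSkew_delta (h : IsGradedOver π ρ D) (g : G) (a : (ρ.onCR R).ideal g) :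
    h.groupToSkew R ((ρ.onCR R).delta g a) = h.ofGroupTerm g a := formalLift_delta _ _ _ _

theorem skewToGroup_comp_groupToSkew (h : IsGradedOver π ρ D) :
    h.skewToGroup R ∘ₗ h.groupToSkew R = LinearMap.id := by
  refine Formal.hom_ext _ fun g a => ?_
  obtain ⟨s, hs, ha⟩ := h.exists_mem_ideal a
  rw [LinearMap.comp_apply, groupToSkew_delta, h.ofGroupTerm_apply hs a ha, skewToGroup_toSkewRing,
    h.formalToGroup_delta hs]
  rfl

theorem groupToSkew_comp_skewToGroup (h : IsGradedOver π ρ D) :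
    h.groupToSkew R ∘ₗ h.skewToGroup R = LinearMap.id := by
  refine Submodule.linearMap_qext _ (Formal.hom_ext _ fun s a => ?_)
  obtain ⟨g, hs⟩ := h.exists_deg s
  have e : h.groupToSkew R (h.skewToGroup R ((π.onCR R).toSkewRing ((π.onCR R).delta s a))) =
      (π.onCR R).toSkewRing ((π.onCR R).delta s a) := by
    rw [skewToGroup_toSkewRing, h.formalToGroup_delta hs, groupToSkew_delta]
    exact h.ofGroupTerm_apply hs _ a.2
  exact e

/-- The partial skew inverse semigroup ring of a partial action graded over a partial action of a
group is the partial skew group ring of the latter. -/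
theorem gradedIso (R : Type*) [CommRing R] (h : IsGradedOver π ρ D) :
    GradedIso (fun g => (π.onCR R).component {s | D s g}) (groupGrading (ρ.onCR R)) := by
  refine ⟨LinearEquiv.ofLinearMap (h.skewToGroup R) (h.groupToSkew R)
    h.skewToGroup_comp_groupToSkew h.groupToSkew_comp_skewToGroup, fun x y => ?_, fun g => ?_⟩
  · obtain ⟨x, rfl⟩ := Submodule.mkQ_surjective _ x
    obtain ⟨y, rfl⟩ := Submodule.mkQ_surjective _ y
    exact h.formalToGroup_mul x y
  · refine le_antisymm ?_ ?_
    · refine Submodule.map_le_iff_le_comap.2 (Submodule.map_le_iff_le_comap.2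
        (Submodule.span_le.2 ?_))
      rintro _ ⟨s, hs, a, rfl⟩
      have e : h.formalToGroup R ((π.onCR R).delta s a) ∈ groupGrading (ρ.onCR R) g := by
        rw [h.formalToGroup_delta hs]
        exact ⟨_, rfl⟩
      exact e
    · rintro _ ⟨a, rfl⟩
      obtain ⟨s, hs, ha⟩ := h.exists_mem_ideal a
      refine ⟨_, ⟨(π.onCR R).delta s ⟨a, ha⟩, Submodule.subset_span ⟨s, hs, _, rfl⟩, rfl⟩, ?_⟩
      exact h.formalToGroup_delta hs _

end IsGradedOver

/-! ### The inverse semigroup `S(G)` -/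

namespace ExelSemigroup

variable {G : Type*} [Group G]

theorem mul_self_of_mem_epsClosure {e : ExelSemigroup G} (he : e ∈ epsClosure G) : e * e = e := by
  induction he using Subsemigroup.closure_induction with
  | mem x hx =>
    obtain ⟨g, rfl⟩ := hx
    rw [eps, ← mul_assoc, of_mul_inv_mul]
  | mul x y hx hy ex ey =>
    calc x * y * (x * y) = x * (y * x) * y := by simp only [mul_assoc]
      _ = x * x * (y * y) := by rw [epsClosure_comm hy hx]; simp only [mul_assoc]
      _ = x * y := by rw [ex, ey]

/-- Every element `e [g]` of `S(G)`, with `e` idempotent, lies below `[g]`. -/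
theorem natLE_of_deg (s : ExelSemigroup G) : NatLE s (of (deg s)) := by
  obtain ⟨e, he, h⟩ := exists_epsClosure s
  generalize deg s = g at h
  subst h
  have hee := mul_self_of_mem_epsClosure he
  have hinv : e⁻¹ = e :=
    (InverseSemigroup.inv_unique e e (by rw [hee, hee]) (by rw [hee, hee])).symm
  have hg : eps g ∈ epsClosure G := Subsemigroup.subset_closure ⟨g, rfl⟩
  change e * of g = of g * (e * of g)⁻¹ * (e * of g)
  rw [mul_inv_rev', hinv, inv_of]
  calc e * of g = e * (of g * of g⁻¹ * of g) := by rw [of_mul_inv_mul]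
    _ = e * eps g * of g := by rw [eps]; simp only [mul_assoc]
    _ = eps g * (e * e) * of g := by rw [epsClosure_comm he hg, hee]
    _ = of g * (of g⁻¹ * e) * (e * of g) := by rw [eps]; simp only [mul_assoc]

end ExelSemigroup

/-- The partial action of `S(G)` is graded over that of `G`; the element `[g]` is the greatest one
of degree `g`. -/
theorem GroupPartialAction.isGradedOver_exelAction {G X : Type*} [Group G] [TopologicalSpace X]
    (φ : GroupPartialAction G X) :
    IsGradedOver φ.exelAction φ.toPartialAction fun s g => ExelSemigroup.deg s = g where
  exists_deg s := ⟨_, rfl⟩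
  deg_mul hs ht := by rw [map_mul, hs, ht]
  deg_inv hs := by rw [ExelSemigroup.deg_inv, hs]
  dom_subset := by
    rintro s _ rfl x hx
    exact Set.mem_iInter₂.1 hx _ s.deg_mem_supp
  map_eq := by
    rintro s _ rfl x -
    rfl
  dom_eq_empty hs hs' hne := absurd (hs.symm.trans hs') hne
  exists_upper := by
    rintro s t _ rfl ht
    exact ⟨ExelSemigroup.of s.deg, rfl, s.natLE_of_deg, ht ▸ t.natLE_of_deg⟩
  exists_dom {g K} _ _ hK := by
    refine ⟨ExelSemigroup.of g, rfl, fun x hx => Set.mem_iInter₂.2 fun a ha => ?_⟩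
    rw [ExelSemigroup.supp_of] at ha
    rcases ha with rfl | rfl
    · rw [φ.dom_one]
      trivial
    · exact hK hx

/-! ### Transformation groupoids of partial actions -/

/-- A compact subset of the range of an open bisection lifts to a compact set. -/
theorem TopGroupoid.IsOpenBisection.isCompact_of_image_r {X Γ : Type*} [TopologicalSpace X]
    [TopologicalSpace Γ] {𝒢 : TopGroupoid X Γ} {V A : Set Γ} (hV : 𝒢.IsOpenBisection V)
    (hA : A ⊆ V) (h : IsCompact (𝒢.r '' A)) : IsCompact A := by
  have e : (fun b : V => 𝒢.r b) '' (Subtype.val ⁻¹' A) = 𝒢.r '' A := by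
    ext x
    constructor
    · rintro ⟨b, hb, rfl⟩
      exact ⟨b, hb, rfl⟩
    · rintro ⟨b, hb, rfl⟩
      exact ⟨⟨b, hA hb⟩, hb, rfl⟩
  have h1 : IsCompact (Subtype.val ⁻¹' A : Set V) := by
    rw [hV.2.2.isInducing.isCompact_iff, e]
    exact h
  have h2 := h1.image continuous_subtype_val
  rwa [Subtype.image_preimage_coe, Set.inter_eq_right.2 hA] at h2

/-- The groupoid `𝒢` with the cocycle `c` is the transformation groupoid of the partial action `ρ`
of `G` on its unit space: for every `g` the set `c⁻¹(g)` is open and `r` maps it bijectively onto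
the domain `X_g`, and `d γ = ρ_{c(γ)⁻¹}(r γ)`. -/
structure IsTransformationGroupoid {G X Γ : Type*} [Group G] [TopologicalSpace X]
    [TopologicalSpace Γ] (𝒢 : TopGroupoid X Γ) (ρ : PartialAction G X) (c : Γ → G) : Prop where
  isOpen_fibre : ∀ g, IsOpen {γ | c γ = g}
  deg_comp : ∀ α β h, c (𝒢.comp α β h) = c α * c β
  injOn_r : ∀ g, Set.InjOn 𝒢.r {γ | c γ = g}
  image_r : ∀ g, 𝒢.r '' {γ | c γ = g} = ρ.dom g
  d_eq : ∀ γ, 𝒢.d γ = ρ.map (c γ)⁻¹ (𝒢.r γ)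

namespace IsTransformationGroupoid

variable {G X Γ : Type*} [Group G] [TopologicalSpace X] [TopologicalSpace Γ]

theorem r_mem {𝒢 : TopGroupoid X Γ} {ρ : PartialAction G X} {c : Γ → G}
    (h : IsTransformationGroupoid 𝒢 ρ c) (γ : Γ) : 𝒢.r γ ∈ ρ.dom (c γ) := by
  rw [← h.image_r]
  exact ⟨γ, rfl, rfl⟩

theorem map_d {𝒢 : TopGroupoid X Γ} {ρ : PartialAction G X} {c : Γ → G}
    (h : IsTransformationGroupoid 𝒢 ρ c) (γ : Γ) : ρ.map (c γ) (𝒢.d γ) = 𝒢.r γ := by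
  rw [h.d_eq, ρ.map_map_inv _ _ (h.r_mem γ)]

theorem isOpenBisection [T2Space X] [T2Space Γ] {𝒢 : AmpleGroupoid X Γ} {ρ : PartialAction G X}
    {c : Γ → G} (h : IsTransformationGroupoid 𝒢.toTopGroupoid ρ c) {g : G} {B : Set Γ}
    (hBo : IsOpen B) (hB : ∀ γ ∈ B, c γ = g) : 𝒢.IsOpenBisection B := by
  refine TopGroupoid.isOpenBisection_of_injOn (𝒢.isOpenMap_d 𝒢.isAmple) (𝒢.isOpenMap_r 𝒢.isAmple)
    hBo (fun α hα β hβ e => ?_) ((h.injOn_r g).mono hB)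
  refine h.injOn_r g (hB α hα) (hB β hβ) ?_
  rw [← h.map_d α, ← h.map_d β, hB α hα, hB β hβ, e]

theorem isCompact_of_image_r [T2Space X] [T2Space Γ] {𝒢 : AmpleGroupoid X Γ}
    {ρ : PartialAction G X} {c : Γ → G} (h : IsTransformationGroupoid 𝒢.toTopGroupoid ρ c) {g : G}
    {A : Set Γ} (hA : ∀ γ ∈ A, c γ = g) (hr : IsCompact (𝒢.r '' A)) : IsCompact A :=
  (h.isOpenBisection (h.isOpen_fibre g) fun _ hγ => hγ).isCompact_of_image_r hA hr

end IsTransformationGroupoid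

theorem bisectionAction_map_d {X Γ G : Type*} [TopologicalSpace X] [TopologicalSpace Γ] [T2Space X]
    [T2Space Γ] [Group G] [TopologicalSpace G] {𝒢 : AmpleGroupoid X Γ}
    {c : Grading 𝒢.toTopGroupoid G} (B : GradedBisection 𝒢 c) {b : Γ} (hb : b ∈ B.carrier) :
    (bisectionAction 𝒢 c).map B (𝒢.d b) = 𝒢.r b := by
  have h : ∃ b' ∈ B.carrier, 𝒢.d b' = 𝒢.d b := ⟨b, hb, rfl⟩
  have e : (bisectionAction 𝒢 c).map B (𝒢.d b) = 𝒢.r h.choose := by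
    simp only [bisectionAction]
    exact dif_pos h
  rw [e, B.isOpenBisection.injOn_d h.choose_spec.1 hb h.choose_spec.2]

theorem GradedBisection.natLE_of_subset {X Γ G : Type*} [TopologicalSpace X] [TopologicalSpace Γ]
    [T2Space X] [T2Space Γ] [Group G] [TopologicalSpace G] {𝒢 : AmpleGroupoid X Γ}
    {c : Grading 𝒢.toTopGroupoid G} {B C : GradedBisection 𝒢 c} (h : B.carrier ⊆ C.carrier) :
    NatLE B C := by
  refine GradedBisection.ext (Set.ext fun γ => ⟨fun hγ => ?_, ?_⟩)
  · exact ⟨_, γ, _, ⟨γ, 𝒢.inv γ, _, h hγ, ⟨γ, hγ, rfl⟩, rfl⟩, hγ, comp_inv_comp_self γ⟩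
  · rintro ⟨_, z, hz', ⟨x, _, hxy, hx, ⟨y, hy, rfl⟩, rfl⟩, hz, rfl⟩
    obtain rfl : x = y := C.isOpenBisection.injOn_d hx (h hy) (hxy.trans (𝒢.r_inv y))
    obtain rfl : x = z := by
      refine B.isOpenBisection.injOn_r hy hz ?_
      rw [← hz', 𝒢.d_comp, 𝒢.d_inv]
    rw [comp_inv_comp_self]
    exact hz

/-- For a transformation groupoid the canonical partial action of the graded compact open
bisections is graded over the partial action of the group. Two bisections of degree `g` lie in
their union, which is again a bisection since the whole set of arrows of degree `g` is one. -/
theorem IsTransformationGroupoid.isGradedOver_bisectionAction {X Γ G : Type*} [TopologicalSpace X]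
    [TopologicalSpace Γ] [T2Space X] [T2Space Γ] [Group G] [TopologicalSpace G]
    {𝒢 : AmpleGroupoid X Γ} {c : Grading 𝒢.toTopGroupoid G} {ρ : PartialAction G X}
    (h : IsTransformationGroupoid 𝒢.toTopGroupoid ρ c.deg) :
    IsGradedOver (bisectionAction 𝒢 c) ρ fun B g => ∀ γ ∈ B.carrier, c.deg γ = g where
  exists_deg B := B.graded
  deg_mul hB hC := by
    rintro _ ⟨b, c', hbc, hb, hc, rfl⟩
    rw [c.deg_comp, hB b hb, hC c' hc]
  deg_inv hB := by
    rintro _ ⟨b, hb, rfl⟩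
    rw [c.deg_inv, hB b hb]
  dom_subset {B g} hB := by
    rw [← h.image_r]
    exact Set.image_mono hB
  map_eq {B g} hB := by
    rintro _ ⟨_, ⟨b, hb, rfl⟩, rfl⟩
    rw [𝒢.r_inv, bisectionAction_map_d B hb, ← h.map_d b, hB b hb]
  dom_eq_empty {B g k} hB hB' hne := by
    refine Set.eq_empty_of_forall_notMem ?_
    rintro _ ⟨b, hb, -⟩
    exact hne ((hB b hb).symm.trans (hB' b hb))
  exists_upper {B C g} hB hC := by
    have hdeg : ∀ γ ∈ B.carrier ∪ C.carrier, c.deg γ = g := fun γ hγ => hγ.elim (hB γ) (hC γ)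
    exact ⟨⟨B.carrier ∪ C.carrier, B.isCompact.union C.isCompact,
      h.isOpenBisection (B.isOpenBisection.1.union C.isOpenBisection.1) hdeg, g, hdeg⟩, hdeg,
      GradedBisection.natLE_of_subset Set.subset_union_left,
      GradedBisection.natLE_of_subset Set.subset_union_right⟩
  exists_dom {g K} hK hKo hKg := by
    have hr : 𝒢.r '' ({γ | c.deg γ = g} ∩ 𝒢.r ⁻¹' K) = K := by
      rw [Set.image_inter_preimage, h.image_r]
      exact Set.inter_eq_right.2 hKg
    have hdeg : ∀ γ ∈ {γ | c.deg γ = g} ∩ 𝒢.r ⁻¹' K, c.deg γ = g := fun γ hγ => hγ.1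
    refine ⟨⟨_, h.isCompact_of_image_r hdeg (by rwa [hr]), h.isOpenBisection
      ((h.isOpen_fibre g).inter (hKo.preimage 𝒢.continuous_r)) hdeg, g, hdeg⟩, hdeg, ?_⟩
    exact hr.symm.subset

namespace GroupPartialAction

variable {G X : Type*} [Group G] [TopologicalSpace G] [DiscreteTopology G] [TopologicalSpace X]
  [T2Space X] [LocallyCompactSpace X] [TotallyDisconnectedSpace X] (φ : GroupPartialAction G X)

theorem isTransformationGroupoid :
    IsTransformationGroupoid φ.groupoid.toTopGroupoid φ.toPartialAction φ.grading.deg where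
  isOpen_fibre := φ.isOpen_arrowDeg_fibre
  deg_comp := φ.grading.deg_comp
  injOn_r := φ.injOn_arrow_r
  image_r g := by
    ext x
    constructor
    · rintro ⟨γ, rfl, rfl⟩
      exact γ.2
    · exact fun hx => ⟨⟨(g, x), hx⟩, rfl, rfl⟩
  d_eq _ := rfl

theorem isTransformationGroupoid_reduction {U : Set X} (hUo : IsOpen U) (hU : φ.IsInvariant U) :
    IsTransformationGroupoid (φ.groupoid.reduction U hUo hU.groupoid).toTopGroupoid
      (φ.toPartialAction.restrict U hU) fun γ => φ.grading.deg γ.1 where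
  isOpen_fibre g := (φ.isOpen_arrowDeg_fibre g).preimage continuous_subtype_val
  deg_comp _ _ _ := rfl
  injOn_r g α hα β hβ e := Subtype.ext (φ.injOn_arrow_r g hα hβ (congrArg Subtype.val e))
  image_r g := by
    ext x
    constructor
    · rintro ⟨γ, rfl, rfl⟩
      exact γ.1.2
    · intro hx
      have hx' : φ.map g⁻¹ x ∈ U := hU g⁻¹ x ⟨by rw [inv_inv]; exact hx, x.2⟩
      exact ⟨⟨⟨(g, x), hx⟩, hx'⟩, rfl, rfl⟩
  d_eq γ := by
    have h : φ.map (φ.grading.deg γ.1)⁻¹ (φ.groupoid.r γ.1) ∈ U := γ.2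
    exact (dif_pos h).symm

end GroupPartialAction

/-! ### The Steinberg algebra of a transformation groupoid -/

theorem Steinberg.ext {R X Γ : Type*} [CommRing R] [TopologicalSpace X] [TopologicalSpace Γ]
    [T2Space X] [T2Space Γ] {𝒢 : AmpleGroupoid X Γ} {f f' : Steinberg R 𝒢}
    (h : ∀ γ, f.toFun γ = f'.toFun γ) : f = f' :=
  Subtype.ext (LocallyConstant.ext h)

namespace IsTransformationGroupoid

variable {G X Γ : Type*} [Group G] [TopologicalSpace X] [TopologicalSpace Γ] [T2Space X]
  [T2Space Γ] {𝒢 : AmpleGroupoid X Γ} {ρ : PartialAction G X} {c : Γ → G}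

theorem eventually_deg_eq (h : IsTransformationGroupoid 𝒢.toTopGroupoid ρ c) (γ : Γ) :
    ∀ᶠ γ' in nhds γ, c γ' = c γ :=
  (h.isOpen_fibre (c γ)).mem_nhds rfl

theorem finite_image_deg (h : IsTransformationGroupoid 𝒢.toTopGroupoid ρ c) {K : Set Γ}
    (hK : IsCompact K) : (c '' K).Finite := by
  obtain ⟨t, -, ht⟩ := hK.elim_nhds_subcover (fun γ => {γ' | c γ' = c γ})
    fun γ _ => h.eventually_deg_eq γ
  refine (t.finite_toSet.image c).subset ?_
  rintro _ ⟨γ, hγ, rfl⟩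
  obtain ⟨γ', hγ', e⟩ := Set.mem_iUnion₂.1 (ht hγ)
  exact ⟨γ', hγ', Eq.symm e⟩

variable {R : Type*} [CommRing R]

/-- In a transformation groupoid a factorization `γ = αβ` is determined by the degree of `α`, so
that only finitely many of them have `α` in a given compact set. -/
theorem finite_factorizations (h : IsTransformationGroupoid 𝒢.toTopGroupoid ρ c)
    (f : Steinberg R 𝒢) (γ : Γ) :
    {p : 𝒢.Composable | 𝒢.compMap p = γ ∧ f.toFun p.1.1 ≠ 0}.Finite := by
  refine Set.Finite.of_injOn (f := fun p : 𝒢.Composable => c p.1.1)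
    (t := c '' Function.support f.toFun) ?_ ?_ (h.finite_image_deg f.2)
  · exact fun p hp => ⟨_, hp.2, rfl⟩
  · rintro ⟨⟨α, β⟩, hp⟩ ⟨e, -⟩ ⟨⟨α', β'⟩, hp'⟩ ⟨e', -⟩ hc
    change 𝒢.comp α β hp = γ at e
    change 𝒢.comp α' β' hp' = γ at e'
    obtain rfl : α = α' := by
      refine h.injOn_r _ hc rfl ?_
      rw [← 𝒢.r_comp α β hp, e, ← e', 𝒢.r_comp]
    obtain rfl : β = β' := (𝒢.inv_comp_comp hp).symm.trans
      ((𝒢.comp_congr _ rfl (e.trans e'.symm)).trans (𝒢.inv_comp_comp hp'))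
    rfl

theorem steinberg_add_mul (h : IsTransformationGroupoid 𝒢.toTopGroupoid ρ c)
    (f f' k : Steinberg R 𝒢) : (f + f') * k = f * k + f' * k := by
  refine Steinberg.ext fun γ => ?_
  rw [Steinberg.toFun_add, Pi.add_apply, Steinberg.toFun_mul, Steinberg.toFun_mul,
    Steinberg.toFun_mul, TopGroupoid.conv, TopGroupoid.conv, TopGroupoid.conv,
    ← finsum_mem_add_distrib']
  · simp only [Steinberg.toFun_add, Pi.add_apply, add_mul]
  · exact (h.finite_factorizations f γ).subset fun p hp => ⟨hp.1, left_ne_zero_of_mul hp.2⟩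
  · exact (h.finite_factorizations f' γ).subset fun p hp => ⟨hp.1, left_ne_zero_of_mul hp.2⟩

theorem steinberg_mul_add (h : IsTransformationGroupoid 𝒢.toTopGroupoid ρ c)
    (f k k' : Steinberg R 𝒢) : f * (k + k') = f * k + f * k' := by
  refine Steinberg.ext fun γ => ?_
  rw [Steinberg.toFun_add, Pi.add_apply, Steinberg.toFun_mul, Steinberg.toFun_mul,
    Steinberg.toFun_mul, TopGroupoid.conv, TopGroupoid.conv, TopGroupoid.conv,
    ← finsum_mem_add_distrib']
  · simp only [Steinberg.toFun_add, Pi.add_apply, mul_add]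
  · exact (h.finite_factorizations f γ).subset fun p hp => ⟨hp.1, left_ne_zero_of_mul hp.2⟩
  · exact (h.finite_factorizations f γ).subset fun p hp => ⟨hp.1, left_ne_zero_of_mul hp.2⟩

open scoped Classical in
/-- The function on arrows which is `a ∘ r` in degree `g` and vanishes in all other degrees. -/
noncomputable def liftFun (𝒢 : AmpleGroupoid X Γ) (c : Γ → G) (g : G) (a : X → R) (γ : Γ) : R :=
  if c γ = g then a (𝒢.r γ) else 0

theorem isLocallyConstant_liftFun (h : IsTransformationGroupoid 𝒢.toTopGroupoid ρ c) (g : G)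
    {a : X → R} (ha : IsLocallyConstant a) : IsLocallyConstant (liftFun 𝒢 c g a) := by
  rw [IsLocallyConstant.iff_eventually_eq]
  intro γ
  filter_upwards [h.eventually_deg_eq γ,
    (ha.comp_continuous 𝒢.continuous_r).eventually_eq γ] with γ' h1 h2
  have h2' : a (𝒢.r γ') = a (𝒢.r γ) := h2
  rw [liftFun, liftFun, h1, h2']

theorem isCompact_support_liftFun (h : IsTransformationGroupoid 𝒢.toTopGroupoid ρ c) {g : G}
    {a : X → R} (ha : IsCompact (Function.support a)) (hag : Function.support a ⊆ ρ.dom g) :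
    IsCompact (Function.support (liftFun 𝒢 c g a)) := by
  have hsupp : Function.support (liftFun 𝒢 c g a) =
      {γ | c γ = g} ∩ 𝒢.r ⁻¹' Function.support a := by
    ext γ
    simp [liftFun]
  rw [hsupp]
  refine h.isCompact_of_image_r (g := g) (fun γ hγ => hγ.1) ?_
  rwa [Set.image_inter_preimage, h.image_r, Set.inter_eq_right.2 hag]

/-- The linear map `a δ_g ↦ (a ∘ r) 1_{c⁻¹(g)}`. -/
noncomputable def termToSteinberg (h : IsTransformationGroupoid 𝒢.toTopGroupoid ρ c) (g : G) :
    (ρ.onCR R).ideal g →ₗ[R] Steinberg R 𝒢 where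
  toFun a := ⟨⟨liftFun 𝒢 c g (a.1 : LocallyConstant X R),
      h.isLocallyConstant_liftFun g (a.1 : LocallyConstant X R).isLocallyConstant⟩,
    h.isCompact_support_liftFun a.1.2 fun x hx => by_contra fun hx' => hx (a.2 x hx')⟩
  map_add' a b := by
    refine Steinberg.ext fun γ => ?_
    change liftFun 𝒢 c g ((a.1 : LocallyConstant X R) + (b.1 : LocallyConstant X R)) γ =
      liftFun 𝒢 c g (a.1 : LocallyConstant X R) γ + liftFun 𝒢 c g (b.1 : LocallyConstant X R) γ
    by_cases hγ : c γ = g <;> simp [liftFun, hγ]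
  map_smul' k a := by
    refine Steinberg.ext fun γ => ?_
    change liftFun 𝒢 c g (k • (a.1 : LocallyConstant X R)) γ =
      k • liftFun 𝒢 c g (a.1 : LocallyConstant X R) γ
    by_cases hγ : c γ = g <;> simp [liftFun, hγ]

theorem termToSteinberg_apply_of_deg (h : IsTransformationGroupoid 𝒢.toTopGroupoid ρ c) {g : G}
    (a : (ρ.onCR R).ideal g) {γ : Γ} (hγ : c γ = g) :
    (h.termToSteinberg g a).toFun γ = (a.1 : LocallyConstant X R) (𝒢.r γ) := if_pos hγ

theorem termToSteinberg_apply_of_deg_ne (h : IsTransformationGroupoid 𝒢.toTopGroupoid ρ c) {g : G}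
    (a : (ρ.onCR R).ideal g) {γ : Γ} (hγ : c γ ≠ g) :
    (h.termToSteinberg g a).toFun γ = 0 := if_neg hγ

/-- The linear map `∑ a_g δ_g ↦ ∑ (a_g ∘ r) 1_{c⁻¹(g)}` from the partial skew group ring to the
Steinberg algebra. -/
noncomputable def toSteinberg (R : Type*) [CommRing R]
    (h : IsTransformationGroupoid 𝒢.toTopGroupoid ρ c) :
    SkewGroupRing (ρ.onCR R) →ₗ[R] Steinberg R 𝒢 :=
  (ρ.onCR R).formalLift h.termToSteinberg

theorem toSteinberg_delta (h : IsTransformationGroupoid 𝒢.toTopGroupoid ρ c) (g : G)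
    (a : (ρ.onCR R).ideal g) :
    h.toSteinberg R ((ρ.onCR R).delta g a) = h.termToSteinberg g a := formalLift_delta _ _ _ _

theorem toSteinberg_apply (h : IsTransformationGroupoid 𝒢.toTopGroupoid ρ c)
    (x : SkewGroupRing (ρ.onCR R)) (γ : Γ) :
    (h.toSteinberg R x).toFun γ = ((x (c γ)).1 : LocallyConstant X R) (𝒢.r γ) := by
  induction x using Formal.induction with
  | zero => rw [map_zero]; rfl
  | add x y hx hy => rw [map_add, Steinberg.toFun_add, Pi.add_apply, hx, hy]; rfl
  | delta g a =>
    rw [toSteinberg_delta]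
    by_cases hγ : c γ = g
    · subst hγ
      rw [h.termToSteinberg_apply_of_deg a rfl, delta_apply_self]
    · rw [h.termToSteinberg_apply_of_deg_ne a hγ, delta_apply_of_ne _ (Ne.symm hγ)]
      rfl

/-- The convolution of `(a ∘ r) 1_{c⁻¹(g)}` and `(b ∘ r) 1_{c⁻¹(k)}` at `γ` has at most one nonzero
term: the first factor has degree `g` and range `r γ`. -/
theorem termToSteinberg_mul (h : IsTransformationGroupoid 𝒢.toTopGroupoid ρ c) (g k : G)
    (a : (ρ.onCR R).ideal g) (b : (ρ.onCR R).ideal k) :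
    h.termToSteinberg (g * k) ((ρ.onCR R).coeff g k a b) =
      h.termToSteinberg g a * h.termToSteinberg k b := by
  refine Steinberg.ext fun γ => ?_
  rw [Steinberg.toFun_mul, TopGroupoid.conv]
  have hdeg : ∀ p : 𝒢.Composable, p ∈ 𝒢.compMap ⁻¹' {γ} →
      (h.termToSteinberg g a).toFun p.1.1 * (h.termToSteinberg k b).toFun p.1.2 ≠ 0 →
      c p.1.1 = g ∧ c p.1.2 = k ∧ 𝒢.r p.1.1 = 𝒢.r γ ∧ c γ = g * k := by
    rintro p rfl hne
    have h1 : c p.1.1 = g := by_contra fun h' =>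
      left_ne_zero_of_mul hne (h.termToSteinberg_apply_of_deg_ne a h')
    have h2 : c p.1.2 = k := by_contra fun h' =>
      right_ne_zero_of_mul hne (h.termToSteinberg_apply_of_deg_ne b h')
    exact ⟨h1, h2, (𝒢.r_comp _ _ p.2).symm, by rw [← h1, ← h2]; exact h.deg_comp _ _ p.2⟩
  by_cases hγ : c γ = g * k ∧ 𝒢.r γ ∈ ρ.dom g
  · obtain ⟨hc, hr⟩ := hγ
    rw [← h.image_r] at hr
    obtain ⟨α, hα : c α = g, hαr⟩ := hr
    have hαd : 𝒢.d α = 𝒢.r (𝒢.comp (𝒢.inv α) γ ((𝒢.d_inv α).trans hαr)) :=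
      (𝒢.r_inv α).symm.trans (𝒢.r_comp _ _ _).symm
    set β := 𝒢.comp (𝒢.inv α) γ ((𝒢.d_inv α).trans hαr) with hβ
    have hαβ : 𝒢.comp α β hαd = γ := 𝒢.comp_inv_comp hαr
    have hcβ : c β = k := by
      have := h.deg_comp α β hαd
      rw [hαβ, hc, hα] at this
      exact (mul_left_cancel this).symm
    have hsum : ∑ᶠ (p : 𝒢.Composable) (_ : p ∈ 𝒢.compMap ⁻¹' {γ}),
        (h.termToSteinberg g a).toFun p.1.1 * (h.termToSteinberg k b).toFun p.1.2 =
        (h.termToSteinberg g a).toFun α * (h.termToSteinberg k b).toFun β := by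
      let q : 𝒢.Composable := ⟨(α, β), hαd⟩
      refine (finsum_mem_inter_support_eq' _ _ {q} fun p hp => ⟨fun hpγ => ?_, ?_⟩).trans
        finsum_mem_singleton
      · obtain ⟨h1, h2, h3, -⟩ := hdeg p hpγ hp
        obtain ⟨⟨α', β'⟩, hp'⟩ := p
        change c α' = g at h1
        change c β' = k at h2
        change 𝒢.r α' = 𝒢.r γ at h3
        obtain rfl : α' = α := h.injOn_r g h1 hα (h3.trans hαr.symm)
        obtain rfl : β' = β := h.injOn_r k h2 hcβ (hp'.symm.trans hαd)
        rfl
      · rintro rfl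
        exact hαβ
    have hd : ρ.map g⁻¹ (𝒢.r γ) = 𝒢.r β := by
      rw [← hαd, h.d_eq, hα, hαr]
    rw [hsum, h.termToSteinberg_apply_of_deg _ hc,
      h.termToSteinberg_apply_of_deg a hα, h.termToSteinberg_apply_of_deg b hcβ,
      PartialAction.onCR_coeff_apply, hαr, hd]
  · rw [finsum_mem_eq_zero_of_forall_eq_zero]
    · by_cases hc : c γ = g * k
      · rw [h.termToSteinberg_apply_of_deg _ hc, PartialAction.onCR_coeff_apply,
          show (a.1 : LocallyConstant X R) (𝒢.r γ) = 0 from a.2 _ fun hr => hγ ⟨hc, hr⟩, zero_mul]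
      · exact h.termToSteinberg_apply_of_deg_ne _ hc
    · intro p hp
      by_contra hne
      obtain ⟨h1, -, h3, h4⟩ := hdeg p hp hne
      refine hγ ⟨h4, ?_⟩
      rw [← h3, ← h1]
      exact h.r_mem _

theorem toSteinberg_mul (h : IsTransformationGroupoid 𝒢.toTopGroupoid ρ c)
    (x y : SkewGroupRing (ρ.onCR R)) :
    h.toSteinberg R (x * y) = h.toSteinberg R x * h.toSteinberg R y := by
  refine map_mul_of_delta _ h.steinberg_add_mul h.steinberg_mul_add _ (fun g k a b => ?_) x y
  rw [delta_mul_delta, toSteinberg_delta, toSteinberg_delta, toSteinberg_delta,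
    h.termToSteinberg_mul]

theorem apply_eq_zero_of_toSteinberg (h : IsTransformationGroupoid 𝒢.toTopGroupoid ρ c)
    {x : SkewGroupRing (ρ.onCR R)} {g : G} (hx : ∀ γ, c γ = g → (h.toSteinberg R x).toFun γ = 0) :
    x g = 0 := by
  refine Subtype.ext (Subtype.ext (LocallyConstant.ext fun y => ?_))
  by_cases hy : y ∈ ρ.dom g
  · rw [← h.image_r] at hy
    obtain ⟨γ, rfl, rfl⟩ := hy
    rw [← h.toSteinberg_apply, hx γ rfl]
    rfl
  · exact (x g).2 y hy

theorem injective_toSteinberg (h : IsTransformationGroupoid 𝒢.toTopGroupoid ρ c) :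
    Function.Injective (h.toSteinberg R) := by
  rw [← LinearMap.ker_eq_bot, LinearMap.ker_eq_bot']
  intro x hx
  refine DFinsupp.ext fun g => h.apply_eq_zero_of_toSteinberg fun γ _ => ?_
  rw [hx]
  rfl

/-- Every homogeneous part of an element of the Steinberg algebra has the form
`(a ∘ r) 1_{c⁻¹(g)}`: the function `a` is obtained by summation over the fibres of `r`, each of
which contains at most one arrow of degree `g`. -/
theorem exists_coeff (h : IsTransformationGroupoid 𝒢.toTopGroupoid ρ c) (f : Steinberg R 𝒢)
    (g : G) : ∃ a : (ρ.onCR R).ideal g, ∀ γ, c γ = g →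
      (a.1 : LocallyConstant X R) (𝒢.r γ) = f.toFun γ := by
  classical
  let F : Γ → R := fun γ => if c γ = g then f.toFun γ else 0
  have hF : IsLocallyConstant F := by
    rw [IsLocallyConstant.iff_eventually_eq]
    intro γ
    filter_upwards [h.eventually_deg_eq γ, f.1.isLocallyConstant.eventually_eq γ] with γ' h1 h2
    have h2' : f.toFun γ' = f.toFun γ := h2
    simp only [F, h1, h2']
  have hFK : IsCompact (Function.support F) := by
    refine IsCompact.of_isClosed_subset f.2 (isClosed_support hF) fun γ hγ hf => hγ ?_
    by_cases hc : c γ = g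
    · exact (if_pos hc).trans hf
    · exact if_neg hc
  have hr : IsLocalHomeomorph 𝒢.r := by
    rw [isLocalHomeomorph_iff_isOpenEmbedding_restrict]
    exact fun γ => ⟨_, h.eventually_deg_eq γ,
      (h.isOpenBisection (h.isOpen_fibre (c γ)) fun _ hγ => hγ).2.2⟩
  let a : X → R := fun x => ∑ᶠ (γ : Γ) (_ : γ ∈ 𝒢.r ⁻¹' {x}), F γ
  have ha : IsLocallyConstant a := isLocallyConstant_fibreSum hr hF hFK
  have ha0 : ∀ x, x ∉ 𝒢.r '' Function.support F → a x = 0 := fun x hx =>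
    finsum_mem_eq_zero_of_forall_eq_zero fun γ hγ => by_contra fun hne => hx ⟨γ, hne, hγ⟩
  have haK : IsCompact (Function.support a) :=
    (hFK.image 𝒢.continuous_r).of_isClosed_subset (isClosed_support ha)
      fun x hx => by_contra fun hx' => hx (ha0 x hx')
  refine ⟨⟨⟨⟨a, ha⟩, haK⟩, fun x hx => ha0 x ?_⟩, fun γ hγ => ?_⟩
  · rintro ⟨γ, hγ, rfl⟩
    have hc : c γ = g := by_contra fun hc => hγ (if_neg hc)
    exact hx (hc ▸ h.r_mem γ)
  · change a (𝒢.r γ) = _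
    have hsum : a (𝒢.r γ) = ∑ᶠ (γ' : Γ) (_ : γ' ∈ ({γ} : Set Γ)), F γ' := by
      refine finsum_mem_inter_support_eq' _ _ _ fun γ' hγ' => ⟨fun e => ?_, ?_⟩
      · have hc : c γ' = g := by_contra fun hc => hγ' (if_neg hc)
        exact h.injOn_r g hc hγ e
      · rintro rfl
        rfl
    rw [hsum, finsum_mem_singleton]
    exact if_pos hγ

theorem surjective_toSteinberg (h : IsTransformationGroupoid 𝒢.toTopGroupoid ρ c) :
    Function.Surjective (h.toSteinberg R) := by
  classical
  intro f
  choose a ha using h.exists_coeff f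
  have hfin := h.finite_image_deg f.2
  refine ⟨DFinsupp.mk hfin.toFinset fun g => a g, Steinberg.ext fun γ => ?_⟩
  rw [h.toSteinberg_apply]
  by_cases hγ : c γ ∈ hfin.toFinset
  · rw [DFinsupp.mk_of_mem hγ]
    exact ha _ γ rfl
  · rw [DFinsupp.mk_of_notMem hγ]
    by_contra hne
    exact hγ (hfin.mem_toFinset.2 ⟨γ, fun h0 => hne (Eq.symm h0), rfl⟩)

/-- The Steinberg algebra of the transformation groupoid of a partial action is the partial skew
group ring. -/
theorem gradedIso_steinberg (R : Type*) [CommRing R]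
    (h : IsTransformationGroupoid 𝒢.toTopGroupoid ρ c) :
    GradedIso (groupGrading (ρ.onCR R)) (Steinberg.component (R := R) (𝒢 := 𝒢) c) := by
  refine ⟨LinearEquiv.ofBijective (h.toSteinberg R)
    ⟨h.injective_toSteinberg, h.surjective_toSteinberg⟩, h.toSteinberg_mul, fun g => ?_⟩
  ext f
  constructor
  · rintro ⟨_, ⟨a, rfl⟩, rfl⟩ γ hγ
    by_contra hc
    refine hγ ?_
    change (h.toSteinberg R ((ρ.onCR R).delta g a)).toFun γ = 0
    rw [toSteinberg_delta, h.termToSteinberg_apply_of_deg_ne a hc]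
  · intro hf
    obtain ⟨x, rfl⟩ := h.surjective_toSteinberg f
    refine ⟨x, (mem_groupGrading _).2 fun k hk => ?_, rfl⟩
    exact h.apply_eq_zero_of_toSteinberg fun γ hγ =>
      by_contra fun hne => hk (hγ.symm.trans (hf γ hne))

end IsTransformationGroupoid

/-! ### The four algebras -/

/-- The comparison of the Steinberg algebra of a transformation groupoid with two skew inverse
semigroup rings graded over the partial action of the group, all three being graded isomorphic to
the partial skew group ring. -/
theorem isGradedAlgebra_and_gradedIso {R G Y Γ S T : Type*} [CommRing R] [Group G]
    [TopologicalSpace Y] [T2Space Y] [TopologicalSpace Γ] [T2Space Γ] [InverseSemigroup S]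
    [InverseSemigroup T] {𝒢 : AmpleGroupoid Y Γ} {c : Γ → G} {ρ : PartialAction G Y}
    {π : PartialAction S Y} {D : S → G → Prop} {τ : PartialAction T Y} {E : T → G → Prop}
    (h : IsTransformationGroupoid 𝒢.toTopGroupoid ρ c) (hπ : IsGradedOver π ρ D)
    (hτ : IsGradedOver τ ρ E) :
    (IsGradedAlgebra (Steinberg.component (R := R) (𝒢 := 𝒢) c) ∧
      IsGradedAlgebra (fun g => (π.onCR R).component {s | D s g}) ∧
      IsGradedAlgebra (fun g => (τ.onCR R).component {s | E s g}) ∧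
      IsGradedAlgebra (groupGrading (ρ.onCR R))) ∧
    GradedIso (Steinberg.component (R := R) (𝒢 := 𝒢) c)
      (fun g => (π.onCR R).component {s | D s g}) ∧
    GradedIso (fun g => (π.onCR R).component {s | D s g})
      (fun g => (τ.onCR R).component {s | E s g}) ∧
    GradedIso (fun g => (τ.onCR R).component {s | E s g}) (groupGrading (ρ.onCR R)) := by
  have hρ := ρ.isGradedAlgebra_groupGrading (R := R)
  have e₁ := (h.gradedIso_steinberg R).symm
  have e₂ := hπ.gradedIso R
  have e₃ := hτ.gradedIso R
  exact ⟨⟨hρ.of_gradedIso e₁, hρ.of_gradedIso e₂, hρ.of_gradedIso e₃, hρ⟩,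
    e₁.trans e₂.symm, e₂.trans e₃.symm, e₃⟩

end PartialSkew

theorem mainTheorem2 {R G X : Type*} [CommRing R] [Group G] [TopologicalSpace G]
    [DiscreteTopology G] [TopologicalSpace X] [T2Space X] [LocallyCompactSpace X]
    [TotallyDisconnectedSpace X] (φ : PartialSkew.GroupPartialAction G X)
    (_hφ : ∀ g, IsClopen (φ.dom g)) (U : Set X) (hUc : IsClopen U) (hU : φ.IsInvariant U) :
    -- the four algebras attached to `U` are `G`-graded and graded isomorphic
    ((PartialSkew.IsGradedAlgebra (φ.steinbergGradingOn R hU hUc.isOpen) ∧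
      PartialSkew.IsGradedAlgebra (PartialSkew.bisectionGrading (φ.bisectionCROn R hU)) ∧
      PartialSkew.IsGradedAlgebra (PartialSkew.exelGrading (φ.exelCROn R hU)) ∧
      PartialSkew.IsGradedAlgebra (PartialSkew.groupGrading (φ.groupCROn R hU))) ∧
      PartialSkew.GradedIso (φ.steinbergGradingOn R hU hUc.isOpen)
        (PartialSkew.bisectionGrading (φ.bisectionCROn R hU)) ∧
      PartialSkew.GradedIso (PartialSkew.bisectionGrading (φ.bisectionCROn R hU))
        (PartialSkew.exelGrading (φ.exelCROn R hU)) ∧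
      PartialSkew.GradedIso (PartialSkew.exelGrading (φ.exelCROn R hU))
        (PartialSkew.groupGrading (φ.groupCROn R hU))) ∧
    -- the same for the whole space `X`
    ((PartialSkew.IsGradedAlgebra (φ.steinbergGrading R) ∧
      PartialSkew.IsGradedAlgebra (PartialSkew.bisectionGrading (φ.bisectionCR R)) ∧
      PartialSkew.IsGradedAlgebra (PartialSkew.exelGrading (φ.exelCR R)) ∧
      PartialSkew.IsGradedAlgebra (PartialSkew.groupGrading (φ.groupCR R))) ∧
      PartialSkew.GradedIso (φ.steinbergGrading R)
        (PartialSkew.bisectionGrading (φ.bisectionCR R)) ∧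
      PartialSkew.GradedIso (PartialSkew.bisectionGrading (φ.bisectionCR R))
        (PartialSkew.exelGrading (φ.exelCR R)) ∧
      PartialSkew.GradedIso (PartialSkew.exelGrading (φ.exelCR R))
        (PartialSkew.groupGrading (φ.groupCR R))) := by
  have h := φ.isTransformationGroupoid.isGradedOver_bisectionAction
  have h' := φ.isGradedOver_exelAction
  exact ⟨PartialSkew.isGradedAlgebra_and_gradedIso
      (φ.isTransformationGroupoid_reduction hUc.isOpen hU)
      (h.restrict hUc.isOpen _ hU) (h'.restrict hUc.isOpen _ hU),
    PartialSkew.isGradedAlgebra_and_gradedIso φ.isTransformationGroupoid h h'⟩
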